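/- Let $d\in\mathbb N$ and let $(Y,J)$ be a spectrally-positive Markov additive process: $J$ is a continuous-time Markov chain on $\{1,\dots,d\}$ (not necessarily irreducible) with transition rate matrix $Q=(q_{ij})$, whose rows sum to zero; while $J$ is in state $i$, the process $Y$ (with $Y(0)=0$) evolves as a Lévy process $Y_i$ without negative jumps, with Laplace exponent $\varphi_i(\alpha)=\log\mathbb E e^{-\alpha Y_i(1)}$; at each transition of $J$ from $i$ to $j\neq i$, $Y$ makes an additional jump distributed as a non-negative random variable $B_{ij}$ with Laplace–Stieltjes transform $\mathscr B_{ij}(\alpha)=\mathbb E e^{-\alpha B_{ij}}$ (and $\mathscr B_{ii}\equiv1$). The chain, the Lévy processes and all the jumps at transitions are independent. Write $\mathbb P_i,\mathbb E_i$ for probability and expectation given $J(0)=i$. Let $$F_{ij}(\alpha)=q_{ij}\mathscr B_{ij}(\alpha)+\varphi_i(\alpha)\mathbf 1_{\{i=j\}}.$$ Fix $K>0$ and $\beta>0$, and let $T_\beta$ be an exponential random variable with parameter $\beta$, independent of everything else. For $u\ge0$ let $\sigma(u)=\inf\{t\ge0:-Y(t)>u\}$ and $\tau(u)=\inf\{t\ge0:Y(t)>u\}$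 (with $\inf\emptyset=\infty$). For $x\in[0,K]$, $u\ge 0$ and $\alpha\ge0$ define the $d\times d$ matrices with entries $$\delta_{-,ij}(x)=\mathbb P_i\big(\sigma(x)\le\min\{\tau(K-x),T_\beta\},\,J(\sigma(x))=j\big),$$ $$\eta_{ij}(u,\alpha,\beta)=\mathbb E_i\big(e^{-\alpha(Y(\tau(u))-u)}\mathbf 1_{\{\tau(u)\le T_\beta,\,J(\tau(u))=j\}}\big),$$ $$\delta_{\star,ij}(x)=e^{-\alpha x}\,\mathbb E_i\big(e^{-\alpha Y(T_\beta)}\mathbf 1_{\{T_\beta\le\min\{\sigma(x),\tau(K-x)\},\,J(T_\beta)=j\}}\big).$$ Then, for all $\alpha\ge0$, $\beta>0$ and $x\in[0,K]$: 1. If $\beta I-F(\alpha)$ is invertible, then with $\Phi(\alpha,\beta)=\beta(\beta I-F(\alpha))^{-1}$, $$\delta_\star(x)=e^{-\alpha x}\Big(I-e^{\alpha x}\delta_-(x)-e^{-\alpha(K-x)}\eta(K-x,\alpha,\beta)+e^{-\alpha(K-x)}\delta_-(x)\,\eta(K,\alpha,\beta)\Big)\Phi(\alpha,\beta).$$ 2.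 If $\mathbb E_i e^{-\alpha Y(T_\beta)}<\infty$ for every $i$, then $\beta I-F(\alpha)$ is invertible, the matrix with entries $\mathbb E_i\big(e^{-\alpha Y(T_\beta)}\mathbf 1_{\{J(T_\beta)=j\}}\big)$ equals $\beta(\beta I-F(\alpha))^{-1}$, and the identity in 1 holds with $\Phi(\alpha,\beta)$ equal to this matrix. -/

import Mathlib

open MeasureTheory ProbabilityTheory
open scoped NNReal ENNReal Topology

noncomputable section

namespace MAPQueue

/-- Right-continuous with left limits, for a path indexed by time in `[0, ∞)`. -/
def IsCadlag {E : Type*} [TopologicalSpace E] (f : ℝ≥0 → E) : Prop :=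
  ∀ t, ContinuousWithinAt f (Set.Ici t) t ∧ ∃ l, Filter.Tendsto f (𝓝[<] t) (𝓝 l)

/-- A spectrally-positive Lévy process: a càdlàg process started in `0` with independent and
stationary increments whose paths have no negative jumps. -/
structure IsSpectrallyPositiveLevy {Ω : Type*} [MeasurableSpace Ω] (P : Measure Ω)
    (X : ℝ≥0 → Ω → ℝ) : Prop where
  measurable : ∀ t, Measurable (X t)
  zero : ∀ ω, X 0 ω = 0
  cadlag : ∀ ω, IsCadlag (fun t => X t ω)
  no_neg_jump : ∀ ω t, Function.leftLim (fun s => X s ω) t ≤ X t ω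
  indep_increments : HasIndepIncrements X P
  stationary_increments : ∀ s h,
    IdentDistrib (fun ω => X (s + h) ω - X s ω) (X h) P P

/-- `Q` is the transition rate matrix of a conservative continuous-time Markov chain. -/
structure IsRateMatrix {d : ℕ} (Q : Matrix (Fin d) (Fin d) ℝ) : Prop where
  nonneg : ∀ i j, i ≠ j → 0 ≤ Q i j
  row_sum : ∀ i, ∑ j, Q i j = 0

/-- `X` is a càdlàg continuous-time Markov chain with rate matrix `Q` and initial state `i`,
described by its finite-dimensional distributions. -/
structure IsMarkovChainFrom {d : ℕ} {Ω : Type*} [MeasurableSpace Ω] (P : Measure Ω)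
    (Q : Matrix (Fin d) (Fin d) ℝ) (i : Fin d) (X : ℝ≥0 → Ω → Fin d) : Prop where
  measurable : ∀ t, Measurable (X t)
  cadlag : ∀ ω, IsCadlag (fun t => X t ω)
  init : ∀ ω, X 0 ω = i
  fdd : ∀ (n : ℕ) (t : ℕ → ℝ≥0) (s : ℕ → Fin d), Monotone t → t 0 = 0 → s 0 = i →
    P.real {ω | ∀ m ≤ n, X (t m) ω = s m} =
      ∏ m ∈ Finset.range n,
        (NormedSpace.exp (((t (m + 1) - t m : ℝ≥0) : ℝ) • Q)) (s m) (s (m + 1))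

/-- Labels of the independent sources of randomness that drive the free process. -/
inductive Source (d : ℕ) where
  | chain : Source d
  | levy (k : Fin d) : Source d
  | mark (n : ℕ) (k l : Fin d) : Source d

/-- The σ-algebra generated by one source of randomness. -/
@[reducible] def sourceSigma {d : ℕ} {Ω : Type*} (J : ℝ≥0 → Ω → Fin d) (L : Fin d → ℝ≥0 → Ω → ℝ)
    (B : ℕ → Fin d → Fin d → Ω → ℝ≥0) : Source d → MeasurableSpace Ω
  | .chain => MeasurableSpace.comap (fun ω t => J t ω) inferInstance
  | .levy k => MeasurableSpace.comap (fun ω t => L k t ω) inferInstance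
  | .mark n k l => MeasurableSpace.comap (B n k l) inferInstance

/-- The primitives of a spectrally-positive Markov additive process with background states
`Fin d`. For every initial state `i`, `J i` is the background process started in `i`;
`levy k` is the Lévy process that is active in state `k`; `mark n k l` is the size of the job
that arrives at the `n`-th transition from `k` to `l` (counted from `n = 0`), with the convention
that `mark n k k` vanishes. For each `i` the processes `J i`, `levy k` and the variables
`mark n k l` are mutually independent. Expectations `E_i` of functionals of the process started
in state `i` are expectations of the functional evaluated at `J i`. -/
structure Model {Ω : Type*} [MeasurableSpace Ω] (P : Measure Ω) (d : ℕ) where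
  Q : Matrix (Fin d) (Fin d) ℝ
  J : Fin d → ℝ≥0 → Ω → Fin d
  levy : Fin d → ℝ≥0 → Ω → ℝ
  mark : ℕ → Fin d → Fin d → Ω → ℝ≥0
  rate : IsRateMatrix Q
  chain : ∀ i, IsMarkovChainFrom P Q i (J i)
  isLevy : ∀ k, IsSpectrallyPositiveLevy P (levy k)
  mark_measurable : ∀ n k l, Measurable (mark n k l)
  mark_law : ∀ n k l, IdentDistrib (mark n k l) (mark 0 k l) P P
  mark_diag : ∀ n k ω, mark n k k ω = 0
  indep : ∀ i, iIndep (sourceSigma (J i) levy mark) P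

/-- Time spent in state `k` during `[0, t)`. -/
def occupation {d : ℕ} (w : ℝ≥0 → Fin d) (k : Fin d) (t : ℝ≥0) : ℝ≥0 :=
  (volume {s : ℝ | 0 ≤ s ∧ s < t ∧ w s.toNNReal = k}).toNNReal

/-- Number of transitions from `k` to `l` during `(0, t]`, for `k ≠ l`. -/
def transitions {d : ℕ} (w : ℝ≥0 → Fin d) (k l : Fin d) (t : ℝ≥0) : ℕ :=
  {s : ℝ≥0 | 0 < s ∧ s ≤ t ∧ Function.leftLim w s = k ∧ w s = l}.ncard

/-- First passage time below `-u`: `σ(u) = inf {t ≥ 0 : -f t > u}`, with `inf ∅ = ∞`. -/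
def sigmaTime (f : ℝ≥0 → ℝ) (u : ℝ) : ℝ≥0∞ := ⨅ (t : ℝ≥0) (_ : u < -f t), (t : ℝ≥0∞)

/-- First passage time strictly above `u`: `τ(u) = inf {t ≥ 0 : f t > u}`, with `inf ∅ = ∞`. -/
def tauTime (f : ℝ≥0 → ℝ) (u : ℝ) : ℝ≥0∞ := ⨅ (t : ℝ≥0) (_ : u < f t), (t : ℝ≥0∞)

namespace Model

variable {Ω : Type*} [MeasurableSpace Ω] {P : Measure Ω} {d : ℕ} (M : Model P d)

/-- The free process started in background state `i` and level `0`. While the background process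
is in state `k` the process moves according to `levy k` (run on the clock that counts the time
spent in `k`), and at each transition from `k` to `l ≠ k` it makes an additional upward jump given
by the next of the variables `mark n k l`. -/
def Y (i : Fin d) (t : ℝ≥0) (ω : Ω) : ℝ :=
  ∑ k, M.levy k (occupation (fun s => M.J i s ω) k t) ω +
    ∑ k, ∑ l ∈ Finset.univ.erase k,
      ∑ n ∈ Finset.range (transitions (fun s => M.J i s ω) k l t), (M.mark n k l ω : ℝ)

/-- The σ-algebra generated by everything that drives the free process started in state `i`. -/
@[reducible] def sigmaAlg (i : Fin d) : MeasurableSpace Ω := ⨆ s, sourceSigma (M.J i) M.levy M.mark s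

/-- `T` is a killing time: exponentially distributed with parameter `β` and independent of
everything else. -/
structure IsKillingTime (β : ℝ) (T : Ω → ℝ≥0) : Prop where
  measurable : Measurable T
  law : P.map (fun ω => (T ω : ℝ)) = expMeasure β
  indep : ∀ i, Indep (MeasurableSpace.comap T inferInstance) (M.sigmaAlg i) P

/-- Laplace exponent `φ_k(α) = log E exp(-α Y_k(1))` of the Lévy process in state `k`. -/
def laplaceExponent (k : Fin d) (α : ℝ) : ℝ := Real.log (∫ ω, Real.exp (-α * M.levy k 1 ω) ∂P)

/-- Laplace-Stieltjes transform of the jobs at transitions from `k` to `l`. -/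
def markLST (k l : Fin d) (α : ℝ) : ℝ := ∫ ω, Real.exp (-α * M.mark 0 k l ω) ∂P

/-- `F_{ij}(α) = q_{ij} B_{ij}(α) + φ_i(α) 1{i = j}`. -/
def F (α : ℝ) : Matrix (Fin d) (Fin d) ℝ :=
  Matrix.of fun i j => M.Q i j * M.markLST i j α + if i = j then M.laplaceExponent i α else 0

def sigma (i : Fin d) (u : ℝ) (ω : Ω) : ℝ≥0∞ := sigmaTime (fun t => M.Y i t ω) u

def tau (i : Fin d) (u : ℝ) (ω : Ω) : ℝ≥0∞ := tauTime (fun t => M.Y i t ω) u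

/-- `δ_{-,ij}(u₋, u₊) = P_i(σ(u₋) ≤ min {τ(u₊), T}, J(σ(u₋)) = j)`. -/
def deltaMinus (T : Ω → ℝ≥0) (u v : ℝ) : Matrix (Fin d) (Fin d) ℝ :=
  Matrix.of fun i j => P.real {ω | M.sigma i u ω ≤ min (M.tau i v ω) (T ω) ∧
    M.J i (M.sigma i u ω).toNNReal ω = j}

/-- `δ_{⋆,ij}(x) = e^{-αx} E_i(e^{-α Y(T)}; T ≤ min {σ(x), τ(K - x)}, J(T) = j)`. -/
def deltaStar (T : Ω → ℝ≥0) (K α x : ℝ) : Matrix (Fin d) (Fin d) ℝ :=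
  Matrix.of fun i j => Real.exp (-α * x) *
    ∫ ω in {ω | (T ω : ℝ≥0∞) ≤ min (M.sigma i x ω) (M.tau i (K - x) ω) ∧ M.J i (T ω) ω = j},
      Real.exp (-α * M.Y i (T ω) ω) ∂P

/-- `η_{ij}(u) = E_i(e^{-α (Y(τ(u)) - u)}; τ(u) ≤ T, J(τ(u)) = j)`. -/
def eta (T : Ω → ℝ≥0) (u α : ℝ) : Matrix (Fin d) (Fin d) ℝ :=
  Matrix.of fun i j =>
    ∫ ω in {ω | M.tau i u ω ≤ (T ω : ℝ≥0∞) ∧ M.J i (M.tau i u ω).toNNReal ω = j},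
      Real.exp (-α * (M.Y i (M.tau i u ω).toNNReal ω - u)) ∂P

/-- `Φ_{ij} = E_i(e^{-α Y(T)}; J(T) = j)`; meaningful when `e^{-α Y(T)}` is integrable for every
initial state. -/
def Phi (T : Ω → ℝ≥0) (α : ℝ) : Matrix (Fin d) (Fin d) ℝ :=
  Matrix.of fun i j => ∫ ω in {ω | M.J i (T ω) ω = j}, Real.exp (-α * M.Y i (T ω) ω) ∂P

end Model

end MAPQueue

end

/-! Write `ζ` for the first exit time of `Y` from `[-x, K - x]`, and let `R` be the matrix with
entries `∫ e^{-βs} E_i(e^{-αY(s)}; s ≤ ζ, J(s) = j) ds`. Independence of `T` gives `δ_⋆(x) = e^{-αx}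
β R`, so everything rests on computing `R (βI - F(α))`.

The matrix `E_i(e^{-αY(t)}; J(t) = j)` is `exp(tF(α))`. The strong Markov property at `ζ` splits it
into the part killed at `ζ` and an integral of `e^{-αY(ζ)} exp((t - ζ)F)` over `{ζ < t}`. Multiply
by `e^{-βt}(βI - F)`, which turns the semigroup into minus the derivative of `e^{-βt} exp(tF)`, and
integrate over `[0, U]`. The terms containing `exp` at the endpoint `U` recombine, by the same
splitting at time `U`, into `e^{-βU}` times the killed semigroup. The latter is at most `e^{αx}`,
because the level stays above `-x` up to `ζ`. Letting `U → ∞` yields `R (βI - F) = I - E(e^{-βζ -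
αY(ζ)}; J(ζ))` (`killedResolvent_mul`). No comparison between `β` and the growth of `exp(tF)`
enters, so invertibility of `βI - F` is all that part 1 requires.

The exit term is computed in `exitTransform_eq`. Without negative jumps the process leaves below
exactly at `-x`, which gives `e^{αx} δ_-`. An exit above is a passage above `K - x` that is not
preceded by a passage below `-x`. After reaching `-x` the process restarts, and has to pass above
`K` relative to its new origin. Hence the difference of `η(K - x)` and `δ_- η(K)`. The factors
`e^{-β·}` are the probabilities that `T` exceeds the passage times.

Most of the work shows that the concrete process, made of time-changed Lévy processes and marks, has
these properties. Given the chain, the increments of `Y` have explicit transforms in terms of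
occupation times and transition counts. These are limits of products over fine meshes, whose
expectations are entries of powers of weighted transition matrices. This gives both the Markov
additive property on grids (`isMAP`) and the formula `exp(tF(α))` (`transform_neg_eq`).
Approximating entrance times by dyadic times then gives `strongMarkov`. Exponential moments of the
Lévy processes come from submultiplicativity of their downward passage probabilities
(`exists_dominating`).

For part 2, integrability makes `e^{-βs} exp(sF)` integrable on `(0, ∞)`, and integrating its
derivative gives `Φ (βI - F) = βI`. -/

open MeasureTheory ProbabilityTheory
open scoped NNReal ENNReal Topology

noncomputable section

namespace MAPQueue

/-! ### Càdlàg paths with finitely many values: transition counts and occupation times on fine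
meshes. -/

section FinitePaths

variable {d : ℕ} {w : ℝ≥0 → Fin d}

lemma leftLim_eq_of_forall_Ico {a u : ℝ≥0} {c : Fin d} (hau : a < u)
    (h : ∀ s, a ≤ s → s < u → w s = c) : Function.leftLim w u = c := by
  have : (𝓝[<] u).NeBot := nhdsLT_neBot_of_exists_lt ⟨a, hau⟩
  refine leftLim_eq_of_tendsto (tendsto_const_nhds.congr' ?_)
  filter_upwards [Ioo_mem_nhdsLT hau] with s hs using (h s hs.1.le hs.2).symm

lemma IsCadlag.exists_locally_constant (hw : IsCadlag w) (v : ℝ≥0) :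
    ∃ δ > (0 : ℝ), ∃ c, (∀ u < v, u ∈ Metric.ball v δ → w u = c) ∧
      ∀ u, v ≤ u → u ∈ Metric.ball v δ → w u = w v := by
  obtain ⟨hr, c, hl⟩ := hw v
  have h1 : ∀ᶠ u in 𝓝[Set.Ici v] v, w u = w v := by
    have := hr.tendsto
    rw [nhds_discrete] at this
    exact Filter.tendsto_pure.1 this
  have h2 : ∀ᶠ u in 𝓝[<] v, w u = c := by
    rw [nhds_discrete] at hl
    exact Filter.tendsto_pure.1 hl
  obtain ⟨δ₁, hδ₁, h1⟩ := Metric.mem_nhdsWithin_iff.1 h1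
  obtain ⟨δ₂, hδ₂, h2⟩ := Metric.mem_nhdsWithin_iff.1 h2
  exact ⟨min δ₁ δ₂, lt_min hδ₁ hδ₂, c,
    fun u hu hb => h2 ⟨Metric.ball_subset_ball (min_le_right _ _) hb, hu⟩,
    fun u hu hb => h1 ⟨Metric.ball_subset_ball (min_le_left _ _) hb, hu⟩⟩

/-- On a short enough interval a càdlàg path with finitely many values jumps at most once. -/
lemma IsCadlag.exists_mesh (hw : IsCadlag w) (T : ℝ≥0) :
    ∃ δ : ℝ≥0, 0 < δ ∧ ∀ a b, a ≤ b → b ≤ T → b < a + δ →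
      (∀ k l, k ≠ l →
        {s : ℝ≥0 | a < s ∧ s ≤ b ∧ Function.leftLim w s = k ∧ w s = l}.Finite ∧
        {s : ℝ≥0 | a < s ∧ s ≤ b ∧ Function.leftLim w s = k ∧ w s = l}.ncard =
          if w a = k ∧ w b = l then 1 else 0) ∧
      (w a = w b → ∀ u, a ≤ u → u ≤ b → w u = w b) := by
  choose δ hδ c hl hr using hw.exists_locally_constant
  -- Around every `v` the path is constant on either side of `v`. A Lebesgue number of the cover by
  -- these balls puts each short interval `[a, b]` inside a single ball, where the only possible
  -- jump is at its centre `v`.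
  obtain ⟨ε, hε, hcov⟩ := lebesgue_number_lemma_of_metric (s := Set.Icc 0 T)
    (c := fun v => Metric.ball v (δ v)) isCompact_Icc (fun _ => Metric.isOpen_ball)
    (fun v _ => Set.mem_iUnion.2 ⟨v, Metric.mem_ball_self (hδ v)⟩)
  refine ⟨ε.toNNReal, by simpa using hε, fun a b hab hbT hba => ?_⟩
  obtain ⟨v, hv⟩ := hcov a ⟨zero_le, hab.trans hbT⟩
  have hin : ∀ u, a ≤ u → u ≤ b → u ∈ Metric.ball v (δ v) := fun u hau hub => hv <| by
    rw [Metric.mem_ball, NNReal.dist_eq, abs_of_nonneg (by simpa using hau)]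
    have h1 : (u : ℝ) ≤ b := hub
    have h2 : (b : ℝ) < a + ε.toNNReal := by exact_mod_cast hba
    rw [Real.coe_toNNReal _ hε.le] at h2
    linarith
  -- `w` is constant on `[a, b]`
  have const : ∀ e, (∀ u, a ≤ u → u ≤ b → w u = e) →
      (∀ k l, k ≠ l →
        {s : ℝ≥0 | a < s ∧ s ≤ b ∧ Function.leftLim w s = k ∧ w s = l}.Finite ∧
        {s : ℝ≥0 | a < s ∧ s ≤ b ∧ Function.leftLim w s = k ∧ w s = l}.ncard =
          if w a = k ∧ w b = l then 1 else 0) ∧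
      (w a = w b → ∀ u, a ≤ u → u ≤ b → w u = w b) := by
    intro e he
    refine ⟨fun k l hkl => ?_, fun _ u h1 h2 => (he u h1 h2).trans (he b hab le_rfl).symm⟩
    have : {s : ℝ≥0 | a < s ∧ s ≤ b ∧ Function.leftLim w s = k ∧ w s = l} = ∅ := by
      ext s
      simp only [Set.mem_ofPred_eq, Set.mem_empty_iff_false, iff_false, not_and]
      intro h1 h2 h3 h4
      rw [leftLim_eq_of_forall_Ico h1 (fun r hr1 hr2 => he r hr1 (hr2.le.trans h2))] at h3
      exact hkl (h3.symm.trans ((he s h1.le h2).symm.trans h4))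
    rw [this]
    refine ⟨Set.finite_empty, ?_⟩
    rw [Set.ncard_empty, if_neg]
    rintro ⟨h1, h2⟩
    exact hkl (h1.symm.trans ((he a le_rfl hab).trans ((he b hab le_rfl).symm.trans h2)))
  rcases le_or_gt v a with hva | hav
  · exact const (w v) fun u h1 h2 => hr v u (hva.trans h1) (hin u h1 h2)
  rcases lt_or_ge b v with hbv | hvb
  · exact const (c v) fun u h1 h2 => hl v u (h2.trans_lt hbv) (hin u h1 h2)
  by_cases hc : c v = w v
  · refine const (w v) fun u h1 h2 => ?_
    rcases lt_or_ge u v with h | h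
    · exact (hl v u h (hin u h1 h2)).trans hc
    · exact hr v u h (hin u h1 h2)
  have hwa : w a = c v := hl v a hav (hin a le_rfl hab)
  have hwb : w b = w v := hr v b hvb (hin b hab le_rfl)
  refine ⟨fun k l hkl => ?_, fun h => absurd (hwa.symm.trans (h.trans hwb)) hc⟩
  -- In the remaining case `a < v ≤ b` and the path does jump at `v`, so `w a` and `w b` are the
  -- left limit and the value at `v`.
  have key : {s : ℝ≥0 | a < s ∧ s ≤ b ∧ Function.leftLim w s = k ∧ w s = l} =
      if w a = k ∧ w b = l then {v} else ∅ := by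
    have hlv : Function.leftLim w v = c v := leftLim_eq_of_forall_Ico hav
      fun s h1 h2 => hl v s h2 (hin s h1 (h2.le.trans hvb))
    have hne : ∀ s, a < s → s ≤ b → s ≠ v → Function.leftLim w s = w s := by
      intro s h1 h2 h3
      rcases lt_or_gt_of_ne h3 with h | h
      · rw [hl v s h (hin s h1.le h2)]
        exact leftLim_eq_of_forall_Ico h1
          fun r h4 h5 => hl v r (h5.trans h) (hin r h4 (h5.le.trans h2))
      · rw [hr v s h.le (hin s h1.le h2)]
        exact leftLim_eq_of_forall_Ico h
          fun r h4 h5 => hr v r h4 (hin r (hav.le.trans h4) (h5.le.trans h2))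
    ext s
    constructor
    · rintro ⟨h1, h2, h3, h4⟩
      by_cases hs : s = v
      · subst hs
        rw [if_pos ⟨hwa.trans (hlv.symm.trans h3), hwb.trans h4⟩]; rfl
      · exact absurd (h3.symm.trans ((hne s h1 h2 hs).trans h4)) hkl
    · split_ifs with h
      · rintro rfl
        exact ⟨hav, hvb, hlv.trans (hwa.symm.trans h.1), hwb.symm.trans h.2⟩
      · exact fun h => h.elim
  rw [key]
  split_ifs with h <;> simp

/-- Compactness of `[0, t]`: finitely many short intervals cover it, each with at most one jump.
Steps of length `δ / 2` keep the strict inequality required of the mesh. -/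
lemma IsCadlag.finite_transitions (hw : IsCadlag w) {k l : Fin d} (hkl : k ≠ l) (t : ℝ≥0) :
    {s : ℝ≥0 | 0 < s ∧ s ≤ t ∧ Function.leftLim w s = k ∧ w s = l}.Finite := by
  obtain ⟨δ, hδ, h⟩ := hw.exists_mesh t
  have : ∀ n : ℕ, ∀ u ≤ t, u ≤ n * (δ / 2) →
      {s : ℝ≥0 | 0 < s ∧ s ≤ u ∧ Function.leftLim w s = k ∧ w s = l}.Finite := by
    intro n
    induction n with
    | zero =>
      intro u _ hu
      refine Set.Finite.subset Set.finite_empty fun s hs => ?_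
      simp only [Nat.cast_zero, zero_mul, nonpos_iff_eq_zero] at hu
      exact absurd (hs.1.trans_le (hs.2.1.trans hu.le)) (lt_irrefl _)
    | succ n ih =>
      intro u hut hu
      have h1 : u - δ / 2 ≤ n * (δ / 2) := by
        rw [tsub_le_iff_right]; push_cast at hu; linarith
      have h2 : u < (u - δ / 2) + δ :=
        (le_tsub_add (a := δ / 2)).trans_lt (add_lt_add_right (half_lt_self hδ) _)
      refine ((ih _ (tsub_le_self.trans hut) h1).union
        ((h (u - δ / 2) u tsub_le_self hut h2).1 k l hkl).1).subset ?_
      rintro s ⟨hs0, hs1, hs2⟩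
      rcases le_or_gt s (u - δ / 2) with h3 | h3
      · exact Or.inl ⟨hs0, h3, hs2⟩
      · exact Or.inr ⟨h3, hs1, hs2⟩
  obtain ⟨n, hn⟩ := exists_nat_ge (t / (δ / 2))
  exact this n t le_rfl ((div_le_iff₀ (by positivity)).1 hn)

lemma IsCadlag.transitions_add (hw : IsCadlag w) {k l : Fin d} (hkl : k ≠ l) {a b : ℝ≥0}
    (hab : a ≤ b) : transitions w k l b = transitions w k l a +
      {s : ℝ≥0 | a < s ∧ s ≤ b ∧ Function.leftLim w s = k ∧ w s = l}.ncard := by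
  unfold transitions
  rw [← Set.ncard_union_eq _ (hw.finite_transitions hkl a)
    ((hw.finite_transitions hkl b).subset fun s hs => ⟨(zero_le).trans_lt hs.1, hs.2⟩)]
  · congr 1
    ext s
    constructor
    · rintro ⟨hs0, hs1, hs2⟩
      rcases le_or_gt s a with h3 | h3
      · exact Or.inl ⟨hs0, h3, hs2⟩
      · exact Or.inr ⟨h3, hs1, hs2⟩
    · rintro (⟨h1, h2, h3⟩ | ⟨h1, h2, h3⟩)
      · exact ⟨h1, h2.trans hab, h3⟩
      · exact ⟨(zero_le).trans_lt h1, h2, h3⟩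
  · rw [Set.disjoint_left]
    exact fun s h1 h2 => absurd h1.2.1 (not_le.2 h2.1)

lemma IsCadlag.transitions_mono (hw : IsCadlag w) {k l : Fin d} (hkl : k ≠ l) :
    Monotone (transitions w k l) := fun a b hab => by
  rw [hw.transitions_add hkl hab]; exact Nat.le_add_right _ _

lemma transitions_zero (k l : Fin d) : transitions w k l 0 = 0 := by
  have : {s : ℝ≥0 | 0 < s ∧ s ≤ 0 ∧ Function.leftLim w s = k ∧ w s = l} = ∅ := by
    ext s
    simp only [Set.mem_ofPred_eq, Set.mem_empty_iff_false, iff_false, not_and]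
    exact fun h1 h2 => absurd h2 (not_le.2 h1)
  rw [transitions, this, Set.ncard_empty]

lemma occupation_set_subset (k : Fin d) (t : ℝ≥0) :
    {s : ℝ | 0 ≤ s ∧ s < t ∧ w s.toNNReal = k} ⊆ Set.Ico 0 (t : ℝ) := fun _ hs => ⟨hs.1, hs.2.1⟩

lemma volume_occupation_ne_top (k : Fin d) (t : ℝ≥0) :
    volume {s : ℝ | 0 ≤ s ∧ s < t ∧ w s.toNNReal = k} ≠ ∞ :=
  ((measure_mono (occupation_set_subset k t)).trans_lt (by simp)).ne

lemma coe_occupation (k : Fin d) (t : ℝ≥0) :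
    (occupation w k t : ℝ≥0∞) = volume {s : ℝ | 0 ≤ s ∧ s < t ∧ w s.toNNReal = k} :=
  ENNReal.coe_toNNReal (volume_occupation_ne_top k t)

lemma occupation_zero (k : Fin d) : occupation w k 0 = 0 := by
  rw [← ENNReal.coe_inj, coe_occupation]
  refine measure_mono_null (occupation_set_subset k 0) (by simp)

lemma coe_occupation_le (k : Fin d) (a b : ℝ≥0) :
    (occupation w k b : ℝ≥0∞) ≤ occupation w k a +
      volume {s : ℝ | a ≤ s ∧ s < b ∧ w s.toNNReal = k} := by
  rw [coe_occupation, coe_occupation]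
  refine (measure_mono ?_).trans (measure_union_le _ _)
  rintro s ⟨h1, h2, h3⟩
  rcases lt_or_ge s a with h | h
  · exact Or.inl ⟨h1, h, h3⟩
  · exact Or.inr ⟨h, h2, h3⟩

lemma occupation_mono (k : Fin d) : Monotone (occupation w k) := fun a b hab => by
  rw [← ENNReal.coe_le_coe, coe_occupation, coe_occupation]
  refine measure_mono fun s hs => ⟨hs.1, hs.2.1.trans_le (by exact_mod_cast hab), hs.2.2⟩

lemma occupation_le_add (k : Fin d) (a b : ℝ≥0) :
    occupation w k b ≤ occupation w k a + (b - a) := by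
  rw [← ENNReal.coe_le_coe]
  refine (coe_occupation_le k a b).trans ?_
  push_cast
  gcongr
  refine (measure_mono (t := Set.Ico (a : ℝ) b) fun s hs => ⟨hs.1, hs.2.1⟩).trans ?_
  rw [Real.volume_Ico, ENNReal.ofReal_sub _ a.coe_nonneg]
  simp

lemma occupation_le (k : Fin d) (t : ℝ≥0) : occupation w k t ≤ t := by
  simpa [occupation_zero] using occupation_le_add (w := w) k 0 t

lemma continuous_occupation (k : Fin d) : Continuous (occupation w k) := by
  refine LipschitzWith.continuous (K := 1) (LipschitzWith.of_dist_le_mul fun a b => ?_)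
  rw [NNReal.coe_one, one_mul]
  wlog hab : a ≤ b generalizing a b
  · rw [dist_comm, dist_comm a]; exact this b a (le_of_not_ge hab)
  have h1 := occupation_mono (w := w) k hab
  have h2 : (occupation w k b : ℝ) ≤ occupation w k a + (b - a : ℝ≥0) := by
    exact_mod_cast occupation_le_add (w := w) k a b
  rw [NNReal.coe_sub hab] at h2
  have h3 : (occupation w k a : ℝ) ≤ occupation w k b := h1
  have h4 : (a : ℝ) ≤ b := hab
  rw [NNReal.dist_eq, NNReal.dist_eq, abs_of_nonpos (by linarith), abs_of_nonpos (by linarith)]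
  linarith

lemma occupation_eq_of_const {k e : Fin d} {a b : ℝ≥0} (hab : a ≤ b)
    (h : ∀ u, a ≤ u → u < b → w u = e) :
    occupation w k b = occupation w k a + if e = k then b - a else 0 := by
  split_ifs with hk
  · refine le_antisymm (occupation_le_add k _ _) ?_
    subst hk
    rw [← ENNReal.coe_le_coe]
    push_cast
    have hm : MeasurableSet (Set.Ico (a : ℝ) b) := measurableSet_Ico
    rw [coe_occupation, coe_occupation]
    have : ((b : ℝ≥0∞) - a) = volume (Set.Ico (a : ℝ) b) := by
      rw [Real.volume_Ico, ENNReal.ofReal_sub _ a.coe_nonneg]; simp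
    rw [this, ← measure_union _ hm]
    · refine measure_mono ?_
      rintro s (⟨h1, h2, h3⟩ | ⟨h1, h2⟩)
      · exact ⟨h1, h2.trans_le (by exact_mod_cast hab), h3⟩
      · refine ⟨a.2.trans h1, h2, h _ ?_ ?_⟩
        · exact NNReal.le_toNNReal_of_coe_le h1
        · exact (Real.toNNReal_lt_iff_lt_coe (a.2.trans h1)).2 h2
    · rw [Set.disjoint_left]
      exact fun s h1 h2 => absurd h1.2.1 (not_lt.2 h2.1)
  · rw [add_zero]
    refine le_antisymm ?_ (occupation_mono k hab)
    rw [← ENNReal.coe_le_coe]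
    refine (coe_occupation_le k a b).trans (le_of_eq ?_)
    have : {s : ℝ | a ≤ s ∧ s < b ∧ w s.toNNReal = k} = ∅ := by
      ext s
      simp only [Set.mem_ofPred_eq, Set.mem_empty_iff_false, iff_false, not_and]
      intro h1 h2 h3
      refine hk ((h _ ?_ ?_).symm.trans h3)
      · exact NNReal.le_toNNReal_of_coe_le h1
      · exact (Real.toNNReal_lt_iff_lt_coe (a.2.trans h1)).2 h2
    rw [this, measure_empty, add_zero]

/-- The `r`-th point of the partition of `[s, t]` into `N` intervals of equal length. -/
def meshPoint (s t : ℝ≥0) (N r : ℕ) : ℝ≥0 := s + r * ((t - s) / N)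

lemma meshPoint_zero (s t : ℝ≥0) (N : ℕ) : meshPoint s t N 0 = s := by simp [meshPoint]

lemma meshPoint_self {s t : ℝ≥0} (hst : s ≤ t) {N : ℕ} (hN : N ≠ 0) : meshPoint s t N N = t := by
  rw [meshPoint, mul_div_cancel₀ _ (by exact_mod_cast hN), add_tsub_cancel_of_le hst]

lemma meshPoint_mono (s t : ℝ≥0) (N : ℕ) : Monotone (meshPoint s t N) := fun a b hab => by
  unfold meshPoint; gcongr

lemma meshPoint_succ (s t : ℝ≥0) (N r : ℕ) :
    meshPoint s t N (r + 1) = meshPoint s t N r + (t - s) / N := by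
  simp only [meshPoint]; push_cast; ring

lemma meshPoint_le {s t : ℝ≥0} (hst : s ≤ t) {N r : ℕ} (hr : r ≤ N) : meshPoint s t N r ≤ t := by
  rcases Nat.eq_zero_or_pos N with rfl | hN
  · simpa [meshPoint, Nat.le_zero.1 hr] using hst
  · exact (meshPoint_mono s t N hr).trans_eq (meshPoint_self hst hN.ne')

lemma tendsto_mesh_size (x : ℝ≥0) :
    Filter.Tendsto (fun N : ℕ => x / N) Filter.atTop (𝓝 0) := by
  rw [← NNReal.tendsto_coe]
  simpa using tendsto_const_div_atTop_nhds_zero_nat (x : ℝ)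

/-- With at most one jump per mesh interval, the endpoints determine the transition exactly. The
occupation time, estimated by the state at the right endpoint, is wrong only on intervals containing
a jump, and then by at most the interval's length. The double sum counts that jump. -/
lemma IsCadlag.eventually_mesh (hw : IsCadlag w) {s t : ℝ≥0} (hst : s ≤ t) :
    ∀ᶠ N in Filter.atTop, N ≠ 0 ∧ ∀ r < N,
      (∀ k l, k ≠ l → transitions w k l (meshPoint s t N (r + 1)) =
        transitions w k l (meshPoint s t N r) +
          if w (meshPoint s t N r) = k ∧ w (meshPoint s t N (r + 1)) = l then 1 else 0) ∧
      ∀ k, |(occupation w k (meshPoint s t N (r + 1)) : ℝ) - occupation w k (meshPoint s t N r)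
          - (if w (meshPoint s t N (r + 1)) = k then (((t - s) / N : ℝ≥0) : ℝ) else 0)| ≤
        ((t - s) / N : ℝ≥0) *
          (∑ k, ∑ l ∈ Finset.univ.erase k, if w (meshPoint s t N r) = k ∧
            w (meshPoint s t N (r + 1)) = l then 1 else 0 : ℕ) := by
  obtain ⟨δ, hδ, h⟩ := hw.exists_mesh t
  filter_upwards [(tendsto_mesh_size (t - s)).eventually_lt_const hδ,
    Filter.eventually_ne_atTop 0] with N hN hN0
  refine ⟨hN0, fun r hr => ?_⟩
  have hab : meshPoint s t N r ≤ meshPoint s t N (r + 1) := meshPoint_mono s t N r.le_succ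
  have hbt : meshPoint s t N (r + 1) ≤ t := meshPoint_le hst hr
  have hlt : meshPoint s t N (r + 1) < meshPoint s t N r + δ := by
    rw [meshPoint_succ]; exact add_lt_add_right hN _
  obtain ⟨h1, h2⟩ := h _ _ hab hbt hlt
  refine ⟨fun k l hkl => by rw [hw.transitions_add hkl hab, (h1 k l hkl).2], fun k => ?_⟩
  have hsub : meshPoint s t N (r + 1) - meshPoint s t N r = (t - s) / N := by
    rw [meshPoint_succ, add_tsub_cancel_left]
  by_cases he : w (meshPoint s t N r) = w (meshPoint s t N (r + 1))
  · rw [occupation_eq_of_const (k := k) hab (fun u hu1 hu2 => h2 he u hu1 hu2.le), hsub]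
    refine le_trans (le_of_eq ?_) (mul_nonneg (NNReal.coe_nonneg _) (Nat.cast_nonneg _))
    split_ifs <;> simp
  · have hone : 1 ≤ (∑ k, ∑ l ∈ Finset.univ.erase k, if w (meshPoint s t N r) = k ∧
            w (meshPoint s t N (r + 1)) = l then 1 else 0 : ℕ) := by
      refine le_trans ?_ (Finset.single_le_sum (fun _ _ => Nat.zero_le _)
        (Finset.mem_univ (w (meshPoint s t N r))))
      refine le_trans ?_ (Finset.single_le_sum (fun _ _ => Nat.zero_le _)
        (Finset.mem_erase.2 ⟨Ne.symm he, Finset.mem_univ (w (meshPoint s t N (r + 1)))⟩))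
      simp
    have hb1 : (occupation w k (meshPoint s t N r) : ℝ) ≤
      occupation w k (meshPoint s t N (r + 1)) := occupation_mono k hab
    have hb2 : (occupation w k (meshPoint s t N (r + 1)) : ℝ) ≤
        occupation w k (meshPoint s t N r) + ((t - s) / N : ℝ≥0) := by
      rw [← hsub]; exact_mod_cast occupation_le_add (w := w) k _ _
    have hb3 : (0 : ℝ) ≤ ((t - s) / N : ℝ≥0) := NNReal.coe_nonneg _
    refine le_trans ?_ (le_mul_of_one_le_right hb3 (by exact_mod_cast hone))
    rw [abs_le]
    split_ifs <;> constructor <;> linarith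

lemma IsCadlag.eventually_transitions_eq (hw : IsCadlag w) {s t : ℝ≥0} (hst : s ≤ t) :
    ∀ᶠ N in Filter.atTop, ∀ k l, k ≠ l →
      transitions w k l t = transitions w k l s + ∑ r ∈ Finset.range N,
        if w (meshPoint s t N r) = k ∧ w (meshPoint s t N (r + 1)) = l then 1 else 0 := by
  filter_upwards [hw.eventually_mesh hst] with N ⟨hN, h⟩ k l hkl
  have : ∀ R ≤ N, transitions w k l (meshPoint s t N R) =
      transitions w k l s + ∑ r ∈ Finset.range R,
        if w (meshPoint s t N r) = k ∧ w (meshPoint s t N (r + 1)) = l then 1 else 0 := by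
    intro R
    induction R with
    | zero => intro _; simp [meshPoint_zero]
    | succ R ih =>
      intro hR
      rw [(h R hR).1 k l hkl, ih (Nat.le_of_succ_le hR), Finset.sum_range_succ, add_assoc]
  simpa [meshPoint_self hst hN] using this N le_rfl

/-- The errors of `eventually_mesh` add up to at most the mesh size times the number of transitions
up to `t`, which does not depend on `N`. -/
lemma IsCadlag.tendsto_occupation (hw : IsCadlag w) {s t : ℝ≥0} (hst : s ≤ t) (k : Fin d) :
    Filter.Tendsto (fun N : ℕ => (∑ r ∈ Finset.range N,
        if w (meshPoint s t N (r + 1)) = k then 1 else 0 : ℕ) * ((t - s) / N))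
      Filter.atTop (𝓝 (occupation w k t - occupation w k s)) := by
  rw [← NNReal.tendsto_coe, NNReal.coe_sub (occupation_mono k hst), tendsto_iff_dist_tendsto_zero]
  set C : ℝ := ((∑ k, ∑ l ∈ Finset.univ.erase k, transitions w k l t : ℕ) : ℝ)
  have hlim : Filter.Tendsto (fun N : ℕ => (((t - s) / N : ℝ≥0) : ℝ) * C) Filter.atTop (𝓝 0) := by
    have := (NNReal.tendsto_coe.2 (tendsto_mesh_size (t - s))).mul_const C
    simpa using this
  refine squeeze_zero' (Filter.Eventually.of_forall fun _ => dist_nonneg) ?_ hlim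
  filter_upwards [hw.eventually_mesh hst, hw.eventually_transitions_eq hst] with N ⟨hN, h⟩ htr
  have hC : C = ∑ r ∈ Finset.range N, ((∑ k, ∑ l ∈ Finset.univ.erase k,
      if w (meshPoint s t N r) = k ∧ w (meshPoint s t N (r + 1)) = l then 1 else 0 : ℕ) : ℝ) +
      (∑ k, ∑ l ∈ Finset.univ.erase k, transitions w k l s : ℕ) := by
    rw [← Nat.cast_sum, ← Nat.cast_add, Finset.sum_comm (s := Finset.range N),
      ← Finset.sum_add_distrib]
    refine congrArg Nat.cast ?_
    refine Finset.sum_congr rfl fun k _ => ?_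
    rw [Finset.sum_comm (s := Finset.range N), ← Finset.sum_add_distrib]
    refine Finset.sum_congr rfl fun l hl => ?_
    rw [htr k l (Finset.ne_of_mem_erase hl).symm, add_comm]
  have htel : (occupation w k t : ℝ) - occupation w k s = ∑ r ∈ Finset.range N,
      ((occupation w k (meshPoint s t N (r + 1)) : ℝ) - occupation w k (meshPoint s t N r)) := by
    rw [Finset.sum_range_sub (fun r => (occupation w k (meshPoint s t N r) : ℝ)),
      meshPoint_self hst hN, meshPoint_zero]
  have hcnt : (((∑ r ∈ Finset.range N,
      if w (meshPoint s t N (r + 1)) = k then 1 else 0 : ℕ) * ((t - s) / N) : ℝ≥0) : ℝ) =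
      ∑ r ∈ Finset.range N,
        if w (meshPoint s t N (r + 1)) = k then (((t - s) / N : ℝ≥0) : ℝ) else 0 := by
    push_cast
    rw [Finset.sum_mul]
    refine Finset.sum_congr rfl fun r _ => ?_
    split_ifs <;> simp
  rw [dist_comm, Real.dist_eq, htel, hcnt, ← Finset.sum_sub_distrib]
  refine (Finset.abs_sum_le_sum_abs _ _).trans
    ((Finset.sum_le_sum fun r hr => (h r (Finset.mem_range.1 hr)).2 k).trans ?_)
  rw [← Finset.mul_sum]
  refine mul_le_mul_of_nonneg_left ?_ (NNReal.coe_nonneg _)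
  rw [hC]
  exact le_add_of_nonneg_right (Nat.cast_nonneg _)

/-- The path is constant just after `t`, so no transition is counted there. This makes the jump part
of the level right-continuous. -/
lemma IsCadlag.eventually_transitions_right (hw : IsCadlag w) {k l : Fin d} (hkl : k ≠ l)
    (t : ℝ≥0) : ∀ᶠ u in 𝓝[Set.Ici t] t, transitions w k l u = transitions w k l t := by
  obtain ⟨δ, hδ, h⟩ := hw.exists_mesh (t + 1)
  have h1 : ∀ᶠ u in 𝓝[Set.Ici t] t, w u = w t := by
    have := (hw t).1.tendsto
    rw [nhds_discrete] at this
    exact Filter.tendsto_pure.1 this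
  have h2 : ∀ᶠ u in 𝓝[Set.Ici t] t, u < t + min δ 1 :=
    mem_nhdsWithin_of_mem_nhds (Iio_mem_nhds (lt_add_of_pos_right _ (lt_min hδ one_pos)))
  filter_upwards [h1, h2, self_mem_nhdsWithin] with u hu1 hu2 hu3
  rw [hw.transitions_add hkl hu3, ((h t u hu3 (hu2.le.trans (by gcongr; exact min_le_right _ _))
    (hu2.trans_le (by gcongr; exact min_le_left _ _))).1 k l hkl).2, if_neg, add_zero]
  rintro ⟨h3, h4⟩
  exact hkl (h3.symm.trans (hu1.symm.trans h4))

end FinitePaths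

/-! ### Dyadic approximation of times from the right. -/

/-- The dyadic mesh of level `n`. -/
def dyad (n : ℕ) : ℝ≥0 := (1 / 2) ^ n

lemma dyad_pos (n : ℕ) : 0 < dyad n := by unfold dyad; positivity

lemma tendsto_dyad : Filter.Tendsto dyad Filter.atTop (𝓝 0) :=
  NNReal.tendsto_pow_atTop_nhds_zero_of_lt_one (by
    rw [← NNReal.coe_lt_coe]; norm_num)

/-- The index of the first dyadic time of level `n` after `t`. -/
def dyadIdx (n : ℕ) (t : ℝ≥0) : ℕ := ⌊t / dyad n⌋₊ + 1

lemma lt_dyadIdx (n : ℕ) (t : ℝ≥0) : t < dyadIdx n t * dyad n := by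
  have := Nat.lt_floor_add_one (t / dyad n)
  rw [div_lt_iff₀ (dyad_pos n)] at this
  simpa [dyadIdx] using this

lemma dyadIdx_le (n : ℕ) (t : ℝ≥0) : dyadIdx n t * dyad n ≤ t + dyad n := by
  have := Nat.floor_le (zero_le (a := t / dyad n))
  rw [le_div_iff₀ (dyad_pos n)] at this
  simp only [dyadIdx, Nat.cast_add, Nat.cast_one, add_mul, one_mul]
  gcongr

lemma tendsto_dyadIdx (t : ℝ≥0) :
    Filter.Tendsto (fun n => dyadIdx n t * dyad n) Filter.atTop (𝓝[Set.Ici t] t) := by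
  refine tendsto_nhdsWithin_iff.2 ⟨?_, Filter.Eventually.of_forall fun n => (lt_dyadIdx n t).le⟩
  refine tendsto_of_tendsto_of_tendsto_of_le_of_le tendsto_const_nhds ?_
    (fun n => (lt_dyadIdx n t).le) (fun n => dyadIdx_le n t)
  simpa using tendsto_dyad.const_add t

section Measurability

variable {Ω E : Type*} {m : MeasurableSpace Ω} [TopologicalSpace E]
  [TopologicalSpace.PseudoMetrizableSpace E] [MeasurableSpace E] [BorelSpace E]

/-- A right-continuous process is jointly measurable. -/
lemma measurable_uncurry_of_rightCts {X : ℝ≥0 → Ω → E} (hX : ∀ t, Measurable (X t))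
    (hrc : ∀ ω t, ContinuousWithinAt (fun t => X t ω) (Set.Ici t) t) :
    Measurable (fun p : ℝ≥0 × Ω => X p.1 p.2) := by
  -- Evaluating at the first dyadic time after `t` uses only countably many times, where
  -- measurability in `ω` suffices. Right-continuity recovers the process in the limit.
  refine measurable_of_tendsto_metrizable
    (f := fun n (p : ℝ≥0 × Ω) => X (dyadIdx n p.1 * dyad n) p.2) (fun n => ?_) ?_
  · have h1 : Measurable (fun p : ℕ × Ω => X (p.1 * dyad n) p.2) :=
      measurable_from_prod_countable_right fun k => hX (k * dyad n)
    have h2 : Measurable (fun p : ℝ≥0 × Ω => (dyadIdx n p.1, p.2)) := by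
      refine Measurable.prodMk ?_ measurable_snd
      have : Measurable (dyadIdx n) := by unfold dyadIdx; fun_prop
      exact this.comp measurable_fst
    exact h1.comp h2
  · rw [tendsto_pi_nhds]
    exact fun p => (hrc p.2 p.1).tendsto.comp (tendsto_dyadIdx p.1)

end Measurability

/-! ### First entrance times of right-continuous functions into open sets. -/

section Hitting

/-- The first time at which `f` is in `O`. -/
def hit (O : Set ℝ) (f : ℝ≥0 → ℝ) : ℝ≥0∞ := ⨅ (t : ℝ≥0) (_ : f t ∈ O), (t : ℝ≥0∞)

variable {O : Set ℝ} {f : ℝ≥0 → ℝ}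

lemma hit_le {t : ℝ≥0} (h : f t ∈ O) : hit O f ≤ t := iInf₂_le t h

lemma notMem_of_lt_hit {t : ℝ≥0} (h : (t : ℝ≥0∞) < hit O f) : f t ∉ O :=
  fun h' => absurd (hit_le h') (not_le.2 h)

lemma hit_lt_iff {c : ℝ≥0∞} : hit O f < c ↔ ∃ t : ℝ≥0, f t ∈ O ∧ (t : ℝ≥0∞) < c := by
  simp [hit, iInf_lt_iff]

lemma le_hit_iff {c : ℝ≥0∞} : c ≤ hit O f ↔ ∀ t : ℝ≥0, f t ∈ O → c ≤ t := by
  simp [hit]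

lemma exists_mem_of_hit_lt (hO : IsOpen O) (hf : ∀ t, ContinuousWithinAt f (Set.Ici t) t)
    {c : ℝ≥0} (h : hit O f < c) : ∀ᶠ n in Filter.atTop, ∃ m : ℕ, f (m * dyad n) ∈ O ∧
      m * dyad n < c := by
  obtain ⟨t, ht, htc⟩ := hit_lt_iff.1 h
  have h1 : ∀ᶠ s in 𝓝[Set.Ici t] t, f s ∈ O := hf t (hO.mem_nhds ht)
  have h2 : ∀ᶠ s in 𝓝[Set.Ici t] t, s < c :=
    mem_nhdsWithin_of_mem_nhds (Iio_mem_nhds (by exact_mod_cast htc))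
  filter_upwards [(tendsto_dyadIdx t).eventually (h1.and h2)] with n hn
  exact ⟨_, hn⟩

/-- A right-continuous function that is in an open set stays there for a moment, hence also at some
dyadic time. Entrance times are therefore measurable without any completion of the σ-algebra. -/
lemma hit_lt_iff_dyadic (hO : IsOpen O) (hf : ∀ t, ContinuousWithinAt f (Set.Ici t) t)
    {c : ℝ≥0∞} : hit O f < c ↔ ∃ n m : ℕ, f (m * dyad n) ∈ O ∧ ((m * dyad n : ℝ≥0) : ℝ≥0∞) < c := by
  constructor
  · intro h
    obtain ⟨c', h1, h2⟩ := ENNReal.lt_iff_exists_nnreal_btwn.1 h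
    obtain ⟨n, m, hm, hc⟩ := (exists_mem_of_hit_lt hO hf h1).exists
    exact ⟨n, m, hm, lt_trans (by exact_mod_cast hc) h2⟩
  · rintro ⟨n, m, hm, hc⟩
    exact hit_lt_iff.2 ⟨_, hm, hc⟩

lemma measurable_hit {Ω : Type*} {m : MeasurableSpace Ω} {X : ℝ≥0 → Ω → ℝ} (hO : IsOpen O)
    (hX : ∀ t, Measurable (X t))
    (hrc : ∀ ω t, ContinuousWithinAt (fun t => X t ω) (Set.Ici t) t) :
    Measurable (fun ω => hit O (fun t => X t ω)) := by
  refine measurable_of_Iio fun c => ?_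
  have : (fun ω => hit O (fun t => X t ω)) ⁻¹' Set.Iio c = ⋃ (n : ℕ) (m : ℕ),
      {ω | X (m * dyad n) ω ∈ O ∧ ((m * dyad n : ℝ≥0) : ℝ≥0∞) < c} := by
    ext ω
    simp only [Set.mem_preimage, Set.mem_Iio, hit_lt_iff_dyadic hO (hrc ω), Set.mem_iUnion,
      Set.mem_ofPred_eq]
  rw [this]
  refine MeasurableSet.iUnion fun n => MeasurableSet.iUnion fun k => ?_
  exact (hX _ hO.measurableSet).inter (MeasurableSet.const _)

/-- The index of the first dyadic time of level `n` at which `f` is in `O`. -/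
def hitIdx (O : Set ℝ) (n : ℕ) (f : ℝ≥0 → ℝ) : ℕ := sInf {m : ℕ | f (m * dyad n) ∈ O}

/-- `f` is in `O` at some dyadic time of level `n`. -/
def HitsAt (O : Set ℝ) (n : ℕ) (f : ℝ≥0 → ℝ) : Prop := ∃ m : ℕ, f (m * dyad n) ∈ O

lemma HitsAt.mem {n : ℕ} (h : HitsAt O n f) : f (hitIdx O n f * dyad n) ∈ O :=
  Nat.sInf_mem (s := {m : ℕ | f (m * dyad n) ∈ O}) h

lemma hitsAt_and_hitIdx_eq_iff {n m : ℕ} : (HitsAt O n f ∧ hitIdx O n f = m) ↔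
    f (m * dyad n) ∈ O ∧ ∀ j < m, f (j * dyad n) ∉ O := by
  constructor
  · rintro ⟨h, rfl⟩
    exact ⟨h.mem, fun j hj hjO => absurd (Nat.sInf_le hjO) (not_le.2 hj)⟩
  · rintro ⟨h1, h2⟩
    refine ⟨⟨m, h1⟩, le_antisymm (Nat.sInf_le h1) ?_⟩
    by_contra hlt
    exact h2 _ (not_le.1 hlt) (Nat.sInf_mem (s := {m : ℕ | f (m * dyad n) ∈ O}) ⟨m, h1⟩)

lemma not_hitsAt_of_hit_eq_top (h : hit O f = ∞) (n : ℕ) : ¬ HitsAt O n f := fun ⟨_, hm⟩ =>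
  ENNReal.coe_ne_top (top_le_iff.1 (h ▸ hit_le hm))

lemma eventually_hitsAt (hO : IsOpen O) (hf : ∀ t, ContinuousWithinAt f (Set.Ici t) t)
    (h : hit O f ≠ ∞) : ∀ᶠ n in Filter.atTop, HitsAt O n f := by
  obtain ⟨c, hc⟩ := ENNReal.lt_iff_exists_nnreal_btwn.1 (lt_top_iff_ne_top.2 h)
  filter_upwards [exists_mem_of_hit_lt hO hf hc.1] with n ⟨m, hm, _⟩
  exact ⟨m, hm⟩

lemma HitsAt.le (h : hit O f ≠ ∞) {n : ℕ} (hn : HitsAt O n f) :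
    (hit O f).toNNReal ≤ hitIdx O n f * dyad n := by
  rw [← ENNReal.coe_le_coe, ENNReal.coe_toNNReal h]
  exact hit_le hn.mem

/-- The dyadic entrance times approach the entrance time from the right, which is the side on which
paths are continuous. This drives the passage from grid times to the strong Markov property. -/
lemma tendsto_hitIdx (hO : IsOpen O) (hf : ∀ t, ContinuousWithinAt f (Set.Ici t) t)
    (h : hit O f ≠ ∞) : Filter.Tendsto (fun n => hitIdx O n f * dyad n) Filter.atTop
      (𝓝[Set.Ici (hit O f).toNNReal] (hit O f).toNNReal) := by
  have hle : ∀ᶠ n in Filter.atTop, (hit O f).toNNReal ≤ hitIdx O n f * dyad n := by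
    filter_upwards [eventually_hitsAt hO hf h] with n hn using hn.le h
  refine tendsto_nhdsWithin_iff.2 ⟨?_, hle⟩
  rw [tendsto_order]
  refine ⟨fun a ha => hle.mono fun n hn => ha.trans_le hn, fun a ha => ?_⟩
  have : hit O f < a := by rw [← ENNReal.coe_toNNReal h]; exact_mod_cast ha
  filter_upwards [exists_mem_of_hit_lt hO hf this] with n ⟨m, hm, hma⟩
  refine lt_of_le_of_lt ?_ hma
  gcongr
  exact Nat.sInf_le hm

lemma mem_closure_hit (hO : IsOpen O) (hf : ∀ t, ContinuousWithinAt f (Set.Ici t) t)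
    (h : hit O f ≠ ∞) : f (hit O f).toNNReal ∈ closure O :=
  mem_closure_of_tendsto ((hf _).tendsto.comp (tendsto_hitIdx hO hf h))
    ((eventually_hitsAt hO hf h).mono fun _ hn => hn.mem)

/-- If `O` is avoided before `r`, the clock may be restarted at `r` with the target translated by
the current value. -/
lemma hit_eq_add {r : ℝ≥0} (h : ∀ t < r, f t ∉ O) :
    hit O f = r + hit {y | y + f r ∈ O} (fun t => f (r + t) - f r) := by
  refine le_antisymm ?_ ?_
  · rw [hit, hit, ENNReal.add_iInf₂]
    · refine le_iInf₂ fun t ht => ?_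
      have h1 : f (r + t) ∈ O := by simpa using ht
      exact_mod_cast hit_le h1
  · rw [le_hit_iff]
    intro t ht
    have hrt : r ≤ t := not_lt.1 fun hlt => h t hlt ht
    have : hit {y | y + f r ∈ O} (fun t => f (r + t) - f r) ≤ ((t - r : ℝ≥0) : ℝ≥0∞) := by
      refine hit_le ?_
      simpa [add_tsub_cancel_of_le hrt] using ht
    refine (add_le_add_right this _).trans (le_of_eq ?_)
    rw [← ENNReal.coe_add, add_tsub_cancel_of_le hrt]

end Hitting

/-! ### The path space. -/

/-- Right-continuous paths in `ℝ × Fin d` whose first component starts in `0` and has left limits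
and no negative jumps. -/
def PathSpace (d : ℕ) : Type :=
  {w : ℝ≥0 → ℝ × Fin d // (∀ t, ContinuousWithinAt w (Set.Ici t) t) ∧ (w 0).1 = 0 ∧
    ∀ t, ∃ l, Filter.Tendsto (fun s => (w s).1) (𝓝[<] t) (𝓝 l) ∧ l ≤ (w t).1}

namespace PathSpace

variable {d : ℕ}

instance : MeasurableSpace (PathSpace d) := inferInstanceAs (MeasurableSpace (Subtype _))

/-- The underlying function of a path. -/
def toFun (w : PathSpace d) : ℝ≥0 → ℝ × Fin d := w.1

/-- The level of a path. -/
def pos (w : PathSpace d) (t : ℝ≥0) : ℝ := (w.1 t).1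

/-- The background state of a path. -/
def st (w : PathSpace d) (t : ℝ≥0) : Fin d := (w.1 t).2

@[ext] lemma ext {w w' : PathSpace d} (h1 : ∀ t, w.pos t = w'.pos t) (h2 : ∀ t, w.st t = w'.st t) :
    w = w' := Subtype.ext (funext fun t => Prod.ext (h1 t) (h2 t))

lemma rightCts (w : PathSpace d) (t : ℝ≥0) : ContinuousWithinAt w.1 (Set.Ici t) t := w.2.1 t

lemma rightCts_pos (w : PathSpace d) (t : ℝ≥0) : ContinuousWithinAt w.pos (Set.Ici t) t :=
  continuous_fst.continuousAt.comp_continuousWithinAt (w.rightCts t)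

lemma rightCts_st (w : PathSpace d) (t : ℝ≥0) : ContinuousWithinAt w.st (Set.Ici t) t :=
  continuous_snd.continuousAt.comp_continuousWithinAt (w.rightCts t)

lemma pos_zero (w : PathSpace d) : w.pos 0 = 0 := w.2.2.1

lemma measurable_toFun : Measurable (toFun : PathSpace d → ℝ≥0 → ℝ × Fin d) :=
  measurable_subtype_coe

lemma measurable_coe_apply (t : ℝ≥0) : Measurable (fun w : PathSpace d => w.1 t) :=
  (measurable_pi_apply t).comp measurable_toFun

lemma measurable_pos (t : ℝ≥0) : Measurable (fun w : PathSpace d => w.pos t) :=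
  measurable_fst.comp (measurable_coe_apply t)

lemma measurable_st (t : ℝ≥0) : Measurable (fun w : PathSpace d => w.st t) :=
  measurable_snd.comp (measurable_coe_apply t)

lemma measurable_pos_uncurry : Measurable (fun p : ℝ≥0 × PathSpace d => p.2.pos p.1) :=
  measurable_uncurry_of_rightCts (X := fun t (w : PathSpace d) => w.pos t) measurable_pos
    rightCts_pos

lemma measurable_st_uncurry : Measurable (fun p : ℝ≥0 × PathSpace d => p.2.st p.1) :=
  measurable_uncurry_of_rightCts (X := fun t (w : PathSpace d) => w.st t) measurable_st rightCts_st

lemma measurable_of_apply {Ω : Type*} {m : MeasurableSpace Ω} {f : Ω → PathSpace d}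
    (h1 : ∀ t, Measurable fun ω => (f ω).pos t) (h2 : ∀ t, Measurable fun ω => (f ω).st t) :
    Measurable f :=
  Measurable.subtype_mk (measurable_pi_lambda _ fun t => (h1 t).prodMk (h2 t))

/-- The left limit at `t` inherits the bound, and the path can only jump upwards from it. This is
how the absence of negative jumps enters the passage arguments. -/
lemma le_pos_of_forall_lt (w : PathSpace d) {r t : ℝ≥0} {c : ℝ} (hrt : r < t)
    (h : ∀ s, r ≤ s → s < t → c ≤ w.pos s) : c ≤ w.pos t := by
  obtain ⟨l, hl, hlt⟩ := w.2.2.2 t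
  have : (𝓝[<] t).NeBot := nhdsLT_neBot_of_exists_lt ⟨r, hrt⟩
  refine (ge_of_tendsto hl ?_).trans hlt
  filter_upwards [Ioo_mem_nhdsLT hrt] with s hs using h s hs.1.le hs.2

/-- The increments of a path after time `r`. -/
def shift (r : ℝ≥0) (w : PathSpace d) : PathSpace d :=
  ⟨fun t => (w.pos (r + t) - w.pos r, w.st (r + t)), by
    have hmaps : ∀ t, Filter.Tendsto (fun s => r + s) (𝓝[Set.Ici t] t)
        (𝓝[Set.Ici (r + t)] (r + t)) := fun t =>
      tendsto_nhdsWithin_iff.2 ⟨(continuous_const_add r).continuousWithinAt,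
        by filter_upwards [self_mem_nhdsWithin] with s hs using add_le_add_right hs r⟩
    refine ⟨fun t => ?_, by simp, fun t => ?_⟩
    · exact ((((w.rightCts_pos (r + t)).tendsto.comp (hmaps t)).sub_const _).prodMk_nhds
        ((w.rightCts_st (r + t)).tendsto.comp (hmaps t)))
    · obtain ⟨l, hl, hlt⟩ := w.2.2.2 (r + t)
      refine ⟨l - w.pos r, ?_, sub_le_sub_right hlt _⟩
      refine (hl.comp (tendsto_nhdsWithin_iff.2 ⟨(continuous_const_add r).continuousWithinAt,
        ?_⟩)).sub_const _
      filter_upwards [self_mem_nhdsWithin] with s hs using add_lt_add_right hs r⟩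

@[simp] lemma pos_shift (r : ℝ≥0) (w : PathSpace d) (t : ℝ≥0) :
    (shift r w).pos t = w.pos (r + t) - w.pos r := rfl

@[simp] lemma st_shift (r : ℝ≥0) (w : PathSpace d) (t : ℝ≥0) :
    (shift r w).st t = w.st (r + t) := rfl

lemma measurable_shift_uncurry : Measurable (fun p : ℝ≥0 × PathSpace d => shift p.1 p.2) := by
  refine measurable_of_apply (fun t => ?_) (fun t => ?_)
  · exact (measurable_pos_uncurry.comp ((measurable_fst.add_const t).prodMk measurable_snd)).sub
      measurable_pos_uncurry
  · exact measurable_st_uncurry.comp ((measurable_fst.add_const t).prodMk measurable_snd)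

lemma measurable_shift (r : ℝ≥0) : Measurable (shift r : PathSpace d → PathSpace d) :=
  measurable_shift_uncurry.comp measurable_prodMk_left

lemma measurable_hit_pos {O : Set ℝ} (hO : IsOpen O) :
    Measurable (fun w : PathSpace d => hit O w.pos) :=
  measurable_hit (X := fun t (w : PathSpace d) => w.pos t) hO measurable_pos rightCts_pos

/-- Measures on `α × PathSpace d` are determined by the finite-dimensional distributions. -/
lemma measure_ext {α : Type*} [MeasurableSpace α] {μ ν : Measure (α × PathSpace d)}
    (h : μ.map (Prod.map id toFun) = ν.map (Prod.map id toFun)) : μ = ν := by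
  -- The path space carries the trace of the product σ-algebra, so all its measurable sets are
  -- preimages. Measurability of the set of paths within the full product is not needed.
  have hm : (inferInstance : MeasurableSpace (α × PathSpace d)) =
      MeasurableSpace.comap (Prod.map id toFun) inferInstance := by
    change MeasurableSpace.comap Prod.fst _ ⊔ MeasurableSpace.comap Prod.snd
      (MeasurableSpace.comap toFun _) = MeasurableSpace.comap _
        (MeasurableSpace.comap Prod.fst _ ⊔ MeasurableSpace.comap Prod.snd _)
    rw [MeasurableSpace.comap_sup, MeasurableSpace.comap_comp, MeasurableSpace.comap_comp,
      MeasurableSpace.comap_comp]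
    rfl
  ext s hs
  have hs' : MeasurableSet[MeasurableSpace.comap (Prod.map id toFun) inferInstance] s := by
    rw [← hm]; exact hs
  obtain ⟨t, ht, rfl⟩ := hs'
  have hmeas : Measurable (Prod.map id toFun : α × PathSpace d → α × (ℝ≥0 → ℝ × Fin d)) :=
    measurable_id.prodMap measurable_toFun
  rw [← Measure.map_apply hmeas ht, h, Measure.map_apply hmeas ht]

end PathSpace

/-! ### Events determined by the states and increments on a grid. -/

namespace PathSpace

variable {d : ℕ}

/-- The paths with prescribed states and increments on the grid of mesh `h`. -/
def gridRect (h : ℝ≥0) (n : ℕ) (s : ℕ → Fin d) (C : ℕ → Set ℝ) : Set (PathSpace d) :=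
  {w | (∀ m ≤ n, w.st (m * h) = s m) ∧
    ∀ m < n, w.pos ((m + 1 : ℕ) * h) - w.pos (m * h) ∈ C m}

lemma measurableSet_gridRect (h : ℝ≥0) (n : ℕ) (s : ℕ → Fin d) {C : ℕ → Set ℝ}
    (hC : ∀ m, MeasurableSet (C m)) : MeasurableSet (gridRect h n s C) := by
  have : gridRect h n s C =
      (⋂ m : ℕ, ⋂ _ : m ≤ n, (fun w : PathSpace d => w.st (m * h)) ⁻¹' {s m}) ∩
      ⋂ m : ℕ, ⋂ _ : m < n,
        (fun w : PathSpace d => w.pos ((m + 1 : ℕ) * h) - w.pos (m * h)) ⁻¹' C m := by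
    ext w
    simp [gridRect]
  rw [this]
  refine MeasurableSet.inter ?_ ?_
  · exact MeasurableSet.iInter fun m => MeasurableSet.iInter fun _ =>
      measurable_st _ (measurableSet_singleton _)
  · exact MeasurableSet.iInter fun m => MeasurableSet.iInter fun _ =>
      ((measurable_pos _).sub (measurable_pos _)) (hC m)

/-- The grid events whose number of steps satisfies `p`. -/
def gridPi (h : ℝ≥0) (p : ℕ → Prop) : Set (Set (PathSpace d)) :=
  {A | ∃ n s C, p n ∧ (∀ m, MeasurableSet (C m)) ∧ A = gridRect h n s C}

/-- The σ-algebra generated by `gridPi h p`. -/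
@[reducible] def gridSigma (h : ℝ≥0) (p : ℕ → Prop) : MeasurableSpace (PathSpace d) :=
  MeasurableSpace.generateFrom (gridPi h p)

/-- A common path forces the two state sequences to agree up to the shorter length, so the
intersection is again a grid event. Empty intersections are harmless for a π-system. -/
lemma gridRect_inter {h : ℝ≥0} {n n' : ℕ} (hn : n ≤ n') {s s' : ℕ → Fin d} {C C' : ℕ → Set ℝ}
    (hne : (gridRect h n s C ∩ gridRect h n' s' C').Nonempty) :
    gridRect h n s C ∩ gridRect h n' s' C' =
      gridRect h n' s' (fun m => if m < n then C m ∩ C' m else C' m) := by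
  obtain ⟨w₀, h1, h2⟩ := hne
  ext w
  constructor
  · rintro ⟨h3, h4⟩
    refine ⟨h4.1, fun m hm => ?_⟩
    beta_reduce
    split_ifs with hmn
    · exact ⟨h3.2 m hmn, h4.2 m hm⟩
    · exact h4.2 m hm
  · rintro ⟨h3, h4⟩
    refine ⟨⟨fun m hm => ?_, fun m hm => ?_⟩, h3, fun m hm => ?_⟩
    · rw [h3 m (hm.trans hn), ← h2.1 m (hm.trans hn), h1.1 m hm]
    · have := h4 m (hm.trans_le hn)
      beta_reduce at this
      rw [if_pos hm] at this
      exact this.1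
    · have := h4 m hm
      beta_reduce at this
      split_ifs at this
      · exact this.2
      · exact this

lemma isPiSystem_gridPi (h : ℝ≥0) (p : ℕ → Prop) : IsPiSystem (gridPi (d := d) h p) := by
  have key : ∀ n n' : ℕ, n ≤ n' → p n' → ∀ (s s' : ℕ → Fin d) (C C' : ℕ → Set ℝ),
      (∀ m, MeasurableSet (C m)) → (∀ m, MeasurableSet (C' m)) →
      (gridRect h n s C ∩ gridRect h n' s' C').Nonempty →
      gridRect h n s C ∩ gridRect h n' s' C' ∈ gridPi h p := by
    intro n n' hn hp s s' C C' hC hC' hne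
    rw [gridRect_inter hn hne]
    refine ⟨n', s', _, hp, fun m => ?_, rfl⟩
    split_ifs
    · exact (hC m).inter (hC' m)
    · exact hC' m
  rintro _ ⟨n, s, C, hp, hC, rfl⟩ _ ⟨n', s', C', hp', hC', rfl⟩ hne
  rcases le_total n n' with hn | hn
  · exact key n n' hn hp' s s' C C' hC hC' hne
  · rw [Set.inter_comm] at hne ⊢
    exact key n' n hn hp s' s C' C hC' hC hne

lemma measurableSet_of_mem_gridPi {h : ℝ≥0} {p : ℕ → Prop} {A : Set (PathSpace d)}
    (hA : A ∈ gridPi h p) : MeasurableSet A := by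
  obtain ⟨n, s, C, _, hC, rfl⟩ := hA
  exact measurableSet_gridRect h n s hC

/-- Extension of a finite sequence by its last term. -/
def extendSeq {n : ℕ} (s : Fin (n + 1) → Fin d) (m : ℕ) : Fin d :=
  s ⟨min m n, Nat.lt_succ_of_le (min_le_right _ _)⟩

lemma mem_gridRect_extendSeq_iff {h : ℝ≥0} {n : ℕ} {s : Fin (n + 1) → Fin d} {C : ℕ → Set ℝ}
    {w : PathSpace d} : w ∈ gridRect h n (extendSeq s) C ↔
      (s = fun m : Fin (n + 1) => w.st (m * h)) ∧
        ∀ m < n, w.pos ((m + 1 : ℕ) * h) - w.pos (m * h) ∈ C m := by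
  refine and_congr_left fun _ => ⟨fun h1 => funext fun m => ?_, fun h1 m hm => ?_⟩
  · rw [h1 m (Nat.lt_succ_iff.1 m.2), extendSeq]
    congr 1
    ext
    exact (min_eq_left (Nat.lt_succ_iff.1 m.2)).symm
  · simp only [h1, extendSeq, min_eq_left hm]

/-- Each value of the state is a finite union of grid events over complete state histories. With `p
= (· = m)` the σ-algebra is the past up to step `m`; with `p` always true it is the whole grid. -/
lemma measurable_grid_st (h : ℝ≥0) (p : ℕ → Prop) {n j : ℕ} (hp : p n) (hj : j ≤ n) :
    Measurable[gridSigma h p]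
      (fun w : PathSpace d => w.st (j * h)) := by
  refine @measurable_to_countable' (Fin d) _ _ _ (gridSigma h p) _
    fun l => ?_
  have : (fun w : PathSpace d => w.st (j * h)) ⁻¹' {l} =
      ⋃ s ∈ {s : Fin (n + 1) → Fin d | extendSeq s j = l},
        gridRect h n (extendSeq s) fun _ => Set.univ := by
    ext w
    simp only [Set.mem_preimage, Set.mem_singleton_iff, Set.mem_iUnion, Set.mem_ofPred_eq,
      mem_gridRect_extendSeq_iff, Set.mem_univ, implies_true, and_true, exists_prop]
    constructor
    · rintro rfl
      exact ⟨_, by simp [extendSeq, min_eq_left hj], rfl⟩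
    · rintro ⟨s, h1, rfl⟩
      simpa [extendSeq, min_eq_left hj] using h1
  rw [this]
  refine MeasurableSet.biUnion (Set.to_countable _) fun s _ => ?_
  exact MeasurableSpace.measurableSet_generateFrom ⟨n, _, _, hp, fun _ => MeasurableSet.univ, rfl⟩

lemma measurable_grid_pos (h : ℝ≥0) (p : ℕ → Prop) {n j : ℕ} (hp : p n) (hj : j ≤ n) :
    Measurable[gridSigma h p]
      (fun w : PathSpace d => w.pos (j * h)) := by
  induction j with
  | zero =>
    have : (fun w : PathSpace d => w.pos ((0 : ℕ) * h)) = fun _ => 0 := by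
      funext w; simp [pos_zero]
    rw [this]
    exact measurable_const
  | succ j ih =>
    have hinc : Measurable[gridSigma h p]
        (fun w : PathSpace d => w.pos ((j + 1 : ℕ) * h) - w.pos (j * h)) := by
      intro C hC
      have : (fun w : PathSpace d => w.pos ((j + 1 : ℕ) * h) - w.pos (j * h)) ⁻¹' C =
          ⋃ s : Fin (n + 1) → Fin d,
            gridRect h n (extendSeq s) (Function.update (fun _ => Set.univ) j C) := by
        ext w
        simp only [Set.mem_preimage, Set.mem_iUnion, mem_gridRect_extendSeq_iff]
        constructor
        · refine fun hw => ⟨_, rfl, fun m hm => ?_⟩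
          rcases eq_or_ne m j with rfl | hmj
          · simpa using hw
          · simp [Function.update_of_ne hmj]
        · rintro ⟨s, _, h2⟩
          simpa using h2 j hj
      rw [this]
      refine MeasurableSet.iUnion fun s =>
        MeasurableSpace.measurableSet_generateFrom ⟨n, _, _, hp, fun m => ?_, rfl⟩
      rcases eq_or_ne m j with rfl | hmj
      · simpa using hC
      · simp [Function.update_of_ne hmj]
    have := (ih (Nat.le_of_succ_le hj)).add hinc
    have heq : (fun w : PathSpace d => w.pos ((j + 1 : ℕ) * h)) =
        fun w => w.pos (j * h) + (w.pos ((j + 1 : ℕ) * h) - w.pos (j * h)) := by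
      funext w; ring
    rw [heq]
    exact this

lemma measurable_grid (h : ℝ≥0) (p : ℕ → Prop) {n j : ℕ} (hp : p n) (hj : j ≤ n) :
    Measurable[gridSigma h p]
      (fun w : PathSpace d => w.toFun (j * h)) :=
  (measurable_grid_pos h p hp hj).prodMk (measurable_grid_st h p hp hj)

lemma measurable_toFun_apply (t : ℝ≥0) : Measurable (fun w : PathSpace d => w.toFun t) :=
  (measurable_pi_apply t).comp measurable_toFun

/-- Concatenation of a past and a future event. Both prescribe the state at step `m`, which is why
`s' 0 = s m` is assumed. -/
lemma gridRect_inter_shift (h : ℝ≥0) (m n : ℕ) (s s' : ℕ → Fin d) (C C' : ℕ → Set ℝ)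
    (hs : s' 0 = s m) :
    gridRect h m s C ∩ shift (m * h) ⁻¹' gridRect h n s' C' =
      gridRect h (m + n) (fun j => if j ≤ m then s j else s' (j - m))
        (fun j => if j < m then C j else C' (j - m)) := by
  ext w
  have e : ∀ j : ℕ, (m : ℝ≥0) * h + j * h = ((m + j : ℕ) : ℝ≥0) * h := fun j => by push_cast; ring
  simp only [Set.mem_inter_iff, Set.mem_preimage, gridRect, Set.mem_ofPred_eq, st_shift, pos_shift,
    sub_sub_sub_cancel_right, e]
  constructor
  · rintro ⟨⟨h1, h2⟩, h3, h4⟩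
    refine ⟨fun j hj => ?_, fun j hj => ?_⟩
    · split_ifs with hjm
      · exact h1 j hjm
      · have := h3 (j - m) (by omega)
        rwa [show m + (j - m) = j by omega] at this
    · split_ifs with hjm
      · exact h2 j hjm
      · have := h4 (j - m) (by omega)
        rwa [show m + (j - m) = j by omega, show m + (j - m + 1) = j + 1 by omega] at this
  · rintro ⟨h1, h2⟩
    refine ⟨⟨fun j hj => ?_, fun j hj => ?_⟩, fun j hj => ?_, fun j hj => ?_⟩
    · simpa [hj] using h1 j (by omega)
    · simpa [hj] using h2 j (by omega)
    · have := h1 (m + j) (by omega)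
      rcases Nat.eq_zero_or_pos j with rfl | hj0
      · simpa [hs] using this
      · simpa [show ¬ m + j ≤ m by omega] using this
    · simpa [add_assoc] using h2 (m + j) (by omega)

end PathSpace

/-! ### Markov additive laws and the Markov property at grid times. -/

open PathSpace

/-- A family of laws on the path space, indexed by the initial state, that describes a Markov
additive process: on every grid the increments form a Markov additive random walk. -/
structure IsMAP {d : ℕ} (μ : Fin d → Measure (PathSpace d)) : Prop where
  prob : ∀ i, IsProbabilityMeasure (μ i)
  rect : ∀ (h : ℝ≥0) (n : ℕ) (s : ℕ → Fin d) (C : ℕ → Set ℝ), (∀ m, MeasurableSet (C m)) →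
    μ (s 0) (gridRect h n s C) =
      ∏ m ∈ Finset.range n, μ (s m) {w | w.pos h ∈ C m ∧ w.st h = s (m + 1)}

namespace IsMAP

variable {d : ℕ} {μ : Fin d → Measure (PathSpace d)}

lemma ae_st_zero (hμ : IsMAP μ) (i : Fin d) : ∀ᵐ w ∂μ i, w.st 0 = i := by
  have := hμ.prob i
  have h := hμ.rect 0 0 (fun _ => i) (fun _ => Set.univ) fun _ => MeasurableSet.univ
  have hs : gridRect 0 0 (fun _ => i) (fun _ => Set.univ) = {w : PathSpace d | w.st 0 = i} := by
    ext w; simp [gridRect]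
  rw [hs, Finset.range_zero, Finset.prod_empty] at h
  exact (prob_compl_eq_zero_iff (measurable_st 0 (measurableSet_singleton i))).2 h

lemma gridRect_eq_zero (hμ : IsMAP μ) {i : Fin d} {s : ℕ → Fin d} (hs : s 0 ≠ i) (h : ℝ≥0) (n : ℕ)
    (C : ℕ → Set ℝ) : μ i (gridRect h n s C) = 0 := by
  refine measure_mono_null (fun w hw => ?_) (hμ.ae_st_zero i)
  have := hw.1 0 (Nat.zero_le _)
  simp only [Nat.cast_zero, zero_mul] at this
  exact fun h' => hs (this.symm.trans h')

/-- The product formula for the concatenated event splits at step `m`. When the prescribed states do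
not match, both sides vanish. -/
lemma gridRect_inter_shift (hμ : IsMAP μ) (i : Fin d) (h : ℝ≥0) (m n : ℕ) (s s' : ℕ → Fin d)
    {C C' : ℕ → Set ℝ} (hC : ∀ m, MeasurableSet (C m)) (hC' : ∀ m, MeasurableSet (C' m)) :
    μ i (gridRect h m s C ∩ shift (m * h) ⁻¹' gridRect h n s' C') =
      μ i (gridRect h m s C) * μ (s m) (gridRect h n s' C') := by
  by_cases hs' : s' 0 = s m
  · by_cases hs : s 0 = i
    · subst hs
      rw [PathSpace.gridRect_inter_shift h m n s s' C C' hs', hμ.rect h m s C hC, ← hs',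
        hμ.rect h n s' C' hC']
      have := hμ.rect h (m + n) (fun j => if j ≤ m then s j else s' (j - m))
        (fun j => if j < m then C j else C' (j - m))
        (fun j => by split_ifs; exacts [hC j, hC' _])
      simp only [zero_le, if_true] at this
      rw [this, Finset.prod_range_add]
      congr 1
      · refine Finset.prod_congr rfl fun j hj => ?_
        have hj := Finset.mem_range.1 hj
        simp [hj, hj.le, Nat.succ_le_of_lt hj]
      · refine Finset.prod_congr rfl fun j _ => ?_
        have h1 : ¬ m + j + 1 ≤ m := by omega
        rcases Nat.eq_zero_or_pos j with rfl | hj0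
        · simp [hs']
        · have h2 : ¬ m + j ≤ m := by omega
          simp [h1, h2, show m + j + 1 - m = j + 1 by omega]
    · rw [hμ.gridRect_eq_zero hs, zero_mul]
      exact measure_mono_null Set.inter_subset_left (hμ.gridRect_eq_zero hs h m C)
  · rw [hμ.gridRect_eq_zero hs', mul_zero]
    refine measure_mono_null (t := ∅) ?_ measure_empty
    rintro w ⟨h1, h2⟩
    have h3 := h2.1 0 (Nat.zero_le _)
    simp only [st_shift, Nat.cast_zero, zero_mul, add_zero] at h3
    exact hs' (h3.symm.trans (h1.1 m le_rfl))

/-- Fixing only the state at step `m` amounts to summing over the finitely many histories ending in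
it, and these are disjoint grid events. -/
lemma measure_st_inter (i k : Fin d) (h : ℝ≥0) (m : ℕ) {D : Set (PathSpace d)}
    (hD : MeasurableSet D) : μ i ({w | w.st (m * h) = k} ∩ D) =
      ∑ s : Fin (m + 1) → Fin d with extendSeq s m = k,
        μ i (gridRect h m (extendSeq s) (fun _ => Set.univ) ∩ D) := by
  rw [← measure_biUnion_finset]
  · congr 1
    ext w
    simp only [Set.mem_inter_iff, Set.mem_ofPred_eq, Set.mem_iUnion, mem_gridRect_extendSeq_iff,
      Set.mem_univ, implies_true, and_true, exists_prop, Finset.mem_filter, Finset.mem_univ,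
      true_and]
    constructor
    · rintro ⟨rfl, h2⟩
      exact ⟨_, by simp [extendSeq], rfl, h2⟩
    · rintro ⟨s, h1, rfl, h2⟩
      exact ⟨by simpa [extendSeq] using h1, h2⟩
  · intro s _ s' _ hne
    refine Set.disjoint_left.2 fun w hw hw' => hne ?_
    exact (mem_gridRect_extendSeq_iff.1 hw.1).1.trans (mem_gridRect_extendSeq_iff.1 hw'.1).1.symm
  · exact fun s _ => (measurableSet_gridRect h m _ fun _ => MeasurableSet.univ).inter hD

lemma measure_st_inter_shift (hμ : IsMAP μ) (i k : Fin d) (h : ℝ≥0) (m n : ℕ) (s : ℕ → Fin d)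
    {C : ℕ → Set ℝ} (hC : ∀ m, MeasurableSet (C m)) :
    μ i ({w | w.st (m * h) = k} ∩ shift (m * h) ⁻¹' gridRect h n s C) =
      μ i {w | w.st (m * h) = k} * μ k (gridRect h n s C) := by
  have h1 := measure_st_inter (μ := μ) i k h m MeasurableSet.univ
  simp only [Set.inter_univ] at h1
  rw [measure_st_inter i k h m (measurable_shift _ (measurableSet_gridRect h n s hC)), h1,
    Finset.sum_mul]
  refine Finset.sum_congr rfl fun s' hs' => ?_
  rw [hμ.gridRect_inter_shift i h m n _ s (fun _ => MeasurableSet.univ) hC,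
    (Finset.mem_filter.1 hs').2]

/-- The Markov property at a time of the grid, for functions of the grid values. -/
theorem integral_grid_markov (hμ : IsMAP μ) (i k : Fin d) (h : ℝ≥0) (m : ℕ)
    {f g : (ℕ → ℝ × Fin d) → ℝ} (hf : Measurable f) (hg : Measurable g) :
    ∫ w in {w | w.st (m * h) = k}, f (fun j => w.toFun ((min j m : ℕ) * h)) *
        g (fun j => (shift (m * h) w).toFun (j * h)) ∂μ i =
      (∫ w in {w | w.st (m * h) = k}, f (fun j => w.toFun ((min j m : ℕ) * h)) ∂μ i) *
        ∫ w, g (fun j => w.toFun (j * h)) ∂μ k := by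
  have := hμ.prob
  set D : Set (PathSpace d) := {w | w.st (m * h) = k} with hDdef
  have hD : MeasurableSet D := measurable_st _ (measurableSet_singleton k)
  by_cases h0 : μ i D = 0
  · simp [Measure.restrict_eq_zero.2 h0]
  have hne : μ i D ≠ ∞ := measure_ne_top _ _
  -- Conditioning on the state at step `m` turns the claim into two facts about `Q`: past and
  -- shifted future are independent, and the shifted future has law `μ k`.
  set Q : Measure (PathSpace d) := cond (μ i) D with hQ
  have : IsProbabilityMeasure Q := cond_isProbabilityMeasure h0
  have hm₂ : gridSigma h (fun _ => True) ≤ (inferInstance : MeasurableSpace (PathSpace d)) :=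
    MeasurableSpace.generateFrom_le fun _ hA => measurableSet_of_mem_gridPi hA
  have hpast : Measurable[(gridSigma h (· = m))] (fun (w : PathSpace d) (j : ℕ) => w.toFun ((min j m : ℕ) * h)) :=
    @measurable_pi_lambda _ _ _ (gridSigma h (· = m)) _ _ fun j => measurable_grid h (· = m) rfl (min_le_right j m)
  have hgrid : Measurable[(gridSigma h fun _ => True)] (fun (w : PathSpace d) (j : ℕ) => w.toFun (j * h)) :=
    @measurable_pi_lambda _ _ _ (gridSigma h fun _ => True) _ _ fun j =>
      measurable_grid h (fun _ => True) trivial (le_refl j)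
  have hQpost : ∀ B ∈ gridPi (d := d) h (fun _ => True), Q.map (shift (m * h)) B = μ k B := by
    rintro _ ⟨n, s, C, -, hC, rfl⟩
    rw [Measure.map_apply (measurable_shift _) (measurableSet_gridRect h n s hC),
      hQ, cond_apply hD, hμ.measure_st_inter_shift i k h m n s hC, ← mul_assoc,
      ENNReal.inv_mul_cancel h0 hne, one_mul]
  -- Independence is checked on the generating π-systems. There it is the product formula, or
  -- trivial when the past event ends in a state other than `k`.
  have hind : Indep (gridSigma h (· = m)) ((gridSigma h fun _ => True).comap (shift (m * h))) Q := by
    refine IndepSets.indep (MeasurableSpace.generateFrom_le fun _ hA =>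
      measurableSet_of_mem_gridPi hA) ?_ (isPiSystem_gridPi h _)
      ((isPiSystem_gridPi h fun _ => True).comap (shift (m * h))) rfl
      (MeasurableSpace.comap_generateFrom) ?_
    · rintro _ ⟨B, hB, rfl⟩
      exact measurable_shift _ (hm₂ _ hB)
    · rw [IndepSets_iff]
      rintro _ _ ⟨n, s, C, rfl, hC, rfl⟩ ⟨B, hB, rfl⟩
      have hB' := hQpost B hB
      rw [Measure.map_apply (measurable_shift _) (measurableSet_of_mem_gridPi hB)] at hB'
      rw [hB']
      obtain ⟨n', s', C', -, hC', rfl⟩ := hB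
      rw [hQ, cond_apply hD, cond_apply hD]
      by_cases hsn : s n = k
      · have hsub : gridRect h n s C ⊆ D := fun w hw => (hw.1 n le_rfl).trans hsn
        rw [← Set.inter_assoc, Set.inter_eq_right.2 hsub,
          hμ.gridRect_inter_shift i h n n' s s' hC hC', hsn, mul_assoc]
      · have hemp : D ∩ gridRect h n s C = ∅ := by
          ext w
          simp only [Set.mem_inter_iff, Set.mem_empty_iff_false, iff_false, not_and]
          exact fun h1 h2 => hsn ((h2.1 n le_rfl).symm.trans h1)
        rw [← Set.inter_assoc, hemp]
        simp
  -- Both measures are probability measures that agree on the π-system of grid events, hence on the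
  -- σ-algebra it generates.
  have hlaw : ∀ B, MeasurableSet[(gridSigma h fun _ => True)] B → Q.map (shift (m * h)) B = μ k B := by
    have : IsProbabilityMeasure (Q.map (shift (m * h))) :=
      Measure.isProbabilityMeasure_map (measurable_shift _).aemeasurable
    exact fun B hB => ext_on_measurableSpace_of_generate_finite _ _ hQpost hm₂ rfl
      (isPiSystem_gridPi h _) (by simp) hB
  have hpost : Measurable (fun (w : PathSpace d) (j : ℕ) => (shift (m * h) w).toFun (j * h)) :=
    (hgrid.mono hm₂ le_rfl).comp (measurable_shift (m * h))
  have hind' : IndepFun (fun (w : PathSpace d) (j : ℕ) => w.toFun ((min j m : ℕ) * h))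
      (fun (w : PathSpace d) (j : ℕ) => (shift (m * h) w).toFun (j * h)) Q := by
    refine indep_of_indep_of_le_left (indep_of_indep_of_le_right hind ?_) hpast.comap_le
    rintro _ ⟨B, hB, rfl⟩
    exact ⟨_, hgrid hB, rfl⟩
  have hmapeq : Q.map (fun (w : PathSpace d) (j : ℕ) => (shift (m * h) w).toFun (j * h)) =
      (μ k).map (fun (w : PathSpace d) (j : ℕ) => w.toFun (j * h)) := by
    ext B hB
    rw [Measure.map_apply hpost hB, Measure.map_apply (hgrid.mono hm₂ le_rfl) hB,
      ← hlaw _ (hgrid hB), Measure.map_apply (measurable_shift _) (hm₂ _ (hgrid hB))]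
    rfl
  have hpast' : Measurable (fun (w : PathSpace d) (j : ℕ) => w.toFun ((min j m : ℕ) * h)) :=
    measurable_pi_lambda _ fun j => measurable_toFun_apply _
  have hint := (hind'.comp hf hg).integral_fun_mul_eq_mul_integral
    (hf.comp hpast').aestronglyMeasurable (hg.comp hpost).aestronglyMeasurable
  have hgQ : ∫ w, g (fun j => (shift (m * h) w).toFun (j * h)) ∂Q =
      ∫ w, g (fun j => w.toFun (j * h)) ∂μ k := by
    rw [← integral_map hpost.aemeasurable hg.aestronglyMeasurable, hmapeq,
      integral_map (hgrid.mono hm₂ le_rfl).aemeasurable hg.aestronglyMeasurable]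
  simp only [Function.comp_def] at hint
  rw [hgQ, hQ, ProbabilityTheory.cond, integral_smul_measure, integral_smul_measure, smul_mul_assoc] at hint
  exact smul_right_injective ℝ (by
    rw [ENNReal.toReal_inv]
    exact inv_ne_zero (ENNReal.toReal_ne_zero.2 ⟨h0, hne⟩)) hint

end IsMAP

/-! ### Measurability of entrance events. -/

open PathSpace

namespace PathSpace

variable {d : ℕ}

open scoped BoundedContinuousFunction

lemma toFun_shift (r t : ℝ≥0) (w : PathSpace d) :
    (shift r w).toFun t = (w.pos (r + t) - w.pos r, w.st (r + t)) := rfl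

/-- The paths that enter `O`, in state `k`. -/
def hitSet (O : Set ℝ) (k : Fin d) : Set (PathSpace d) :=
  {w | hit O w.pos ≠ ∞ ∧ w.st (hit O w.pos).toNNReal = k}

/-- The paths that are in `O` at a dyadic time of level `n`, in state `k` at the first such time. -/
def hitSetAt (O : Set ℝ) (n : ℕ) (k : Fin d) : Set (PathSpace d) :=
  {w | HitsAt O n w.pos ∧ w.st (hitIdx O n w.pos * dyad n) = k}

lemma measurableSet_hitSet {O : Set ℝ} (hO : IsOpen O) (k : Fin d) :
    MeasurableSet (hitSet O k) := by
  have h := measurable_hit_pos (d := d) hO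
  refine MeasurableSet.inter (h (measurableSet_singleton ∞).compl) ?_
  exact measurable_st_uncurry.comp (h.ennreal_toNNReal.prodMk measurable_id)
    (measurableSet_singleton k)

lemma measurableSet_firstHit {O : Set ℝ} (hO : IsOpen O) (n m : ℕ) :
    MeasurableSet {w : PathSpace d | HitsAt O n w.pos ∧ hitIdx O n w.pos = m} := by
  have : {w : PathSpace d | HitsAt O n w.pos ∧ hitIdx O n w.pos = m} =
      (fun w => w.pos (m * dyad n)) ⁻¹' O ∩ ⋂ j : ℕ, ⋂ _ : j < m,
        (fun w => w.pos (j * dyad n)) ⁻¹' Oᶜ := by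
    ext w
    simp only [Set.mem_ofPred_eq, hitsAt_and_hitIdx_eq_iff]
    simp
  rw [this]
  exact (measurable_pos _ hO.measurableSet).inter (MeasurableSet.iInter fun j =>
    MeasurableSet.iInter fun _ => measurable_pos _ hO.measurableSet.compl)

lemma measurableSet_hitsAt {O : Set ℝ} (hO : IsOpen O) (n : ℕ) :
    MeasurableSet {w : PathSpace d | HitsAt O n w.pos} := by
  have : {w : PathSpace d | HitsAt O n w.pos} =
      ⋃ m : ℕ, (fun w => w.pos (m * dyad n)) ⁻¹' O := by
    ext w
    simp [HitsAt]
  rw [this]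
  exact MeasurableSet.iUnion fun m => measurable_pos _ hO.measurableSet

lemma measurable_hitIdx {O : Set ℝ} (hO : IsOpen O) (n : ℕ) :
    Measurable (fun w : PathSpace d => hitIdx O n w.pos) := by
  refine measurable_to_countable' fun m => ?_
  have : (fun w : PathSpace d => hitIdx O n w.pos) ⁻¹' {m} =
      {w | HitsAt O n w.pos ∧ hitIdx O n w.pos = m} ∪ ({w | HitsAt O n w.pos}ᶜ ∩ {_w | m = 0}) := by
    ext w
    simp only [Set.mem_preimage, Set.mem_singleton_iff, Set.mem_union, Set.mem_ofPred_eq,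
      Set.mem_inter_iff, Set.mem_compl_iff]
    by_cases h : HitsAt O n w.pos
    · simp [h]
    -- Paths that miss `O` at every grid time have index `0`, the infimum of the empty set, and have
    -- to be accounted for separately.
    · have : hitIdx O n w.pos = 0 := by
        have he : {m : ℕ | w.pos (m * dyad n) ∈ O} = ∅ :=
          Set.eq_empty_of_forall_notMem fun m hm => h ⟨m, hm⟩
        rw [hitIdx, he, Nat.sInf_empty]
      simp [h, this, eq_comm]
  rw [this]
  exact (measurableSet_firstHit hO n m).union
    ((measurableSet_hitsAt hO n).compl.inter (MeasurableSet.const _))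

lemma measurable_hitIdx_time {O : Set ℝ} (hO : IsOpen O) (n : ℕ) :
    Measurable (fun w : PathSpace d => (hitIdx O n w.pos * dyad n : ℝ≥0)) :=
  (measurable_from_nat.comp (measurable_hitIdx hO n)).mul_const _

lemma measurableSet_hitSetAt {O : Set ℝ} (hO : IsOpen O) (n : ℕ) (k : Fin d) :
    MeasurableSet (hitSetAt O n k) :=
  (measurableSet_hitsAt hO n).inter (measurable_st_uncurry.comp
    ((measurable_hitIdx_time hO n).prodMk measurable_id) (measurableSet_singleton k))

lemma measurable_pos_comp {α : Type*} {m : MeasurableSpace α} {r : α → ℝ≥0} {w : α → PathSpace d}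
    (hr : Measurable r) (hw : Measurable w) : Measurable fun a => (w a).pos (r a) :=
  measurable_pos_uncurry.comp (hr.prodMk hw)

lemma measurable_st_comp {α : Type*} {m : MeasurableSpace α} {r : α → ℝ≥0} {w : α → PathSpace d}
    (hr : Measurable r) (hw : Measurable w) : Measurable fun a => (w a).st (r a) :=
  measurable_st_uncurry.comp (hr.prodMk hw)

lemma measurable_shift_comp {α : Type*} {m : MeasurableSpace α} {r : α → ℝ≥0}
    {w : α → PathSpace d} (hr : Measurable r) (hw : Measurable w) :
    Measurable fun a => shift (r a) (w a) :=
  measurable_shift_uncurry.comp (hr.prodMk hw)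

end PathSpace

/-! ### Measures determined by products of bounded continuous functions. -/

open scoped BoundedContinuousFunction in
-- Multiplying by a one-point space brings the measure into the form treated by the uniqueness
-- criterion for a factor times a finite product; projecting back removes it.
lemma measure_pi_ext_of_integral {ι E : Type*} [Fintype ι] [TopologicalSpace E]
    [MeasurableSpace E] [BorelSpace E] [HasOuterApproxClosed E] {μ ν : Measure (ι → E)}
    [IsFiniteMeasure μ] [IsFiniteMeasure ν]
    (h : ∀ g : ι → (E →ᵇ ℝ), ∫ u, ∏ t, g t (u t) ∂μ = ∫ u, ∏ t, g t (u t) ∂ν) : μ = ν := by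
  have hprod : (Measure.dirac ()).prod μ = (Measure.dirac ()).prod ν := by
    refine Measure.ext_of_integral_mul_prod_boundedContinuousFunction fun f g => ?_
    rw [integral_prod_mul (fun z => f z) (fun u : ι → E => ∏ j, g j (u j)),
      integral_prod_mul (fun z => f z) (fun u : ι → E => ∏ j, g j (u j)), h]
  have := congrArg (Measure.map Prod.snd) hprod
  simpa using this

open scoped BoundedContinuousFunction in
lemma measure_process_ext_of_integral {S E : Type*} [TopologicalSpace E]
    [MeasurableSpace E] [BorelSpace E] [HasOuterApproxClosed E] {μ ν : Measure (S → E)}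
    [IsFiniteMeasure μ] [IsFiniteMeasure ν]
    (h : ∀ (I : Finset S) (g : I → (E →ᵇ ℝ)),
      ∫ u, ∏ t, g t (u t) ∂μ = ∫ u, ∏ t, g t (u t) ∂ν) : μ = ν := by
  have h1 : IsProjectiveLimit μ fun I => μ.map I.restrict := fun I => rfl
  have h2 : IsProjectiveLimit ν fun I => μ.map I.restrict := fun I => by
    have hr := Finset.measurable_restrict (X := fun _ : S => E) I
    refine measure_pi_ext_of_integral fun g => ?_
    have hg : Measurable (fun u : I → E => ∏ t, g t (u t)) :=
      Finset.measurable_prod _ fun t _ => (g t).continuous.measurable.comp (measurable_pi_apply _)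
    rw [integral_map hr.aemeasurable hg.aestronglyMeasurable,
      integral_map hr.aemeasurable hg.aestronglyMeasurable]
    exact (h I g).symm
  exact h1.unique h2

/-! ### The strong Markov property at entrance times of open sets. -/

namespace IsMAP

open scoped BoundedContinuousFunction

variable {d : ℕ} {μ : Fin d → Measure (PathSpace d)}

/-- Split according to the index `m` of the first grid time in `O`: on each piece the time is
deterministic and the Markov property on the grid applies. The times in `J` are rounded up to the
grid so that the future factor is a functional of grid values. -/
lemma integral_hitSetAt (hμ : IsMAP μ) {O : Set ℝ} (hO : IsOpen O) (i k : Fin d) (n : ℕ)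
    (f : ℝ≥0 × ℝ →ᵇ ℝ) (J : Finset ℝ≥0) (g : J → (ℝ × Fin d →ᵇ ℝ)) :
    ∫ w in hitSetAt O n k, f (hitIdx O n w.pos * dyad n, w.pos (hitIdx O n w.pos * dyad n)) *
        ∏ t, g t ((shift (hitIdx O n w.pos * dyad n) w).toFun (dyadIdx n t * dyad n)) ∂μ i =
      (∫ w in hitSetAt O n k,
        f (hitIdx O n w.pos * dyad n, w.pos (hitIdx O n w.pos * dyad n)) ∂μ i) *
      ∫ w, ∏ t, g t (w.toFun (dyadIdx n t * dyad n)) ∂μ k := by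
  have := hμ.prob
  classical
  set A : ℕ → Set (PathSpace d) := fun m => {w | HitsAt O n w.pos ∧ hitIdx O n w.pos = m} with hA
  set S : ℕ → Set (PathSpace d) := fun m => {w | w.st (m * dyad n) = k} with hS
  have hAm : ∀ m, MeasurableSet (A m) := measurableSet_firstHit hO n
  have hSm : ∀ m, MeasurableSet (S m) := fun m => measurable_st _ (measurableSet_singleton k)
  have hU : hitSetAt O n k = ⋃ m, S m ∩ A m := by
    ext w
    simp only [hitSetAt, hA, hS, Set.mem_ofPred_eq, Set.mem_iUnion, Set.mem_inter_iff]
    constructor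
    · rintro ⟨h1, h2⟩
      exact ⟨_, h2, h1, rfl⟩
    · rintro ⟨m, h1, h2, rfl⟩
      exact ⟨h2, h1⟩
  have hdisj : Pairwise (Function.onFun Disjoint fun m => S m ∩ A m) := fun m m' hne =>
    Set.disjoint_left.2 fun w hw hw' => hne (hw.2.2.symm.trans hw'.2.2)
  have hfm : Measurable fun w : PathSpace d =>
      f (hitIdx O n w.pos * dyad n, w.pos (hitIdx O n w.pos * dyad n)) :=
    f.continuous.measurable.comp ((measurable_hitIdx_time hO n).prodMk
      (measurable_pos_comp (measurable_hitIdx_time hO n) measurable_id))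
  have hgm : Measurable fun w : PathSpace d =>
      ∏ t, g t ((shift (hitIdx O n w.pos * dyad n) w).toFun (dyadIdx n t * dyad n)) :=
    Finset.measurable_prod _ fun t _ => (g t).continuous.measurable.comp
      ((measurable_toFun_apply _).comp (measurable_shift_comp (measurable_hitIdx_time hO n)
        measurable_id))
  have hgb : ∀ u : J → ℝ × Fin d, ‖∏ t, g t (u t)‖ ≤ ∏ t, ‖g t‖ := fun u => by
    rw [norm_prod]
    exact Finset.prod_le_prod (fun _ _ => norm_nonneg _) fun t _ => (g t).norm_coe_le_norm _
  have hint1 : Integrable (fun w : PathSpace d =>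
      f (hitIdx O n w.pos * dyad n, w.pos (hitIdx O n w.pos * dyad n))) (μ i) :=
    Integrable.of_bound hfm.aestronglyMeasurable ‖f‖
      (Filter.Eventually.of_forall fun w => f.norm_coe_le_norm _)
  have hint2 : Integrable (fun w : PathSpace d =>
      f (hitIdx O n w.pos * dyad n, w.pos (hitIdx O n w.pos * dyad n)) *
        ∏ t, g t ((shift (hitIdx O n w.pos * dyad n) w).toFun (dyadIdx n t * dyad n))) (μ i) :=
    hint1.mul_bdd hgm.aestronglyMeasurable (c := ∏ t, ‖g t‖)
      (Filter.Eventually.of_forall fun w => hgb _)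
  have h1 := hasSum_integral_iUnion (fun m => (hSm m).inter (hAm m)) hdisj hint1.integrableOn
  have h2 := hasSum_integral_iUnion (fun m => (hSm m).inter (hAm m)) hdisj hint2.integrableOn
  rw [← hU] at h1 h2
  refine h2.unique ?_
  convert! h1.mul_right (∫ w, ∏ t, g t (w.toFun (dyadIdx n t * dyad n)) ∂μ k) using 2 with m
  -- `F` contains the indicator that `m` is the first index in `O`. It looks at coordinates up to
  -- `m` only, so stopping the path at step `m` does not change it.
  set F : (ℕ → ℝ × Fin d) → ℝ := fun u =>
    if (u m).1 ∈ O ∧ ∀ j < m, (u j).1 ∉ O then f (m * dyad n, (u m).1) else 0 with hF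
  set G : (ℕ → ℝ × Fin d) → ℝ := fun u => ∏ t, g t (u (dyadIdx n t)) with hG
  have hFm : Measurable F := by
    refine Measurable.ite ?_ ?_ measurable_const
    · refine MeasurableSet.inter ?_ ?_
      · exact (measurable_fst.comp (measurable_pi_apply m)) hO.measurableSet
      · have : {u : ℕ → ℝ × Fin d | ∀ j < m, (u j).1 ∉ O} = ⋂ j : ℕ, ⋂ _ : j < m,
            (fun u : ℕ → ℝ × Fin d => (u j).1) ⁻¹' Oᶜ := by ext u; simp
        change MeasurableSet {u : ℕ → ℝ × Fin d | ∀ j < m, (u j).1 ∉ O}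
        rw [this]
        exact MeasurableSet.iInter fun j => MeasurableSet.iInter fun _ =>
          (measurable_fst.comp (measurable_pi_apply j)) hO.measurableSet.compl
    · exact f.continuous.measurable.comp (measurable_const.prodMk
        (measurable_fst.comp (measurable_pi_apply m)))
  have hGm : Measurable G := Finset.measurable_prod _ fun t _ =>
    (g t).continuous.measurable.comp (measurable_pi_apply _)
  have hFA : ∀ w : PathSpace d, F (fun j => w.toFun ((min j m : ℕ) * dyad n)) = (A m).indicator
      (fun w => f (hitIdx O n w.pos * dyad n, w.pos (hitIdx O n w.pos * dyad n))) w := by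
    intro w
    have hiff : ((w.toFun (m * dyad n)).1 ∈ O ∧
        ∀ j < m, (w.toFun ((min j m : ℕ) * dyad n)).1 ∉ O) ↔ w ∈ A m := by
      change (w.pos (m * dyad n) ∈ O ∧ ∀ j < m, w.pos ((min j m : ℕ) * dyad n) ∉ O) ↔ w ∈ A m
      simp only [hA, Set.mem_ofPred_eq, hitsAt_and_hitIdx_eq_iff]
      refine and_congr_right fun _ => forall₂_congr fun j hj => ?_
      rw [min_eq_left hj.le]
    simp only [hF, min_self]
    by_cases hw : w ∈ A m
    · rw [if_pos (hiff.2 hw), Set.indicator_of_mem hw, hw.2]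
      rfl
    · rw [if_neg (fun h => hw (hiff.1 h)), Set.indicator_of_notMem hw]
  have key := hμ.integral_grid_markov i k (dyad n) m hFm hGm
  simp only [hFA] at key
  rw [setIntegral_indicator (hAm m)] at key
  rw [← setIntegral_indicator (hAm m)]
  refine (setIntegral_congr_fun (hSm m) fun w _ => ?_).trans key
  by_cases hw : w ∈ A m
  · rw [Set.indicator_of_mem hw, Set.indicator_of_mem hw, hw.2]
  · rw [Set.indicator_of_notMem hw, Set.indicator_of_notMem hw, zero_mul]

/-- The limit of the dyadic versions. Levels converge by right-continuity. The state, being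
discrete, is eventually equal to its limit, so the indicators stabilise. Dominated convergence
applies since all test functions are bounded. -/
lemma integral_hitSet (hμ : IsMAP μ) {O : Set ℝ} (hO : IsOpen O) (i k : Fin d)
    (f : ℝ≥0 × ℝ →ᵇ ℝ) (J : Finset ℝ≥0) (g : J → (ℝ × Fin d →ᵇ ℝ)) :
    ∫ w in hitSet O k, f ((hit O w.pos).toNNReal, w.pos (hit O w.pos).toNNReal) *
        ∏ t, g t ((shift (hit O w.pos).toNNReal w).toFun t) ∂μ i =
      (∫ w in hitSet O k, f ((hit O w.pos).toNNReal, w.pos (hit O w.pos).toNNReal) ∂μ i) *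
      ∫ w, ∏ t, g t (w.toFun t) ∂μ k := by
  have := hμ.prob
  have hgb : ∀ u : J → ℝ × Fin d, ‖∏ t, g t (u t)‖ ≤ ∏ t, ‖g t‖ := fun u => by
    rw [norm_prod]
    exact Finset.prod_le_prod (fun _ _ => norm_nonneg _) fun t _ => (g t).norm_coe_le_norm _
  have hfm : ∀ n, Measurable fun w : PathSpace d =>
      f (hitIdx O n w.pos * dyad n, w.pos (hitIdx O n w.pos * dyad n)) := fun n =>
    f.continuous.measurable.comp ((measurable_hitIdx_time hO n).prodMk
      (measurable_pos_comp (measurable_hitIdx_time hO n) measurable_id))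
  -- eventually constant indicators
  have hlim : ∀ w : PathSpace d, w ∈ hitSet O k → ∀ᶠ n in Filter.atTop, w ∈ hitSetAt O n k := by
    rintro w ⟨h1, h2⟩
    have hst := (w.rightCts_st (hit O w.pos).toNNReal).tendsto.comp
      (tendsto_hitIdx hO w.rightCts_pos h1)
    rw [nhds_discrete] at hst
    filter_upwards [eventually_hitsAt hO w.rightCts_pos h1, Filter.tendsto_pure.1 hst] with n h3 h4
    exact ⟨h3, h4.trans h2⟩
  have hlim' : ∀ w : PathSpace d, w ∉ hitSet O k →
      ∀ᶠ n in Filter.atTop, w ∉ hitSetAt O n k := by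
    intro w hw
    by_cases h1 : hit O w.pos = ∞
    · exact Filter.Eventually.of_forall fun n h => not_hitsAt_of_hit_eq_top h1 n h.1
    · have hst := (w.rightCts_st (hit O w.pos).toNNReal).tendsto.comp
        (tendsto_hitIdx hO w.rightCts_pos h1)
      rw [nhds_discrete] at hst
      filter_upwards [Filter.tendsto_pure.1 hst] with n h4 h5
      exact hw ⟨h1, h4.symm.trans h5.2⟩
  have hf_lim : ∀ w : PathSpace d, w ∈ hitSet O k → Filter.Tendsto
      (fun n => f (hitIdx O n w.pos * dyad n, w.pos (hitIdx O n w.pos * dyad n))) Filter.atTop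
      (𝓝 (f ((hit O w.pos).toNNReal, w.pos (hit O w.pos).toNNReal))) := by
    rintro w ⟨h1, h2⟩
    have ht := tendsto_hitIdx hO w.rightCts_pos h1
    exact (f.continuous.tendsto _).comp ((ht.mono_right nhdsWithin_le_nhds).prodMk_nhds
      ((w.rightCts_pos _).tendsto.comp ht))
  have hg_lim : ∀ w : PathSpace d, w ∈ hitSet O k → Filter.Tendsto (fun n => ∏ t, g t
      ((shift (hitIdx O n w.pos * dyad n) w).toFun (dyadIdx n t * dyad n))) Filter.atTop
      (𝓝 (∏ t, g t ((shift (hit O w.pos).toNNReal w).toFun t))) := by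
    rintro w ⟨h1, h2⟩
    have ht := tendsto_hitIdx hO w.rightCts_pos h1
    refine tendsto_finsetProd _ fun t _ => ((g t).continuous.tendsto _).comp ?_
    have hsum : Filter.Tendsto (fun n => hitIdx O n w.pos * dyad n + dyadIdx n t * dyad n)
        Filter.atTop (𝓝[Set.Ici ((hit O w.pos).toNNReal + t)] ((hit O w.pos).toNNReal + t)) := by
      refine tendsto_nhdsWithin_iff.2 ⟨(ht.mono_right nhdsWithin_le_nhds).add
        ((tendsto_dyadIdx t).mono_right nhdsWithin_le_nhds), ?_⟩
      filter_upwards [tendsto_nhdsWithin_iff.1 ht |>.2] with n hn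
      exact add_le_add hn (lt_dyadIdx n t).le
    simp only [toFun_shift]
    exact (((w.rightCts_pos _).tendsto.comp hsum).sub
      ((w.rightCts_pos _).tendsto.comp ht)).prodMk_nhds ((w.rightCts_st _).tendsto.comp hsum)
  have l1 : Filter.Tendsto (fun n => ∫ w in hitSetAt O n k,
      f (hitIdx O n w.pos * dyad n, w.pos (hitIdx O n w.pos * dyad n)) *
        ∏ t, g t ((shift (hitIdx O n w.pos * dyad n) w).toFun (dyadIdx n t * dyad n)) ∂μ i)
      Filter.atTop (𝓝 (∫ w in hitSet O k,
        f ((hit O w.pos).toNNReal, w.pos (hit O w.pos).toNNReal) *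
        ∏ t, g t ((shift (hit O w.pos).toNNReal w).toFun t) ∂μ i)) := by
    simp_rw [← integral_indicator (measurableSet_hitSetAt hO _ k),
      ← integral_indicator (measurableSet_hitSet hO k)]
    refine tendsto_integral_of_dominated_convergence (fun _ => ‖f‖ * ∏ t, ‖g t‖) (fun n => ?_)
      (integrable_const _) (fun n => Filter.Eventually.of_forall fun w => ?_)
      (Filter.Eventually.of_forall fun w => ?_)
    · refine (Measurable.indicator ?_ (measurableSet_hitSetAt hO n k)).aestronglyMeasurable
      exact (hfm n).mul (Finset.measurable_prod _ fun t _ => (g t).continuous.measurable.comp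
        ((measurable_toFun_apply _).comp (measurable_shift_comp (measurable_hitIdx_time hO n)
          measurable_id)))
    · refine (norm_indicator_le_norm_self _ _).trans ?_
      rw [norm_mul]
      exact mul_le_mul (f.norm_coe_le_norm _) (hgb _) (norm_nonneg _) (norm_nonneg _)
    · by_cases hw : w ∈ hitSet O k
      · rw [Set.indicator_of_mem hw]
        refine ((hf_lim w hw).mul (hg_lim w hw)).congr' ?_
        filter_upwards [hlim w hw] with n hn
        rw [Set.indicator_of_mem hn]
      · rw [Set.indicator_of_notMem hw]
        refine tendsto_const_nhds.congr' ?_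
        filter_upwards [hlim' w hw] with n hn
        rw [Set.indicator_of_notMem hn]
  have l2 : Filter.Tendsto (fun n => ∫ w in hitSetAt O n k,
      f (hitIdx O n w.pos * dyad n, w.pos (hitIdx O n w.pos * dyad n)) ∂μ i)
      Filter.atTop (𝓝 (∫ w in hitSet O k,
        f ((hit O w.pos).toNNReal, w.pos (hit O w.pos).toNNReal) ∂μ i)) := by
    simp_rw [← integral_indicator (measurableSet_hitSetAt hO _ k),
      ← integral_indicator (measurableSet_hitSet hO k)]
    refine tendsto_integral_of_dominated_convergence (fun _ => ‖f‖) (fun n => ?_)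
      (integrable_const _) (fun n => Filter.Eventually.of_forall fun w => ?_)
      (Filter.Eventually.of_forall fun w => ?_)
    · exact (Measurable.indicator (hfm n) (measurableSet_hitSetAt hO n k)).aestronglyMeasurable
    · exact (norm_indicator_le_norm_self _ _).trans (f.norm_coe_le_norm _)
    · by_cases hw : w ∈ hitSet O k
      · rw [Set.indicator_of_mem hw]
        refine (hf_lim w hw).congr' ?_
        filter_upwards [hlim w hw] with n hn
        rw [Set.indicator_of_mem hn]
      · rw [Set.indicator_of_notMem hw]
        refine tendsto_const_nhds.congr' ?_
        filter_upwards [hlim' w hw] with n hn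
        rw [Set.indicator_of_notMem hn]
  have l3 : Filter.Tendsto (fun n => ∫ w, ∏ t, g t (w.toFun (dyadIdx n t * dyad n)) ∂μ k)
      Filter.atTop (𝓝 (∫ w, ∏ t, g t (w.toFun t) ∂μ k)) := by
    refine tendsto_integral_of_dominated_convergence (fun _ => ∏ t, ‖g t‖) (fun n => ?_)
      (integrable_const _) (fun n => Filter.Eventually.of_forall fun w => hgb _)
      (Filter.Eventually.of_forall fun w => ?_)
    · exact (Finset.measurable_prod _ fun t _ => (g t).continuous.measurable.comp
        (measurable_toFun_apply _)).aestronglyMeasurable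
    · exact tendsto_finsetProd _ fun t _ => ((g t).continuous.tendsto _).comp
        ((w.rightCts _).tendsto.comp (tendsto_dyadIdx t))
  refine tendsto_nhds_unique l1 ?_
  simp_rw [hμ.integral_hitSetAt hO i k]
  exact l2.mul l3

/-- The strong Markov property at the first entrance into an open set. -/
theorem strongMarkov (hμ : IsMAP μ) {O : Set ℝ} (hO : IsOpen O) (i k : Fin d) :
    ((μ i).restrict (hitSet O k)).map (fun w => (((hit O w.pos).toNNReal,
        w.pos (hit O w.pos).toNNReal), shift (hit O w.pos).toNNReal w)) =
      (((μ i).restrict (hitSet O k)).map (fun w => ((hit O w.pos).toNNReal,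
        w.pos (hit O w.pos).toNNReal))).prod (μ k) := by
  have := hμ.prob
  set D := hitSet O k
  have hD : MeasurableSet D := measurableSet_hitSet hO k
  have hρ : Measurable fun w : PathSpace d => (hit O w.pos).toNNReal :=
    (measurable_hit_pos hO).ennreal_toNNReal
  have hZ : Measurable fun w : PathSpace d => ((hit O w.pos).toNNReal,
      w.pos (hit O w.pos).toNNReal) := hρ.prodMk (measurable_pos_comp hρ measurable_id)
  have hsh : Measurable fun w : PathSpace d => shift (hit O w.pos).toNNReal w :=
    measurable_shift_comp hρ measurable_id
  by_cases h0 : μ i D = 0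
  · rw [Measure.restrict_eq_zero.2 h0]; simp
  have hne : μ i D ≠ ∞ := measure_ne_top _ _
  -- As at grid times: under the conditioned measure the future has law `μ k` (the case `f = 1`) and
  -- is independent of the entrance time and level. Both statements are read off from products of
  -- test functions.
  set Q : Measure (PathSpace d) := cond (μ i) D with hQ
  have : IsProbabilityMeasure Q := cond_isProbabilityMeasure h0
  have hpos : (μ i D).toReal ≠ 0 := ENNReal.toReal_ne_zero.2 ⟨h0, hne⟩
  have hQint : ∀ F : PathSpace d → ℝ, ∫ w, F w ∂Q = (μ i D).toReal⁻¹ * ∫ w in D, F w ∂μ i := by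
    intro F
    rw [hQ, ProbabilityTheory.cond, integral_smul_measure, ENNReal.toReal_inv, smul_eq_mul]
  have hQ1 : ∀ (J : Finset ℝ≥0) (g : J → (ℝ × Fin d →ᵇ ℝ)),
      ∫ w, ∏ t, g t ((shift (hit O w.pos).toNNReal w).toFun t) ∂Q =
        ∫ w, ∏ t, g t (w.toFun t) ∂μ k := by
    intro J g
    have h := hμ.integral_hitSet hO i k (BoundedContinuousFunction.const _ 1) J g
    simp only [BoundedContinuousFunction.const_apply, one_mul, integral_const, smul_eq_mul,
      mul_one, measureReal_restrict_apply_univ] at h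
    rw [hQint, h, ← mul_assoc, measureReal_def, inv_mul_cancel₀ hpos, one_mul]
  have hfdd : Q.map (fun w t => (shift (hit O w.pos).toNNReal w).toFun t) =
      (μ k).map (fun w t => w.toFun t) := by
    have hm1 : Measurable fun (w : PathSpace d) t => (shift (hit O w.pos).toNNReal w).toFun t :=
      measurable_toFun.comp hsh
    have hm2 : Measurable fun (w : PathSpace d) t => w.toFun t := measurable_toFun
    have h1 := Measure.isProbabilityMeasure_map (μ := Q) hm1.aemeasurable
    have h2 := Measure.isProbabilityMeasure_map (μ := μ k) hm2.aemeasurable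
    refine measure_process_ext_of_integral fun I g => ?_
    have hg : Measurable (fun u : ℝ≥0 → ℝ × Fin d => ∏ t, g t (u t)) :=
      Finset.measurable_prod _ fun t _ => (g t).continuous.measurable.comp (measurable_pi_apply _)
    rw [integral_map hm2.aemeasurable hg.aestronglyMeasurable,
      integral_map hm1.aemeasurable hg.aestronglyMeasurable]
    exact hQ1 I g
  have hind : IndepFun (fun w : PathSpace d => ((hit O w.pos).toNNReal,
      w.pos (hit O w.pos).toNNReal))
      (fun w t => (shift (hit O w.pos).toNNReal w).toFun t) Q := by
    refine indepFun_process_of_prod_bcf hZ.aemeasurable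
      (fun t => ((measurable_toFun_apply t).comp hsh).aemeasurable) fun f J g => ?_
    have h := hμ.integral_hitSet hO i k f J g
    simp only [Pi.mul_apply, Finset.prod_apply, Function.comp_apply]
    rw [hQ1, hQint, hQint, h, mul_assoc]
  have hpair := (indepFun_iff_map_prod_eq_prod_map_map hZ.aemeasurable
    (measurable_toFun.comp hsh).aemeasurable).1 hind
  refine PathSpace.measure_ext ?_
  have hm3 := hZ.prodMk hsh
  have hm4 : Measurable (Prod.map id toFun : (ℝ≥0 × ℝ) × PathSpace d → _) :=
    measurable_id.prodMap measurable_toFun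
  have e1 : (μ i).restrict D = (μ i D) • Q := by
    rw [hQ, ProbabilityTheory.cond, smul_smul, ENNReal.mul_inv_cancel h0 hne, one_smul]
  rw [Measure.map_map hm4 hm3, ← Measure.map_prod_map _ _ measurable_id measurable_toFun,
    Measure.map_id, e1, Measure.map_smul, Measure.map_smul, Measure.prod_smul_left]
  congr 1
  refine Eq.trans ?_ (hpair.trans ?_)
  · rfl
  · congr 1

end IsMAP

/-! ### First passage below a level. -/

open PathSpace

/-- The levels below `-a`. -/
def lowSet (a : ℝ) : Set ℝ := {y | a < -y}

lemma isOpen_lowSet (a : ℝ) : IsOpen (lowSet a) := isOpen_lt continuous_const continuous_neg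

section Passage

variable {d : ℕ}

/-- The level at passage lies in the closure of the target, hence is at most `-a`. It is at least
`-a` because it was so beforehand and jumps are upwards. Downward passage is thus continuous. -/
lemma pos_hit_lowSet {a : ℝ} (ha : 0 ≤ a) {w : PathSpace d} (h : hit (lowSet a) w.pos ≠ ∞) :
    w.pos (hit (lowSet a) w.pos).toNNReal = -a := by
  refine le_antisymm ?_ ?_
  · have h1 := mem_closure_hit (isOpen_lowSet a) w.rightCts_pos h
    have h2 : closure (lowSet a) ⊆ Set.Iic (-a) :=
      closure_minimal (fun y hy => by simp only [lowSet, Set.mem_ofPred_eq] at hy; simp; linarith)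
        isClosed_Iic
    exact h2 h1
  · rcases eq_or_ne (hit (lowSet a) w.pos).toNNReal 0 with h0 | h0
    · rw [h0, w.pos_zero]; linarith
    · refine w.le_pos_of_forall_lt (r := 0) (pos_iff_ne_zero.2 h0) fun s _ hs => ?_
      have : w.pos s ∉ lowSet a := notMem_of_lt_hit (by
        rw [← ENNReal.coe_toNNReal h]; exact_mod_cast hs)
      simp only [lowSet, Set.mem_ofPred_eq, not_lt] at this
      linarith

lemma hit_lowSet_add {a b : ℝ} (ha : 0 ≤ a) (hb : 0 ≤ b) {w : PathSpace d}
    (h : hit (lowSet a) w.pos ≠ ∞) : hit (lowSet (a + b)) w.pos =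
      (hit (lowSet a) w.pos).toNNReal +
        hit (lowSet b) (shift (hit (lowSet a) w.pos).toNNReal w).pos := by
  rw [hit_eq_add (r := (hit (lowSet a) w.pos).toNNReal)]
  · rw [pos_hit_lowSet ha h]
    congr 2
    · ext y
      simp only [lowSet, Set.mem_ofPred_eq]
      constructor <;> intro <;> linarith
    · funext t
      rw [pos_shift, pos_hit_lowSet ha h]
  · intro t ht
    have : w.pos t ∉ lowSet a := notMem_of_lt_hit (by
      rw [← ENNReal.coe_toNNReal h]; exact_mod_cast ht)
    simp only [lowSet, Set.mem_ofPred_eq, not_lt] at this ⊢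
    linarith

lemma hit_lowSet_mono {a b : ℝ} (hab : a ≤ b) (f : ℝ≥0 → ℝ) :
    hit (lowSet a) f ≤ hit (lowSet b) f :=
  le_hit_iff.2 fun _ ht => hit_le (lt_of_le_of_lt hab ht)

end Passage

/-! ### Exponential moments and transforms of spectrally-positive Lévy processes. -/

section Levy

variable {Ω : Type*} [MeasurableSpace Ω] {P : Measure Ω} {L : ℝ≥0 → Ω → ℝ}

/-- The path of a spectrally-positive Lévy process. -/
def levyPath (hL : IsSpectrallyPositiveLevy P L) (ω : Ω) : PathSpace 1 :=
  ⟨fun t => (L t ω, 0), fun t => (hL.cadlag ω t).1.prodMk continuousWithinAt_const, hL.zero ω,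
    fun t => by
      obtain ⟨l, hl⟩ := (hL.cadlag ω t).2
      rcases eq_or_ne t 0 with rfl | ht
      · refine ⟨L 0 ω, ?_, le_rfl⟩
        have : 𝓝[<] (0 : ℝ≥0) = ⊥ := by
          rw [show Set.Iio (0 : ℝ≥0) = ∅ by ext; simp, nhdsWithin_empty]
        rw [this]
        exact Filter.tendsto_bot
      · have : (𝓝[<] t).NeBot := nhdsLT_neBot_of_exists_lt ⟨0, pos_iff_ne_zero.2 ht⟩
        refine ⟨l, hl, ?_⟩
        have := hL.no_neg_jump ω t
        rwa [leftLim_eq_of_tendsto hl] at this⟩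

lemma pos_levyPath (hL : IsSpectrallyPositiveLevy P L) (ω : Ω) (t : ℝ≥0) :
    (levyPath hL ω).pos t = L t ω := rfl

lemma measurable_levyPath (hL : IsSpectrallyPositiveLevy P L) : Measurable (levyPath hL) :=
  measurable_of_apply hL.measurable fun _ => measurable_const

/-- A Lévy process is a Markov additive process with a single state, so the strong Markov property
becomes available for it. -/
lemma isMAP_levy [IsProbabilityMeasure P] (hL : IsSpectrallyPositiveLevy P L) :
    IsMAP (fun _ : Fin 1 => P.map (levyPath hL)) where
  prob _ := Measure.isProbabilityMeasure_map (measurable_levyPath hL).aemeasurable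
  rect h n s C hC := by
    have hmono : Monotone fun m : ℕ => (m : ℝ≥0) * h := fun a b hab => by
      beta_reduce; gcongr
    have hind := hL.indep_increments.nat hmono
    rw [Measure.map_apply (measurable_levyPath hL) (measurableSet_gridRect h n s hC)]
    have hset : levyPath hL ⁻¹' gridRect h n s C = ⋂ m ∈ Finset.range n,
        (fun ω => L ((m + 1 : ℕ) * h) ω - L (m * h) ω) ⁻¹' C m := by
      ext ω
      simp only [gridRect, Set.mem_preimage, Set.mem_ofPred_eq, pos_levyPath, Finset.mem_range,
        Set.mem_iInter]
      exact and_iff_right fun m _ => Subsingleton.elim _ _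
    rw [hset, hind.measure_inter_preimage_eq_mul _ fun m _ => hC m]
    refine Finset.prod_congr rfl fun m _ => ?_
    have hms : MeasurableSet {w : PathSpace 1 | w.pos h ∈ C m ∧ w.st h = s (m + 1)} :=
      (PathSpace.measurable_pos h (hC m)).inter (measurable_st h (measurableSet_singleton _))
    rw [Measure.map_apply (measurable_levyPath hL) hms]
    have hset2 : levyPath hL ⁻¹' {w : PathSpace 1 | w.pos h ∈ C m ∧ w.st h = s (m + 1)} =
        L h ⁻¹' C m := by
      ext ω
      simp only [Set.mem_preimage, Set.mem_ofPred_eq, pos_levyPath]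
      exact and_iff_left (Subsingleton.elim _ _)
    rw [hset2]
    have := (hL.stationary_increments (m * h) h).measure_mem_eq (hC m)
    rw [← this]
    congr 1
    ext ω
    simp only [Set.mem_preimage, Nat.cast_add, Nat.cast_one, add_mul, one_mul]

/-- To pass below `-(a + b)` by time `t`, the process has to pass below `-a` by time `t` and then
descend by a further `b` within another `t`. It sits exactly at `-a` when it restarts, whence the
product bound. -/
lemma hit_lowSet_measure_add {μ : Fin 1 → Measure (PathSpace 1)} (hμ : IsMAP μ)
    {a b : ℝ} (ha : 0 ≤ a) (hb : 0 ≤ b) (t : ℝ≥0) :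
    μ 0 {w | hit (lowSet (a + b)) w.pos ≤ t} ≤
      μ 0 {w | hit (lowSet a) w.pos ≤ t} * μ 0 {w | hit (lowSet b) w.pos ≤ t} := by
  have := hμ.prob
  set ρ : PathSpace 1 → ℝ≥0 := fun w => (hit (lowSet a) w.pos).toNNReal with hρdef
  have hρ : Measurable ρ := (measurable_hit_pos (isOpen_lowSet a)).ennreal_toNNReal
  have hsm := hμ.strongMarkov (isOpen_lowSet a) 0 0
  have hB : MeasurableSet {w : PathSpace 1 | hit (lowSet b) w.pos ≤ t} :=
    measurable_hit_pos (isOpen_lowSet b) measurableSet_Iic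
  have hA : MeasurableSet {p : ℝ≥0 × ℝ | p.1 ≤ t} := measurable_fst measurableSet_Iic
  have hm1 : Measurable fun w : PathSpace 1 => (ρ w, w.pos (ρ w)) :=
    hρ.prodMk (measurable_pos_comp hρ measurable_id)
  have h := congrArg (fun m => m ({p : ℝ≥0 × ℝ | p.1 ≤ t} ×ˢ
    {w : PathSpace 1 | hit (lowSet b) w.pos ≤ t})) hsm
  simp only [Measure.prod_prod] at h
  have hm2 : Measurable fun w : PathSpace 1 => ((ρ w, w.pos (ρ w)), shift (ρ w) w) :=
    hm1.prodMk (measurable_shift_comp hρ measurable_id)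
  simp only [hρdef] at hm1 hm2
  rw [Measure.map_apply hm2 (hA.prod hB),
    Measure.map_apply hm1 hA, Measure.restrict_apply' (measurableSet_hitSet (isOpen_lowSet a) 0),
    Measure.restrict_apply' (measurableSet_hitSet (isOpen_lowSet a) 0)] at h
  refine le_trans (measure_mono ?_) (h.le.trans (mul_le_mul_left (measure_mono ?_) _))
  · intro w hw
    have hwa : hit (lowSet a) w.pos ≤ t := (hit_lowSet_mono (by linarith) _).trans hw
    have hne : hit (lowSet a) w.pos ≠ ∞ := (hwa.trans_lt ENNReal.coe_lt_top).ne
    refine ⟨⟨?_, ?_⟩, hne, Subsingleton.elim _ _⟩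
    · exact (ENNReal.toNNReal_mono ENNReal.coe_ne_top hwa).trans_eq (ENNReal.toNNReal_coe _)
    · have hw' : hit (lowSet (a + b)) w.pos ≤ t := hw
      rw [hit_lowSet_add ha hb hne] at hw'
      exact le_add_self.trans hw'
  · rintro w ⟨h1, h2, -⟩
    have h1' : ρ w ≤ t := h1
    change hit (lowSet a) w.pos ≤ t
    rw [← ENNReal.coe_toNNReal h2]
    exact_mod_cast h1'

lemma hit_lowSet_measure_pow {μ : Fin 1 → Measure (PathSpace 1)} (hμ : IsMAP μ) (t : ℝ≥0)
    (n : ℕ) : μ 0 {w | hit (lowSet n) w.pos ≤ t} ≤ μ 0 {w | hit (lowSet 1) w.pos ≤ t} ^ n := by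
  have := hμ.prob
  induction n with
  | zero => simpa using prob_le_one
  | succ n ih =>
    have := hit_lowSet_measure_add hμ (Nat.cast_nonneg n) zero_le_one t
    push_cast
    rw [pow_succ]
    exact this.trans (mul_le_mul_left ih _)

lemma tendsto_hit_lowSet_measure {μ : Measure (PathSpace 1)} [IsFiniteMeasure μ] :
    Filter.Tendsto (fun n => μ {w | hit (lowSet 1) w.pos ≤ dyad n}) Filter.atTop (𝓝 0) := by
  have hmeas : ∀ n, MeasurableSet {w : PathSpace 1 | hit (lowSet 1) w.pos ≤ dyad n} := fun n =>
    measurable_hit_pos (isOpen_lowSet 1) measurableSet_Iic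
  have hanti : Antitone fun n => {w : PathSpace 1 | hit (lowSet 1) w.pos ≤ dyad n} := by
    intro m n hmn w hw
    refine le_trans (show hit (lowSet 1) w.pos ≤ (dyad n : ℝ≥0∞) from hw) ?_
    rw [ENNReal.coe_le_coe]
    exact pow_le_pow_of_le_one zero_le (by rw [← NNReal.coe_le_coe]; norm_num) hmn
  have h := tendsto_measure_iInter_atTop (μ := μ) (fun n => (hmeas n).nullMeasurableSet) hanti
    ⟨0, measure_ne_top _ _⟩
  convert! h
  symm
  convert! measure_empty (μ := μ)
  -- A path passing below `-1` before every dyadic time would be at `-1` at time `0`, although it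
  -- starts in `0`.
  refine Set.eq_empty_of_forall_notMem fun w hw => ?_
  have h0 : hit (lowSet 1) w.pos ≤ ((0 : ℝ≥0) : ℝ≥0∞) := by
    have hd : Filter.Tendsto (fun n => (dyad n : ℝ≥0∞)) Filter.atTop (𝓝 ((0 : ℝ≥0) : ℝ≥0∞)) :=
      ENNReal.tendsto_coe.2 tendsto_dyad
    exact ge_of_tendsto' hd fun n => Set.mem_iInter.1 hw n
  have hne : hit (lowSet 1) w.pos ≠ ∞ := (h0.trans_lt ENNReal.coe_lt_top).ne
  have h1 := pos_hit_lowSet zero_le_one hne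
  have h2 : (hit (lowSet 1) w.pos).toNNReal = 0 := by
    simpa using ENNReal.toNNReal_mono ENNReal.coe_ne_top h0
  rw [h2, w.pos_zero] at h1
  norm_num at h1

/-- The exponential moments of a spectrally-positive Lévy process are dominated for small times. -/
lemma exists_dominating [IsProbabilityMeasure P] (hL : IsSpectrallyPositiveLevy P L) {α : ℝ}
    (hα : 0 ≤ α) : ∃ t₀ > (0 : ℝ≥0), ∃ B : Ω → ℝ, Integrable B P ∧
      ∀ᵐ ω ∂P, ∀ s ≤ t₀, Real.exp (-α * L s ω) ≤ B ω := by
  set μ : Fin 1 → Measure (PathSpace 1) := fun _ => P.map (levyPath hL) with hμdef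
  have hμ : IsMAP μ := isMAP_levy hL
  have := hμ.prob
  set c : ℝ≥0∞ := ENNReal.ofReal (Real.exp α) with hc
  have hc0 : c ≠ 0 := by simpa [hc] using Real.exp_pos α
  have hct : c ≠ ∞ := ENNReal.ofReal_ne_top
  -- The time `t₀` is so small that `e^α` times the probability of passing below `-1` by `t₀` is at
  -- most `1/2`. The powers of this product then form a convergent geometric series.
  obtain ⟨n₀, hn₀⟩ := ((tendsto_hit_lowSet_measure (μ := μ 0)).eventually_lt_const
    (show (0 : ℝ≥0∞) < 2⁻¹ * c⁻¹ by simp [hct])).exists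
  set t₀ := dyad n₀
  set p := μ 0 {w | hit (lowSet 1) w.pos ≤ t₀}
  have hcp : c * p ≤ 2⁻¹ := by
    calc c * p ≤ c * (2⁻¹ * c⁻¹) := by gcongr
      _ = 2⁻¹ * (c * c⁻¹) := by ring
      _ = 2⁻¹ := by rw [ENNReal.mul_inv_cancel hc0 hct, mul_one]
  set S : ℕ → Set (PathSpace 1) := fun n => {w | hit (lowSet n) w.pos ≤ t₀} with hSdef
  have hSm : ∀ n, MeasurableSet (S n) := fun n =>
    measurable_hit_pos (isOpen_lowSet n) measurableSet_Iic
  -- The term `1` covers nonnegative levels. If `-L s` lies in `(n, n + 1]` for some `s ≤ t₀`, then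
  -- `-n` has been passed by `t₀` and `exp(-α L s) ≤ c ^ (n + 1)`, the `n`-th summand.
  set G : PathSpace 1 → ℝ≥0∞ := fun w => 1 + ∑' n : ℕ, (S n).indicator (fun _ => c ^ (n + 1)) w
    with hG
  have hGm : Measurable G :=
    (Measurable.tsum fun n => measurable_const.indicator (hSm n)).const_add _
  have hGint : ∫⁻ w, G w ∂μ 0 ≠ ∞ := by
    rw [hG, lintegral_add_left measurable_const, lintegral_tsum fun n =>
      (measurable_const.indicator (hSm n)).aemeasurable]
    have hterm : ∀ n, ∫⁻ w, (S n).indicator (fun _ => c ^ (n + 1)) w ∂μ 0 ≤ c * 2⁻¹ ^ n := by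
      intro n
      rw [lintegral_indicator (hSm n), setLIntegral_const]
      calc c ^ (n + 1) * μ 0 (S n) ≤ c ^ (n + 1) * p ^ n := by
            gcongr; exact hit_lowSet_measure_pow hμ t₀ n
        _ = c * (c * p) ^ n := by rw [mul_pow]; ring
        _ ≤ c * 2⁻¹ ^ n := by gcongr
    refine ((add_le_add_right (ENNReal.tsum_le_tsum hterm) _).trans_lt ?_).ne
    rw [ENNReal.tsum_mul_left, ENNReal.tsum_geometric]
    rw [lintegral_const, one_mul]
    refine ENNReal.add_lt_top.2 ⟨measure_lt_top _ _, ENNReal.mul_lt_top hct.lt_top ?_⟩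
    rw [ENNReal.one_sub_inv_two, inv_inv]
    exact ENNReal.ofNat_lt_top
  have hGP : ∫⁻ ω, G (levyPath hL ω) ∂P ≠ ∞ := by
    rwa [← lintegral_map hGm (measurable_levyPath hL)]
  have hGP' : Measurable fun ω => G (levyPath hL ω) := hGm.comp (measurable_levyPath hL)
  refine ⟨t₀, dyad_pos n₀, fun ω => (G (levyPath hL ω)).toReal,
    integrable_toReal_of_lintegral_ne_top hGP'.aemeasurable hGP, ?_⟩
  filter_upwards [ae_lt_top hGP' hGP] with ω hω s hs
  have key : ENNReal.ofReal (Real.exp (-α * L s ω)) ≤ G (levyPath hL ω) := by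
    rcases le_or_gt 0 (L s ω) with h0 | h0
    · refine le_trans ?_ (le_add_right le_rfl)
      rw [ENNReal.ofReal_le_one, Real.exp_le_one_iff]
      nlinarith [mul_nonneg hα h0]
    · refine le_trans ?_ (le_add_left le_rfl)
      set n : ℕ := ⌈-L s ω⌉₊ - 1 with hn
      have hpos : 0 < ⌈-L s ω⌉₊ := Nat.ceil_pos.2 (by linarith)
      have h1 : (n : ℝ) < -L s ω := Nat.lt_ceil.1 (by omega)
      have h2 : -L s ω ≤ n + 1 := by
        have := Nat.le_ceil (-L s ω)
        rw [show ⌈-L s ω⌉₊ = n + 1 by omega] at this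
        exact_mod_cast this
      refine le_trans ?_ (ENNReal.le_tsum n)
      have hmem : levyPath hL ω ∈ S n :=
        (hit_le (show (levyPath hL ω).pos s ∈ lowSet n from h1)).trans (by exact_mod_cast hs)
      rw [Set.indicator_of_mem hmem, hc, ← ENNReal.ofReal_pow (Real.exp_pos _).le,
        ← Real.exp_nat_mul]
      refine ENNReal.ofReal_le_ofReal (Real.exp_le_exp.2 ?_)
      push_cast
      nlinarith [mul_le_mul_of_nonneg_left h2 hα]
  have := ENNReal.toReal_mono hω.ne key
  rwa [ENNReal.toReal_ofReal (Real.exp_pos _).le] at this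

/-- The transform `E exp(ζ L(t))` of a Lévy process. -/
def levyTransform (P : Measure Ω) (L : ℝ≥0 → Ω → ℝ) (ζ : ℂ) (t : ℝ≥0) : ℂ :=
  ∫ ω, Complex.exp (ζ * L t ω) ∂P

lemma norm_exp_mul_real (ζ : ℂ) (y : ℝ) : ‖Complex.exp (ζ * y)‖ = Real.exp (ζ.re * y) := by
  rw [Complex.norm_exp]; simp

lemma measurable_cexp_mul {Ω' : Type*} {m : MeasurableSpace Ω'} {X : Ω' → ℝ} (hX : Measurable X) (ζ : ℂ) :
    Measurable fun ω => Complex.exp (ζ * X ω) :=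
  Complex.measurable_exp.comp ((Complex.measurable_ofReal.comp hX).const_mul ζ)

lemma IsSpectrallyPositiveLevy.integrable_exp_sub [IsProbabilityMeasure P]
    (hL : IsSpectrallyPositiveLevy P L) {ζ : ℂ} {s t : ℝ≥0}
    (h : Integrable (fun ω => Complex.exp (ζ * L t ω)) P) :
    Integrable (fun ω => Complex.exp (ζ * ((L (s + t) ω - L s ω : ℝ) : ℂ))) P :=
  ((hL.stationary_increments s t).comp
    (u := fun x : ℝ => Complex.exp (ζ * x)) (measurable_cexp_mul measurable_id ζ)).integrable_iff.2 h

/-- For small times the dominating variable suffices. A general time is divided into `n` short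
steps, whose increments are independent with integrable exponentials. -/
lemma IsSpectrallyPositiveLevy.integrable_exp [IsProbabilityMeasure P]
    (hL : IsSpectrallyPositiveLevy P L) {ζ : ℂ} (hζ : ζ.re ≤ 0) (t : ℝ≥0) :
    Integrable (fun ω => Complex.exp (ζ * L t ω)) P := by
  obtain ⟨t₀, ht₀, B, hB, hdom⟩ := exists_dominating hL (neg_nonneg.2 hζ)
  have hsmall : ∀ s ≤ t₀, Integrable (fun ω => Complex.exp (ζ * L s ω)) P := fun s hs => by
    refine hB.mono' (measurable_cexp_mul (hL.measurable s) ζ).aestronglyMeasurable ?_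
    filter_upwards [hdom] with ω hω
    rw [norm_exp_mul_real]
    simpa using hω s hs
  have hmul : ∀ s ≤ t₀, ∀ n : ℕ, Integrable (fun ω => Complex.exp (ζ * L (n * s) ω)) P := by
    intro s hs n
    induction n with
    | zero => simp [hL.zero]
    | succ n ih =>
      have hi := hL.integrable_exp_sub (s := n * s) (hsmall s hs)
      have hind : IndepFun (L (n * s)) (L (n * s + s) - L (n * s)) P :=
        hL.indep_increments.indepFun_eval_sub (r := 0) (zero_le) (by simp)
          (Filter.Eventually.of_forall fun ω => hL.zero ω)
      have hind' := hind.comp (φ := fun x : ℝ => Complex.exp (ζ * x))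
        (ψ := fun x : ℝ => Complex.exp (ζ * x)) (measurable_cexp_mul measurable_id ζ)
        (measurable_cexp_mul measurable_id ζ)
      refine (hind'.integrable_mul ih hi).congr (Filter.Eventually.of_forall fun ω => ?_)
      simp only [Pi.mul_apply, Function.comp_apply, Pi.sub_apply]
      rw [← Complex.exp_add, ← mul_add, Nat.cast_add, Nat.cast_one, add_mul, one_mul]
      push_cast
      congr 2
      ring
  obtain ⟨n, hn⟩ := exists_nat_gt (t / t₀)
  have hn0 : (n : ℝ≥0) ≠ 0 := fun h => by rw [h] at hn; exact absurd hn (not_lt.2 zero_le)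
  have := hmul (t / n) (by
    rw [div_lt_iff₀ ht₀] at hn
    exact div_le_of_le_mul₀ zero_le zero_le (by rw [mul_comm]; exact hn.le)) n
  rwa [mul_div_cancel₀ _ hn0] at this

lemma levyTransform_zero [IsProbabilityMeasure P] (hL : IsSpectrallyPositiveLevy P L) (ζ : ℂ) :
    levyTransform P L ζ 0 = 1 := by simp [levyTransform, hL.zero]

lemma integral_exp_sub (hL : IsSpectrallyPositiveLevy P L) (ζ : ℂ) (s t : ℝ≥0) :
    ∫ ω, Complex.exp (ζ * ((L (s + t) ω - L s ω : ℝ) : ℂ)) ∂P = levyTransform P L ζ t :=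
  ((hL.stationary_increments s t).comp
    (u := fun x : ℝ => Complex.exp (ζ * x)) (measurable_cexp_mul measurable_id ζ)).integral_eq

lemma integral_prod_exp_sub (hL : IsSpectrallyPositiveLevy P L) (n : ℕ) (ζ : ℕ → ℂ) {t : ℕ → ℝ≥0}
    (ht : Monotone t) :
    ∫ ω, ∏ j : Fin n, Complex.exp (ζ j * ((L (t (j + 1)) ω - L (t j) ω : ℝ) : ℂ)) ∂P =
      ∏ j : Fin n, levyTransform P L (ζ j) (t (j + 1) - t j) := by
  have hind : iIndepFun (fun (j : Fin n) ω => L (t (j + 1)) ω - L (t j) ω) P :=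
    (hL.indep_increments.nat ht).precomp Fin.val_injective
  have hm : ∀ j : Fin n, Measurable fun ω => L (t (j + 1)) ω - L (t j) ω := fun j =>
    (hL.measurable _).sub (hL.measurable _)
  have := hind.integral_fun_prod_comp (fun j => (hm j).aemeasurable)
    (f := fun (j : Fin n) (x : ℝ) => Complex.exp (ζ j * x))
    (fun j => (measurable_cexp_mul measurable_id (ζ j)).aestronglyMeasurable)
  refine this.trans (Finset.prod_congr rfl fun j _ => ?_)
  rw [← integral_exp_sub hL (ζ j) (t j) (t (j + 1) - t j),
    add_tsub_cancel_of_le (ht (Nat.le_succ _))]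

lemma levyTransform_add (hL : IsSpectrallyPositiveLevy P L) (ζ : ℂ) (s t : ℝ≥0) :
    levyTransform P L ζ (s + t) = levyTransform P L ζ s * levyTransform P L ζ t := by
  have hind : IndepFun (L s) (L (s + t) - L s) P :=
    hL.indep_increments.indepFun_eval_sub (r := 0) (zero_le) (by simp)
      (Filter.Eventually.of_forall fun ω => hL.zero ω)
  have hind' := hind.comp (φ := fun x : ℝ => Complex.exp (ζ * x))
    (ψ := fun x : ℝ => Complex.exp (ζ * x)) (measurable_cexp_mul measurable_id ζ)
    (measurable_cexp_mul measurable_id ζ)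
  have h := hind'.integral_fun_mul_eq_mul_integral
    (measurable_cexp_mul (hL.measurable s) ζ).aestronglyMeasurable
    (measurable_cexp_mul ((hL.measurable _).sub (hL.measurable _)) ζ).aestronglyMeasurable
  have h2 := integral_exp_sub hL ζ s t
  simp only [Function.comp_apply, Pi.sub_apply] at h
  rw [h2] at h
  rw [levyTransform, levyTransform, ← h]
  refine integral_congr_ae (Filter.Eventually.of_forall fun ω => ?_)
  beta_reduce
  rw [← Complex.exp_add, ← mul_add]
  congr 2
  push_cast
  ring

lemma tendsto_levyTransform_zero [IsProbabilityMeasure P] (hL : IsSpectrallyPositiveLevy P L)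
    {ζ : ℂ} (hζ : ζ.re ≤ 0) : Filter.Tendsto (levyTransform P L ζ) (𝓝 0) (𝓝 1) := by
  obtain ⟨t₀, ht₀, B, hB, hdom⟩ := exists_dominating hL (neg_nonneg.2 hζ)
  rw [← levyTransform_zero hL ζ]
  refine tendsto_integral_filter_of_dominated_convergence B
    (Filter.Eventually.of_forall fun t =>
      (measurable_cexp_mul (hL.measurable t) ζ).aestronglyMeasurable) ?_ hB
    (Filter.Eventually.of_forall fun ω => ?_)
  · filter_upwards [Iio_mem_nhds ht₀] with t ht
    filter_upwards [hdom] with ω hω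
    rw [norm_exp_mul_real]
    simpa using hω t (le_of_lt ht)
  · have h1 := (hL.cadlag ω 0).1.tendsto
    rw [show Set.Ici (0 : ℝ≥0) = Set.univ by ext; simp, nhdsWithin_univ] at h1
    exact (Complex.continuous_exp.tendsto _).comp
      (((Complex.continuous_ofReal.tendsto _).comp h1).const_mul ζ)

/-- Multiplicativity in time carries continuity at `0` to every time. -/
lemma continuous_levyTransform [IsProbabilityMeasure P] (hL : IsSpectrallyPositiveLevy P L)
    {ζ : ℂ} (hζ : ζ.re ≤ 0) : Continuous (levyTransform P L ζ) := by
  rw [continuous_iff_continuousAt]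
  intro t
  have h0 := tendsto_levyTransform_zero hL hζ
  have hsub : Filter.Tendsto (fun s : ℝ≥0 => s - t) (𝓝 t) (𝓝 0) := by
    have : Continuous fun s : ℝ≥0 => s - t := by fun_prop
    simpa using this.tendsto t
  have hsub' : Filter.Tendsto (fun s : ℝ≥0 => t - s) (𝓝 t) (𝓝 0) := by
    have : Continuous fun s : ℝ≥0 => t - s := by fun_prop
    simpa using this.tendsto t
  have h1 : Filter.Tendsto (fun s => levyTransform P L ζ (s - t)) (𝓝 t) (𝓝 1) := h0.comp hsub
  have h2 : Filter.Tendsto (fun s => levyTransform P L ζ (t - s)) (𝓝 t) (𝓝 1) := h0.comp hsub'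
  -- Since `s + (t - s) = t + (s - t)` for truncated subtraction, one quotient covers times on both
  -- sides of `t`. The denominator is near `1`.
  have h3 : Filter.Tendsto (fun s => levyTransform P L ζ t * levyTransform P L ζ (s - t) /
      levyTransform P L ζ (t - s)) (𝓝 t) (𝓝 (levyTransform P L ζ t)) := by
    have := (h1.const_mul (levyTransform P L ζ t)).div h2 one_ne_zero
    rwa [mul_one, div_one] at this
  refine h3.congr' ?_
  filter_upwards [h2.eventually_ne one_ne_zero] with s hs
  rw [div_eq_iff hs]
  rw [← levyTransform_add hL, ← levyTransform_add hL]
  congr 1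
  rcases le_total s t with h | h
  · rw [tsub_eq_zero_of_le h, add_zero, add_tsub_cancel_of_le h]
  · rw [tsub_eq_zero_of_le h, add_zero, add_tsub_cancel_of_le h]

/-- Cauchy's functional equation: multiplicativity settles dyadic times, continuity the others. -/
lemma eq_exp_of_mul_of_continuous {m : ℝ≥0 → ℝ} (hm : Continuous m) (hpos : ∀ t, 0 < m t)
    (hadd : ∀ s t, m (s + t) = m s * m t) (t : ℝ≥0) :
    m t = Real.exp (t * Real.log (m 1)) := by
  have hpow : ∀ (n : ℕ) (s : ℝ≥0), m (n * s) = m s ^ n := by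
    intro n s
    induction n with
    | zero =>
      have := hadd 0 0
      rw [add_zero] at this
      have h1 : m 0 = 1 := mul_left_cancel₀ (hpos 0).ne' (by rw [mul_one]; exact this.symm)
      simpa using h1
    | succ n ih => rw [Nat.cast_add, Nat.cast_one, add_mul, one_mul, hadd, ih, pow_succ]
  have hlog : ∀ (n : ℕ) (s : ℝ≥0), Real.log (m (n * s)) = n * Real.log (m s) := fun n s => by
    rw [hpow, Real.log_pow]
  have hd : ∀ n k : ℕ, Real.log (m (k * dyad n)) =
      ((k * dyad n : ℝ≥0) : ℝ) * Real.log (m 1) := by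
    intro n k
    have h1 := hlog (2 ^ n) (dyad n)
    have h2 : ((2 ^ n : ℕ) : ℝ≥0) * dyad n = 1 := by
      unfold dyad; push_cast; rw [← mul_pow]; norm_num
    rw [h2] at h1
    rw [hlog, h1, ← mul_assoc]
    congr 1
    have h3 : ((dyad n : ℝ≥0) : ℝ) * ((2 ^ n : ℕ) : ℝ) = 1 := by
      rw [mul_comm]; exact_mod_cast congrArg NNReal.toReal h2
    rw [NNReal.coe_mul, mul_assoc, h3]
    simp
  have hlim1 : Filter.Tendsto (fun n => Real.log (m (dyadIdx n t * dyad n))) Filter.atTop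
      (𝓝 (Real.log (m t))) :=
    ((hm.tendsto t).log (hpos t).ne').comp ((tendsto_dyadIdx t).mono_right nhdsWithin_le_nhds)
  have hlim2 : Filter.Tendsto (fun n => ((dyadIdx n t * dyad n : ℝ≥0) : ℝ) * Real.log (m 1))
      Filter.atTop (𝓝 (t * Real.log (m 1))) :=
    (NNReal.tendsto_coe.2 ((tendsto_dyadIdx t).mono_right nhdsWithin_le_nhds)).mul_const _
  simp_rw [hd] at hlim1
  rw [← tendsto_nhds_unique hlim1 hlim2, Real.exp_log (hpos t)]

lemma levyTransform_neg_real (P : Measure Ω) (L : ℝ≥0 → Ω → ℝ) (α : ℝ) (t : ℝ≥0) :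
    levyTransform P L (-α : ℝ) t = ((∫ ω, Real.exp (-α * L t ω) ∂P : ℝ) : ℂ) := by
  rw [levyTransform, ← integral_complex_ofReal]
  congr 1
  funext ω
  push_cast
  rfl

lemma IsSpectrallyPositiveLevy.integrable_exp_neg [IsProbabilityMeasure P]
    (hL : IsSpectrallyPositiveLevy P L) {α : ℝ} (hα : 0 ≤ α) (t : ℝ≥0) :
    Integrable (fun ω => Real.exp (-α * L t ω)) P := by
  have := (hL.integrable_exp (ζ := (-α : ℝ)) (by simpa using hα) t).norm
  refine this.congr (Filter.Eventually.of_forall fun ω => ?_)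
  beta_reduce
  rw [norm_exp_mul_real, Complex.ofReal_re]

lemma integral_exp_neg_levy [IsProbabilityMeasure P] (hL : IsSpectrallyPositiveLevy P L) {α : ℝ}
    (hα : 0 ≤ α) (t : ℝ≥0) : ∫ ω, Real.exp (-α * L t ω) ∂P =
      Real.exp (t * Real.log (∫ ω, Real.exp (-α * L 1 ω) ∂P)) := by
  refine eq_exp_of_mul_of_continuous (m := fun t => ∫ ω, Real.exp (-α * L t ω) ∂P) ?_ ?_ ?_ t
  · have h := continuous_levyTransform hL (ζ := (-α : ℝ)) (by simpa using hα)
    have h2 := Complex.continuous_re.comp h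
    refine h2.congr fun t => ?_
    rw [Function.comp_apply, levyTransform_neg_real, Complex.ofReal_re]
  · intro t
    exact integral_exp_pos (hL.integrable_exp_neg hα t)
  · intro s t
    have := levyTransform_add hL (-α : ℝ) s t
    simp only [levyTransform_neg_real] at this
    exact_mod_cast this

end Levy

/-! ### Multiplicative functionals of a Markov chain on a grid. -/

open PathSpace

namespace IsMarkovChainFrom

lemma exists_eq_grid {d : ℕ} {Ω : Type*} {X : ℝ≥0 → Ω → Fin d} {h : ℝ≥0} {q : ℕ} {C : Ω → ℂ}
    (hC : ∀ ω ω', (∀ m ≤ q, X (m * h) ω = X (m * h) ω') → C ω = C ω') :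
    ∃ c : (Fin (q + 1) → Fin d) → ℂ, ∀ ω, C ω = c fun m => X (m * h) ω := by
  have hfac : Function.FactorsThrough C fun ω (m : Fin (q + 1)) => X (m * h) ω :=
    fun ω ω' hv => hC ω ω' fun m hm => congrFun hv ⟨m, Nat.lt_succ_of_le hm⟩
  exact ⟨Function.extend _ C 0, fun ω => (hfac.extend_apply 0 ω).symm⟩

variable {d : ℕ} {Ω : Type*} [MeasurableSpace Ω] {P : Measure Ω}
  {Q : Matrix (Fin d) (Fin d) ℝ} {i : Fin d} {X : ℝ≥0 → Ω → Fin d}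

lemma fdd_grid (hX : IsMarkovChainFrom P Q i X) (h : ℝ≥0) (n : ℕ) (s : ℕ → Fin d) (hs : s 0 = i) :
    P.real {ω | ∀ m ≤ n, X (m * h) ω = s m} =
      ∏ m ∈ Finset.range n, (NormedSpace.exp ((h : ℝ) • Q)) (s m) (s (m + 1)) := by
  have hmono : Monotone fun m : ℕ => (m : ℝ≥0) * h := fun a b hab => by
    beta_reduce; gcongr
  rw [hX.fdd n (fun m => m * h) s hmono (by simp) hs]
  refine Finset.prod_congr rfl fun m _ => ?_
  rw [show ((m + 1 : ℕ) : ℝ≥0) * h - m * h = h by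
    rw [Nat.cast_add, Nat.cast_one, add_mul, one_mul, add_tsub_cancel_left]]

/-- One more step contributes one more factor to the finite-dimensional product. Histories with the
wrong initial state give zero on both sides. -/
lemma measureReal_grid_succ (hX : IsMarkovChainFrom P Q i X) (h : ℝ≥0) (q : ℕ) (s : ℕ → Fin d)
    (l : Fin d) :
    P.real {ω | (∀ m ≤ q, X (m * h) ω = s m) ∧ X ((q + 1 : ℕ) * h) ω = l} =
      P.real {ω | ∀ m ≤ q, X (m * h) ω = s m} * (NormedSpace.exp ((h : ℝ) • Q)) (s q) l := by
  by_cases hs : s 0 = i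
  · have h1 := hX.fdd_grid h (q + 1) (fun m => if m ≤ q then s m else l) (by simpa using hs)
    have h2 : {ω | (∀ m ≤ q, X (m * h) ω = s m) ∧ X ((q + 1 : ℕ) * h) ω = l} =
        {ω | ∀ m ≤ q + 1, X (m * h) ω = if m ≤ q then s m else l} := by
      ext ω
      constructor
      · rintro ⟨h3, h4⟩ m hm
        rcases Nat.le_succ_iff.1 hm with hm | rfl
        · rw [if_pos hm, h3 m hm]
        · rw [if_neg (by simp), ← h4]
      · intro h3
        refine ⟨fun m hm => ?_, ?_⟩
        · rw [h3 m (hm.trans (Nat.le_succ _)), if_pos hm]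
        · rw [h3 (q + 1) le_rfl, if_neg (by simp)]
    rw [h2, h1, Finset.prod_range_succ, hX.fdd_grid h q s hs]
    congr 1
    · refine Finset.prod_congr rfl fun m hm => ?_
      have := Finset.mem_range.1 hm
      rw [if_pos this.le, if_pos (Nat.succ_le_of_lt this)]
    · simp
  · have h0 : {ω | ∀ m ≤ q, X (m * h) ω = s m} = ∅ := by
      refine Set.eq_empty_of_forall_notMem fun ω hω => hs ?_
      have := hω 0 (Nat.zero_le _)
      rw [← this, Nat.cast_zero, zero_mul, hX.init]
    have h1 : {ω | (∀ m ≤ q, X (m * h) ω = s m) ∧ X ((q + 1 : ℕ) * h) ω = l} = ∅ :=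
      Set.eq_empty_of_forall_notMem fun ω hω => (h0 ▸ Set.notMem_empty ω) hω.1
    rw [h0, h1]
    simp

lemma integrable_grid [IsProbabilityMeasure P] (hX : IsMarkovChainFrom P Q i X) {h : ℝ≥0} {q : ℕ} {C : Ω → ℂ}
    (hC : ∀ ω ω', (∀ m ≤ q, X (m * h) ω = X (m * h) ω') → C ω = C ω') : Integrable C P := by
  obtain ⟨c, hc⟩ := exists_eq_grid hC
  have hV : Measurable fun ω (m : Fin (q + 1)) => X (m * h) ω :=
    measurable_pi_lambda _ fun m => hX.measurable _
  have := Measure.isFiniteMeasure_map P fun ω (m : Fin (q + 1)) => X (m * h) ω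
  exact ((Integrable.of_finite (f := c)).comp_measurable hV).congr
    (Filter.Eventually.of_forall fun ω => (hc ω).symm)

/-- The one-step Markov property for functionals of the past on a grid. -/
lemma integral_step [IsProbabilityMeasure P] (hX : IsMarkovChainFrom P Q i X) (h : ℝ≥0) (q : ℕ) {C : Ω → ℂ}
    (hC : ∀ ω ω', (∀ m ≤ q, X (m * h) ω = X (m * h) ω') → C ω = C ω') (k l : Fin d) :
    ∫ ω, C ω * (if X (q * h) ω = k then 1 else 0) * (if X ((q + 1 : ℕ) * h) ω = l then 1 else 0) ∂P =
      (∫ ω, C ω * (if X (q * h) ω = k then 1 else 0) ∂P) *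
        ((NormedSpace.exp ((h : ℝ) • Q)) k l : ℝ) := by
  classical
  set V : Ω → Fin (q + 1) → Fin d := fun ω m => X (m * h) ω with hV
  have hVm : Measurable V := measurable_pi_lambda _ fun m => hX.measurable _
  set W : Ω → Fin d := X ((q + 1 : ℕ) * h) with hW
  have hWm : Measurable W := hX.measurable _
  obtain ⟨c, hc⟩ : ∃ c : (Fin (q + 1) → Fin d) → ℂ, ∀ ω, C ω = c (V ω) := exists_eq_grid hC
  have hq : ∀ ω, X (q * h) ω = V ω (Fin.last q) := fun ω => by simp [hV]
  have key : ∀ (v : Fin (q + 1) → Fin d) (l : Fin d), P.real ((fun ω => (V ω, W ω)) ⁻¹' {(v, l)}) =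
      P.real (V ⁻¹' {v}) * (NormedSpace.exp ((h : ℝ) • Q)) (v (Fin.last q)) l := by
    intro v l
    have := hX.measureReal_grid_succ h q (fun m => if hm : m < q + 1 then v ⟨m, hm⟩ else l) l
    have e1 : V ⁻¹' {v} = {ω | ∀ m ≤ q, X (m * h) ω = if hm : m < q + 1 then v ⟨m, hm⟩ else l} := by
      ext ω
      simp only [Set.mem_preimage, Set.mem_singleton_iff, funext_iff, Set.mem_ofPred_eq]
      constructor
      · intro h1 m hm
        rw [dif_pos (Nat.lt_succ_of_le hm)]
        exact h1 ⟨m, Nat.lt_succ_of_le hm⟩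
      · intro h1 m
        have := h1 m (Nat.le_of_lt_succ m.2)
        rwa [dif_pos m.2] at this
    have e2 : (fun ω => (V ω, W ω)) ⁻¹' {(v, l)} = {ω | (∀ m ≤ q, X (m * h) ω =
        if hm : m < q + 1 then v ⟨m, hm⟩ else l) ∧ X ((q + 1 : ℕ) * h) ω = l} := by
      have : (fun ω => (V ω, W ω)) ⁻¹' {(v, l)} = V ⁻¹' {v} ∩ {ω | W ω = l} := by
        ext ω; simp [Prod.ext_iff]
      rw [this, e1]
      rfl
    rw [e2, this, e1]
    simp only [Nat.lt_succ_self, dif_pos]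
    rfl
  have i1 : ∫ ω, C ω * (if X (q * h) ω = k then 1 else 0) ∂P =
      ∑ v, (P.real (V ⁻¹' {v}) : ℂ) * (c v * (if v (Fin.last q) = k then 1 else 0)) := by
    simp_rw [hc, hq]
    rw [← integral_map (μ := P) hVm.aemeasurable
      (f := fun v => c v * (if v (Fin.last q) = k then 1 else 0))
      (measurable_of_finite _).aestronglyMeasurable,
      integral_fintype Integrable.of_finite]
    refine Finset.sum_congr rfl fun v _ => ?_
    rw [map_measureReal_apply hVm (measurableSet_singleton _), Complex.real_smul]
  have i2 : ∫ ω, C ω * (if X (q * h) ω = k then 1 else 0) *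
      (if X ((q + 1 : ℕ) * h) ω = l then 1 else 0) ∂P =
      ∑ p : (Fin (q + 1) → Fin d) × Fin d, (P.real ((fun ω => (V ω, W ω)) ⁻¹' {p}) : ℂ) *
        (c p.1 * (if p.1 (Fin.last q) = k then 1 else 0) * (if p.2 = l then 1 else 0)) := by
    simp_rw [hc, hq]
    have hm := hVm.prodMk hWm
    rw [← integral_map (μ := P) hm.aemeasurable (f := fun p : (Fin (q + 1) → Fin d) × Fin d =>
        c p.1 * (if p.1 (Fin.last q) = k then 1 else 0) * (if p.2 = l then 1 else 0))
      (measurable_of_finite _).aestronglyMeasurable,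
      integral_fintype Integrable.of_finite]
    refine Finset.sum_congr rfl fun v _ => ?_
    rw [map_measureReal_apply hm (measurableSet_singleton _), Complex.real_smul]
  rw [i1, i2, Fintype.sum_prod_type, Finset.sum_mul]
  refine Finset.sum_congr rfl fun v _ => ?_
  rw [Finset.sum_eq_single l (fun b _ hb => by simp [hb]) (by simp), key]
  by_cases hv : v (Fin.last q) = k
  · subst hv
    push_cast
    simp
    ring
  · simp [hv]

/-- The transition matrix over a time step, weighted by `g`. -/
def weightedStep (Q : Matrix (Fin d) (Fin d) ℝ) (h : ℝ≥0) (g : Fin d → Fin d → ℂ) :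
    Matrix (Fin d) (Fin d) ℂ :=
  Matrix.of fun k l => ((NormedSpace.exp ((h : ℝ) • Q)) k l : ℝ) * g k l

/-- A discrete Feynman–Kac formula. Summing over the state before the last step shows that each step
multiplies by the weighted transition matrix. -/
lemma integral_block [IsProbabilityMeasure P] (hX : IsMarkovChainFrom P Q i X) (h : ℝ≥0) (q : ℕ) {C : Ω → ℂ}
    (hC : ∀ ω ω', (∀ m ≤ q, X (m * h) ω = X (m * h) ω') → C ω = C ω')
    (g : Fin d → Fin d → ℂ) (k l : Fin d) (N : ℕ) :
    ∫ ω, C ω * (if X (q * h) ω = k then 1 else 0) *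
        (∏ r ∈ Finset.range N, g (X ((q + r : ℕ) * h) ω) (X ((q + r + 1 : ℕ) * h) ω)) *
        (if X ((q + N : ℕ) * h) ω = l then 1 else 0) ∂P =
      (∫ ω, C ω * (if X (q * h) ω = k then 1 else 0) ∂P) * (weightedStep Q h g ^ N) k l := by
  classical
  induction N generalizing l with
  | zero =>
    simp only [Finset.range_zero, Finset.prod_empty, mul_one, add_zero, pow_zero, Matrix.one_apply]
    by_cases hkl : k = l
    · subst hkl
      rw [if_pos rfl, mul_one]
      refine integral_congr_ae (Filter.Eventually.of_forall fun ω => ?_)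
      beta_reduce
      split_ifs <;> simp
    · rw [if_neg hkl, mul_zero]
      refine (integral_congr_ae (Filter.Eventually.of_forall fun ω => ?_)).trans (integral_zero _ _)
      split_ifs with h1 h2 <;> simp
      exact absurd (h1.symm.trans h2) hkl
  | succ N ih =>
    set D : Ω → ℂ := fun ω => C ω * (if X (q * h) ω = k then 1 else 0) *
      ∏ r ∈ Finset.range N, g (X ((q + r : ℕ) * h) ω) (X ((q + r + 1 : ℕ) * h) ω) with hD
    have hDC : ∀ ω ω', (∀ m ≤ q + N, X (m * h) ω = X (m * h) ω') → D ω = D ω' := by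
      intro ω ω' hω
      simp only [hD]
      rw [hC ω ω' fun m hm => hω m (hm.trans (Nat.le_add_right _ _)), hω q (Nat.le_add_right _ _)]
      congr 1
      refine Finset.prod_congr rfl fun r hr => ?_
      have := Finset.mem_range.1 hr
      rw [hω (q + r) (by omega), hω (q + r + 1) (by omega)]
    have hstep : ∀ ω, C ω * (if X (q * h) ω = k then 1 else 0) *
        (∏ r ∈ Finset.range (N + 1), g (X ((q + r : ℕ) * h) ω) (X ((q + r + 1 : ℕ) * h) ω)) *
        (if X ((q + (N + 1) : ℕ) * h) ω = l then 1 else 0) =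
        ∑ m, D ω * (if X ((q + N : ℕ) * h) ω = m then 1 else 0) *
          (if X ((q + N + 1 : ℕ) * h) ω = l then 1 else 0) * g m l := by
      intro ω
      rw [Finset.sum_eq_single (X ((q + N : ℕ) * h) ω) (fun b _ hb => by rw [if_neg hb.symm]; ring)
        (by simp), Finset.prod_range_succ, if_pos rfl, mul_one, ← add_assoc]
      simp only [hD]
      split_ifs with h1 h2 h2
      · rw [h2]; ring
      · simp
      · simp
      · simp
    simp_rw [hstep]
    rw [integral_finsetSum]
    · simp_rw [integral_mul_const, hX.integral_step h (q + N) hDC]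
      rw [pow_succ, Matrix.mul_apply, Finset.mul_sum]
      refine Finset.sum_congr rfl fun m _ => ?_
      have := ih m
      change ∫ ω, D ω * (if X ((q + N : ℕ) * h) ω = m then 1 else 0) ∂P = _ at this
      rw [this]
      rw [show weightedStep Q h g m l = ((NormedSpace.exp ((h : ℝ) • Q)) m l : ℝ) * g m l from rfl]
      ring
    · intro m _
      refine (hX.integrable_grid (h := h) (q := q + N + 1) fun ω ω' hω => ?_).mul_const _
      rw [hDC ω ω' fun m hm => hω m (hm.trans (Nat.le_succ _)), hω (q + N) (Nat.le_succ _),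
        hω (q + N + 1) le_rfl]

/-- The states prescribed at the block ends decouple the blocks: earlier blocks form a functional of
the past, to which the formula for a single block applies. -/
lemma integral_blocks [IsProbabilityMeasure P] (hX : IsMarkovChainFrom P Q i X) (h : ℝ≥0) (N : ℕ)
    (g : ℕ → Fin d → Fin d → ℂ) (s : ℕ → Fin d) (hs : s 0 = i) (n : ℕ) :
    ∫ ω, ∏ j ∈ Finset.range n, ((if X ((j * N : ℕ) * h) ω = s j then 1 else 0) *
        (∏ r ∈ Finset.range N, g j (X ((j * N + r : ℕ) * h) ω) (X ((j * N + r + 1 : ℕ) * h) ω)) *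
        (if X ((j * N + N : ℕ) * h) ω = s (j + 1) then 1 else 0)) ∂P =
      ∏ j ∈ Finset.range n, (weightedStep Q h (g j) ^ N) (s j) (s (j + 1)) := by
  induction n with
  | zero => simp
  | succ n ih =>
    set C : Ω → ℂ := fun ω => ∏ j ∈ Finset.range n,
      ((if X ((j * N : ℕ) * h) ω = s j then 1 else 0) *
        (∏ r ∈ Finset.range N, g j (X ((j * N + r : ℕ) * h) ω) (X ((j * N + r + 1 : ℕ) * h) ω)) *
        (if X ((j * N + N : ℕ) * h) ω = s (j + 1) then 1 else 0)) with hCdef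
    have hC : ∀ ω ω', (∀ m ≤ n * N, X (m * h) ω = X (m * h) ω') → C ω = C ω' := by
      intro ω ω' hω
      refine Finset.prod_congr rfl fun j hj => ?_
      have hjn : j * N + N ≤ n * N := by
        rw [← Nat.succ_mul]; exact Nat.mul_le_mul_right _ (Finset.mem_range.1 hj)
      rw [hω (j * N) (by omega), hω (j * N + N) hjn]
      congr 2
      refine Finset.prod_congr rfl fun r hr => ?_
      have := Finset.mem_range.1 hr
      rw [hω (j * N + r) (by omega), hω (j * N + r + 1) (by omega)]
    -- The state at the start of the new block is already fixed by `C`, as the end of the previous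
    -- block, or by the initial condition when there is none.
    have h1 : ∀ ω, C ω * (if X ((n * N : ℕ) * h) ω = s n then 1 else 0) = C ω := by
      intro ω
      rcases n with - | n
      · simp [hX.init, hs]
      · by_cases hn : X (((n + 1) * N : ℕ) * h) ω = s (n + 1)
        · rw [if_pos hn, mul_one]
        · have : C ω = 0 := by
            refine Finset.prod_eq_zero (i := n) (by simp) ?_
            rw [← Nat.succ_mul, if_neg hn, mul_zero]
          rw [this, zero_mul]
    have hblock := hX.integral_block h (n * N) hC (g n) (s n) (s (n + 1)) N
    simp only [h1] at hblock
    rw [Finset.prod_range_succ, ← ih, ← hblock]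
    refine integral_congr_ae (Filter.Eventually.of_forall fun ω => ?_)
    beta_reduce
    rw [Finset.prod_range_succ]
    change C ω * _ = _
    rw [← mul_assoc, ← mul_assoc, h1]

end IsMarkovChainFrom

/-! ### Measurability of the clocks. -/

open PathSpace

section Measurability

variable {d : ℕ} {Ω : Type*} {m : MeasurableSpace Ω} {X : ℝ≥0 → Ω → Fin d}

/-- Occupation times are limits of mesh sums. The σ-algebra is arbitrary, so the result also holds
for the one generated by the chain alone, which the conditioning argument needs. -/
lemma measurable_occupation (hX : ∀ t, Measurable (X t)) (hc : ∀ ω, IsCadlag fun t => X t ω)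
    (k : Fin d) (t : ℝ≥0) : Measurable fun ω => occupation (fun s => X s ω) k t := by
  refine measurable_of_tendsto_metrizable (f := fun N ω => (∑ r ∈ Finset.range N,
    if X (meshPoint 0 t N (r + 1)) ω = k then 1 else 0 : ℕ) * ((t - 0) / (N : ℝ≥0)))
    (fun N => ?_) (tendsto_pi_nhds.2 fun ω => ?_)
  · refine Measurable.mul_const ?_ _
    refine (measurable_of_countable fun n : ℕ => (n : ℝ≥0)).comp
      (Finset.measurable_sum _ fun r _ => ?_)
    exact (measurable_of_finite fun x : Fin d => if x = k then (1 : ℕ) else 0).comp (hX _)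
  · have := (hc ω).tendsto_occupation (zero_le : 0 ≤ t) k
    rwa [occupation_zero, tsub_zero (occupation _ _ _)] at this

lemma measurable_transitions (hX : ∀ t, Measurable (X t)) (hc : ∀ ω, IsCadlag fun t => X t ω)
    {k l : Fin d} (hkl : k ≠ l) (t : ℝ≥0) :
    Measurable fun ω => transitions (fun s => X s ω) k l t := by
  refine measurable_of_tendsto_metrizable (f := fun N ω => ∑ r ∈ Finset.range N,
    if X (meshPoint 0 t N r) ω = k ∧ X (meshPoint 0 t N (r + 1)) ω = l then 1 else 0)
    (fun N => ?_) (tendsto_pi_nhds.2 fun ω => ?_)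
  · refine Finset.measurable_sum _ fun r _ => ?_
    exact (measurable_of_finite fun x : Fin d × Fin d => if x.1 = k ∧ x.2 = l then 1 else 0).comp
      ((hX _).prodMk (hX _))
  · refine tendsto_const_nhds.congr' ?_
    filter_upwards [(hc ω).eventually_transitions_eq (zero_le : 0 ≤ t)] with N hN
    rw [hN k l hkl, transitions_zero, zero_add]

lemma measurable_sources_of_apply {f : Ω → (Fin d → PathSpace 1) × (ℕ → Fin d → Fin d → ℝ≥0)}
    (h1 : ∀ k t, Measurable fun ω => ((f ω).1 k).pos t)
    (h2 : ∀ n k l, Measurable fun ω => (f ω).2 n k l) : Measurable f :=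
  (measurable_pi_lambda _ fun k => measurable_of_apply (h1 k) fun _ =>
      measurable_const' fun _ _ => Subsingleton.elim _ _).prodMk
    (measurable_pi_lambda _ fun n => measurable_pi_lambda _ fun k => measurable_pi_lambda _ (h2 n k))

end Measurability

/-! ### Left limits of time-changed and summed paths. -/

section LeftLimits

lemma tendsto_nhdsLT_zero {E : Type*} (f : ℝ≥0 → E) (l : Filter E) :
    Filter.Tendsto f (𝓝[<] 0) l := by
  rw [show Set.Iio (0 : ℝ≥0) = ∅ by ext; simp, nhdsWithin_empty]
  exact Filter.tendsto_bot

lemma Monotone.exists_tendsto_nhdsLT_le {f : ℝ≥0 → ℝ} (hf : Monotone f) (t : ℝ≥0) :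
    ∃ l, Filter.Tendsto f (𝓝[<] t) (𝓝 l) ∧ l ≤ f t := by
  rcases eq_or_ne t 0 with rfl | ht
  · exact ⟨f 0, tendsto_nhdsLT_zero f _, le_rfl⟩
  · refine ⟨_, hf.tendsto_nhdsLT t, csSup_le ⟨f 0, 0, pos_iff_ne_zero.2 ht, rfl⟩ ?_⟩
    rintro _ ⟨s, hs, rfl⟩
    exact hf (le_of_lt hs)

/-- Either the clock is flat just before `t` and the composition is constant there, or it approaches
`c t` strictly from below and the left limit of the path is inherited. -/
lemma PathSpace.exists_tendsto_comp {d : ℕ} (w : PathSpace d) {c : ℝ≥0 → ℝ≥0} (hc : Continuous c)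
    (hmono : Monotone c) (t : ℝ≥0) :
    ∃ l, Filter.Tendsto (fun s => w.pos (c s)) (𝓝[<] t) (𝓝 l) ∧ l ≤ w.pos (c t) := by
  by_cases h : ∃ s < t, c s = c t
  · obtain ⟨s, hs, hst⟩ := h
    refine ⟨w.pos (c t), tendsto_const_nhds.congr' ?_, le_rfl⟩
    filter_upwards [Ioo_mem_nhdsLT hs] with u hu
    rw [le_antisymm (hmono hu.2.le) (hst ▸ hmono hu.1.le)]
  · push Not at h
    obtain ⟨l, hl, hle⟩ := w.2.2.2 (c t)
    refine ⟨l, hl.comp (tendsto_nhdsWithin_iff.2 ⟨hc.continuousAt.continuousWithinAt, ?_⟩), hle⟩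
    filter_upwards [self_mem_nhdsWithin] with u hu
    exact lt_of_le_of_ne (hmono (le_of_lt hu)) (h u hu)

lemma exists_tendsto_nhdsLT_sum {ι : Type*} (S : Finset ι) {f : ι → ℝ≥0 → ℝ} {t : ℝ≥0}
    (hf : ∀ k ∈ S, ∃ l, Filter.Tendsto (f k) (𝓝[<] t) (𝓝 l) ∧ l ≤ f k t) :
    ∃ l, Filter.Tendsto (fun s => ∑ k ∈ S, f k s) (𝓝[<] t) (𝓝 l) ∧ l ≤ ∑ k ∈ S, f k t := by
  choose! l hl hle using hf
  exact ⟨∑ k ∈ S, l k, tendsto_finsetSum _ fun k hk => hl k hk, Finset.sum_le_sum hle⟩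

lemma PathSpace.continuousWithinAt_comp {d : ℕ} (w : PathSpace d) {c : ℝ≥0 → ℝ≥0}
    (hc : Continuous c) (hmono : Monotone c) (t : ℝ≥0) :
    ContinuousWithinAt (fun s => w.pos (c s)) (Set.Ici t) t :=
  (w.rightCts_pos (c t)).comp hc.continuousWithinAt fun _ hs => hmono hs

end LeftLimits

/-! ### The free process as a random path, and the splitting of its sources. -/

namespace Model

variable {Ω : Type*} [MeasurableSpace Ω] {P : Measure Ω} {d : ℕ} (M : Model P d)

/-- The sources of randomness other than the background chain. -/
def rest (ω : Ω) : (Fin d → PathSpace 1) × (ℕ → Fin d → Fin d → ℝ≥0) :=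
  (fun k => levyPath (M.isLevy k) ω, fun n k l => M.mark n k l ω)

/-- The level as a function of the occupation times, the numbers of transitions, the Lévy paths and
the marks. -/
def level (v : Fin d → ℝ≥0) (N : Fin d → Fin d → ℕ)
    (r : (Fin d → PathSpace 1) × (ℕ → Fin d → Fin d → ℝ≥0)) : ℝ :=
  ∑ k, (r.1 k).pos (v k) + ∑ k, ∑ l ∈ Finset.univ.erase k, ∑ n ∈ Finset.range (N k l), (r.2 n k l : ℝ)

lemma Y_eq_level (i : Fin d) (t : ℝ≥0) (ω : Ω) : M.Y i t ω =
    level (fun k => occupation (fun s => M.J i s ω) k t)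
      (fun k l => transitions (fun s => M.J i s ω) k l t) (M.rest ω) := rfl

/-- The path of the process started in state `i`. -/
def path (i : Fin d) (ω : Ω) : PathSpace d :=
  ⟨fun t => (M.Y i t ω, M.J i t ω), by
    have hc := (M.chain i).cadlag ω
    have hmono : ∀ k, ∀ l ∈ Finset.univ.erase k, Monotone fun t =>
        ∑ n ∈ Finset.range (transitions (fun s => M.J i s ω) k l t), (M.mark n k l ω : ℝ) := by
      intro k l hl a b hab
      exact Finset.sum_le_sum_of_subset_of_nonneg
        (Finset.range_mono (hc.transitions_mono (Finset.ne_of_mem_erase hl).symm hab))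
        fun _ _ _ => NNReal.coe_nonneg _
    refine ⟨fun t => ContinuousWithinAt.prodMk ?_ (hc t).1, ?_, fun t => ?_⟩
    · refine ContinuousWithinAt.add (tendsto_finsetSum _ fun k _ => ?_)
        (tendsto_finsetSum _ fun k _ => tendsto_finsetSum _ fun l hl => ?_)
      · exact (levyPath (M.isLevy k) ω).continuousWithinAt_comp (continuous_occupation k)
          (occupation_mono k) t
      · refine tendsto_const_nhds.congr' ?_
        filter_upwards [hc.eventually_transitions_right (Finset.ne_of_mem_erase hl).symm t] with u hu
        rw [hu]
    · simp only [Y, occupation_zero, transitions_zero, (M.isLevy _).zero]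
      simp
    · obtain ⟨l₁, h1, h2⟩ := exists_tendsto_nhdsLT_sum (t := t) Finset.univ
        (f := fun k t => M.levy k (occupation (fun s => M.J i s ω) k t) ω) fun k _ =>
        (levyPath (M.isLevy k) ω).exists_tendsto_comp (continuous_occupation k)
          (occupation_mono k) t
      obtain ⟨l₂, h3, h4⟩ := exists_tendsto_nhdsLT_sum (t := t) Finset.univ fun k _ =>
        exists_tendsto_nhdsLT_sum (t := t) (Finset.univ.erase k) fun l hl =>
          Monotone.exists_tendsto_nhdsLT_le (hmono k l hl) t
      exact ⟨l₁ + l₂, h1.add h3, add_le_add h2 h4⟩⟩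

@[simp] lemma pos_path (i : Fin d) (ω : Ω) (t : ℝ≥0) : (M.path i ω).pos t = M.Y i t ω := rfl

@[simp] lemma st_path (i : Fin d) (ω : Ω) (t : ℝ≥0) : (M.path i ω).st t = M.J i t ω := rfl

lemma measurable_chain_J (i : Fin d) (t : ℝ≥0) :
    Measurable[sourceSigma (M.J i) M.levy M.mark .chain] (M.J i t) :=
  (measurable_pi_apply t).comp (comap_measurable fun ω t => M.J i t ω)

lemma measurable_rest (i : Fin d) :
    Measurable[⨆ s ∈ ({Source.chain}ᶜ : Set (Source d)), sourceSigma (M.J i) M.levy M.mark s]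
      M.rest := by
  have hle : ∀ s ≠ Source.chain, sourceSigma (M.J i) M.levy M.mark s ≤
      ⨆ s ∈ ({Source.chain}ᶜ : Set (Source d)), sourceSigma (M.J i) M.levy M.mark s :=
    fun s hs => le_iSup₂_of_le s hs le_rfl
  refine measurable_sources_of_apply (fun k t => ?_) fun n k l => ?_
  · have : Measurable[sourceSigma (M.J i) M.levy M.mark (.levy k)] (M.levy k t) :=
      (measurable_pi_apply t).comp (comap_measurable fun ω t => M.levy k t ω)
    exact this.mono (hle _ (by simp)) le_rfl
  · exact (comap_measurable (M.mark n k l)).mono (hle (.mark n k l) (by simp)) le_rfl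

lemma sourceSigma_le (i : Fin d) (s : Source d) :
    sourceSigma (M.J i) M.levy M.mark s ≤ (inferInstance : MeasurableSpace Ω) := by
  cases s with
  | chain => exact (measurable_pi_lambda _ fun t => (M.chain i).measurable t).comap_le
  | levy k => exact (measurable_pi_lambda _ fun t => (M.isLevy k).measurable t).comap_le
  | mark n k l => exact (M.mark_measurable n k l).comap_le

/-- Mutual independence of the sources, grouped into the chain on one side and all others on the
other. -/
lemma indepFun_rest [IsZeroOrProbabilityMeasure P] (i : Fin d) {β : Type*} [MeasurableSpace β]
    {V : Ω → β} (hV : Measurable[sourceSigma (M.J i) M.levy M.mark .chain] V) :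
    IndepFun V M.rest P := by
  have h := indep_iSup_of_disjoint (M.sourceSigma_le i) (M.indep i)
    (S := {Source.chain}) (T := {Source.chain}ᶜ) disjoint_compl_right
  rw [IndepFun_iff_Indep]
  refine indep_of_indep_of_le_left (indep_of_indep_of_le_right h ?_) ?_
  · exact (M.measurable_rest i).comap_le
  · exact hV.comap_le.trans (le_iSup₂_of_le Source.chain rfl le_rfl)

lemma measurable_level {α : Type*} {m : MeasurableSpace α} {v : α → Fin d → ℝ≥0}
    {N : α → Fin d → Fin d → ℕ} {r : α → (Fin d → PathSpace 1) × (ℕ → Fin d → Fin d → ℝ≥0)}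
    (hv : ∀ k, Measurable fun a => v a k) (hN : ∀ k, ∀ l ≠ k, Measurable fun a => N a k l)
    (hr : Measurable r) : Measurable fun a => level (v a) (N a) (r a) := by
  refine Measurable.add (Finset.measurable_sum _ fun k _ => ?_)
    (Finset.measurable_sum _ fun k _ => Finset.measurable_sum _ fun l hl => ?_)
  · exact measurable_pos_uncurry.comp
      ((hv k).prodMk ((measurable_pi_apply k).comp (measurable_fst.comp hr)))
  · have h1 : Measurable fun p : ℕ × (ℕ → Fin d → Fin d → ℝ≥0) =>
        ∑ n ∈ Finset.range p.1, (p.2 n k l : ℝ) := by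
      refine measurable_from_prod_countable_right fun n =>
        Finset.measurable_sum (Finset.range n) fun j _ => ?_
      exact measurable_coe_nnreal_real.comp ((measurable_pi_apply l).comp
        ((measurable_pi_apply k).comp (measurable_pi_apply j)))
    exact h1.comp ((hN k l (Finset.ne_of_mem_erase hl)).prodMk (measurable_snd.comp hr))

/-- The killing time is independent of this σ-algebra, so measurability with respect to it yields
independence of the killing time and the path. -/
lemma measurable_path_sigmaAlg (i : Fin d) : Measurable[M.sigmaAlg i] (M.path i) := by
  have hle : ∀ s, sourceSigma (M.J i) M.levy M.mark s ≤ M.sigmaAlg i := le_iSup _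
  have hJ : ∀ t, Measurable[M.sigmaAlg i] (M.J i t) := fun t =>
    (M.measurable_chain_J i t).mono (hle _) le_rfl
  refine measurable_of_apply (fun t => ?_) hJ
  exact measurable_level (fun k => measurable_occupation hJ (M.chain i).cadlag k t)
    (fun k l hl => measurable_transitions hJ (M.chain i).cadlag hl.symm t)
    ((M.measurable_rest i).mono (iSup₂_le fun s _ => hle s) le_rfl)

lemma measurable_path (i : Fin d) : Measurable (M.path i) :=
  (M.measurable_path_sigmaAlg i).mono (iSup_le (M.sourceSigma_le i)) le_rfl

end Model

/-! ### Transforms of level increments for deterministic clocks. -/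

open PathSpace

/-- The intervals `[a j, a (j + 1))` are disjoint, so at most one factor differs from `1`. In the
application, a given mark enters at most one increment of the level. The index is the same for all
`u`, so the dichotomy serves both the random factor and its expectation. -/
lemma prod_indicator_cases {a : ℕ → ℕ} (ha : Monotone a) (m n : ℕ) :
    (∀ u : ℕ → ℂ, ∏ j ∈ Finset.range n, (if a j ≤ m ∧ m < a (j + 1) then u j else 1) = 1) ∨
    ∃ i, ∀ u : ℕ → ℂ,
      ∏ j ∈ Finset.range n, (if a j ≤ m ∧ m < a (j + 1) then u j else 1) = u i := by
  by_cases h : ∃ i ∈ Finset.range n, a i ≤ m ∧ m < a (i + 1)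
  · obtain ⟨i, hi, h1, h2⟩ := h
    refine Or.inr ⟨i, fun u => ?_⟩
    rw [Finset.prod_eq_single i _ (fun h => absurd hi h), if_pos ⟨h1, h2⟩]
    rintro j - hji
    rw [if_neg]
    rintro ⟨h3, h4⟩
    rcases lt_or_gt_of_ne hji with h | h
    · exact absurd (h4.trans_le ((ha h).trans h1)) (lt_irrefl _)
    · exact absurd (h2.trans_le ((ha h).trans h3)) (lt_irrefl _)
  · push Not at h
    refine Or.inl fun u => Finset.prod_eq_one fun j hj => if_neg fun h' => ?_
    exact absurd h'.2 (not_lt.2 (h j hj h'.1))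

lemma prod_range_indicator {a b m₀ : ℕ} (hb : b ≤ m₀) (c : ℂ) :
    ∏ m ∈ Finset.range m₀, (if a ≤ m ∧ m < b then c else 1) = c ^ (b - a) := by
  rw [Finset.prod_ite, Finset.prod_const, Finset.prod_const_one, mul_one, ← Nat.card_Ico]
  congr 2
  ext m
  simp only [Finset.mem_filter, Finset.mem_range, Finset.mem_Ico]
  omega

lemma prod_range_indicator_exp {a b m₀ : ℕ} (hab : a ≤ b) (hb : b ≤ m₀) (ζ : ℂ) (x : ℕ → ℝ) :
    ∏ m ∈ Finset.range m₀, (if a ≤ m ∧ m < b then Complex.exp (ζ * x m) else 1) =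
      Complex.exp (ζ * ((∑ m ∈ Finset.range b, x m - ∑ m ∈ Finset.range a, x m : ℝ) : ℂ)) := by
  rw [← Finset.sum_Ico_eq_sub _ hab, Complex.ofReal_sum, Finset.mul_sum, Complex.exp_sum,
    Finset.prod_ite, Finset.prod_const_one, mul_one]
  congr 1
  ext m
  simp only [Finset.mem_filter, Finset.mem_range, Finset.mem_Ico]
  omega

lemma iIndepFun.integrable_prod {Ω ι : Type*} [MeasurableSpace Ω] {P : Measure Ω}
    [IsProbabilityMeasure P] {f : ι → Ω → ℂ} (hf : iIndepFun f P) (hm : ∀ i, Measurable (f i))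
    (hi : ∀ i, Integrable (f i) P) (s : Finset ι) : Integrable (∏ i ∈ s, f i) P := by
  classical
  induction s using Finset.induction_on with
  | empty => exact integrable_const (1 : ℂ)
  | insert i s his ih =>
    rw [Finset.prod_insert his, mul_comm]
    exact (hf.indepFun_finsetProd_of_notMem hm his).integrable_mul ih (hi i)

namespace IsSpectrallyPositiveLevy

variable {Ω : Type*} [MeasurableSpace Ω] {P : Measure Ω} {L : ℝ≥0 → Ω → ℝ}

lemma integrable_prod_exp_sub [IsProbabilityMeasure P] (hL : IsSpectrallyPositiveLevy P L) (n : ℕ)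
    {ζ : ℕ → ℂ} (hζ : ∀ j, (ζ j).re ≤ 0) {t : ℕ → ℝ≥0} (ht : Monotone t) :
    Integrable (fun ω => ∏ j ∈ Finset.range n,
      Complex.exp (ζ j * ((L (t (j + 1)) ω - L (t j) ω : ℝ) : ℂ))) P := by
  have hind : iIndepFun (fun (j : ℕ) ω => L (t (j + 1)) ω - L (t j) ω) P :=
    hL.indep_increments.nat ht
  have hind' := hind.comp (fun j (x : ℝ) => Complex.exp (ζ j * x))
    (fun j => measurable_cexp_mul measurable_id (ζ j))
  have := iIndepFun.integrable_prod hind' (fun j => measurable_cexp_mul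
    ((hL.measurable _).sub (hL.measurable _)) (ζ j)) (fun j => ?_) (Finset.range n)
  · simpa only [Finset.prod_fn, Function.comp_apply] using this
  · have := hL.integrable_exp_sub (s := t j) (hL.integrable_exp (hζ j) (t (j + 1) - t j))
    rwa [add_tsub_cancel_of_le (ht (Nat.le_succ _))] at this

end IsSpectrallyPositiveLevy

namespace Model

variable {Ω : Type*} [MeasurableSpace Ω] {P : Measure Ω} {d : ℕ} (M : Model P d)

/-- The transform `E exp(ζ B)` of the mark `B` of a transition from `k` to `l`. -/
def markTransform (k l : Fin d) (ζ : ℂ) : ℂ := ∫ ω, Complex.exp (ζ * (M.mark 0 k l ω : ℝ)) ∂P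

lemma norm_exp_mark_le {ζ : ℂ} (hζ : ζ.re ≤ 0) (n : ℕ) (k l : Fin d) (ω : Ω) :
    ‖Complex.exp (ζ * (M.mark n k l ω : ℝ))‖ ≤ 1 := by
  rw [norm_exp_mul_real, Real.exp_le_one_iff]
  exact mul_nonpos_of_nonpos_of_nonneg hζ (NNReal.coe_nonneg _)

lemma measurable_exp_mark (ζ : ℂ) (n : ℕ) (k l : Fin d) :
    Measurable fun ω => Complex.exp (ζ * (M.mark n k l ω : ℝ)) :=
  measurable_cexp_mul (measurable_coe_nnreal_real.comp (M.mark_measurable n k l)) ζ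

lemma integrable_exp_mark [IsProbabilityMeasure P] {ζ : ℂ} (hζ : ζ.re ≤ 0) (n : ℕ) (k l : Fin d) :
    Integrable (fun ω => Complex.exp (ζ * (M.mark n k l ω : ℝ))) P :=
  Integrable.of_bound (M.measurable_exp_mark ζ n k l).aestronglyMeasurable 1
    (Filter.Eventually.of_forall (M.norm_exp_mark_le hζ n k l))

lemma integral_exp_mark (ζ : ℂ) (n : ℕ) (k l : Fin d) :
    ∫ ω, Complex.exp (ζ * (M.mark n k l ω : ℝ)) ∂P = M.markTransform k l ζ :=
  ((M.mark_law n k l).comp (u := fun x : ℝ≥0 => Complex.exp (ζ * (x : ℝ)))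
    (measurable_cexp_mul measurable_coe_nnreal_real ζ)).integral_eq

lemma markTransform_diag [IsProbabilityMeasure P] (k : Fin d) (ζ : ℂ) :
    M.markTransform k k ζ = 1 := by
  simp [markTransform, M.mark_diag]

lemma norm_markTransform_le [IsProbabilityMeasure P] {ζ : ℂ} (hζ : ζ.re ≤ 0) (k l : Fin d) :
    ‖M.markTransform k l ζ‖ ≤ 1 := by
  have := norm_integral_le_of_norm_le_const (μ := P)
    (Filter.Eventually.of_forall (M.norm_exp_mark_le hζ 0 k l))
  rwa [probReal_univ, mul_one] at this

/-- The conditional transform of an increment of the level, given the background path. -/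
def weight (ζ : ℂ) (v v' : Fin d → ℝ≥0) (N N' : Fin d → Fin d → ℕ) : ℂ :=
  (∏ k, levyTransform P (M.levy k) ζ (v' k - v k)) *
    ∏ k, ∏ l ∈ Finset.univ.erase k, M.markTransform k l ζ ^ (N' k l - N k l)

/-- The factor that one source contributes to the exponential of weighted increments of the level. -/
def sourceFactor (n : ℕ) (ζ : ℕ → ℂ) (v : ℕ → Fin d → ℝ≥0) (N : ℕ → Fin d → Fin d → ℕ) :
    Source d → Ω → ℂ
  | .chain => fun _ => 1
  | .levy k => fun ω => ∏ j ∈ Finset.range n,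
      Complex.exp (ζ j * ((M.levy k (v (j + 1) k) ω - M.levy k (v j k) ω : ℝ) : ℂ))
  | .mark m k l => fun ω => ∏ j ∈ Finset.range n,
      if N j k l ≤ m ∧ m < N (j + 1) k l then Complex.exp (ζ j * (M.mark m k l ω : ℝ)) else 1

lemma measurable_sourceFactor (i : Fin d) (n : ℕ) (ζ : ℕ → ℂ) (v : ℕ → Fin d → ℝ≥0)
    (N : ℕ → Fin d → Fin d → ℕ) (s : Source d) :
    Measurable[sourceSigma (M.J i) M.levy M.mark s] (M.sourceFactor n ζ v N s) := by
  cases s with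
  | chain => exact measurable_const
  | levy k =>
    have h : ∀ t, Measurable[sourceSigma (M.J i) M.levy M.mark (.levy k)] (M.levy k t) := fun t =>
      (measurable_pi_apply t).comp (comap_measurable fun ω t => M.levy k t ω)
    exact Finset.measurable_fun_prod _ fun j _ => measurable_cexp_mul ((h _).sub (h _)) _
  | mark m k l =>
    have h : Measurable[sourceSigma (M.J i) M.levy M.mark (.mark m k l)] (M.mark m k l) :=
      comap_measurable _
    refine Finset.measurable_fun_prod _ fun j _ => ?_
    split_ifs
    · exact measurable_cexp_mul (measurable_coe_nnreal_real.comp h) _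
    · exact measurable_const

lemma sourceFactor_mark [IsProbabilityMeasure P] {n : ℕ} {ζ : ℕ → ℂ} (hζ : ∀ j, (ζ j).re ≤ 0)
    (v : ℕ → Fin d → ℝ≥0) {N : ℕ → Fin d → Fin d → ℕ}
    (hN : ∀ k l, k ≠ l → Monotone fun j => N j k l) (m : ℕ) (k l : Fin d) :
    Integrable (M.sourceFactor n ζ v N (.mark m k l)) P ∧
    ∫ ω, M.sourceFactor n ζ v N (.mark m k l) ω ∂P = ∏ j ∈ Finset.range n,
      if N j k l ≤ m ∧ m < N (j + 1) k l then M.markTransform k l (ζ j) else 1 := by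
  by_cases hkl : k = l
  · subst hkl
    have : M.sourceFactor n ζ v N (.mark m k k) = fun _ => 1 := by
      funext ω
      simp [sourceFactor, M.mark_diag]
    rw [this]
    simp [M.markTransform_diag]
  · rcases prod_indicator_cases (hN k l hkl) m n with h | ⟨i, h⟩
    · have h1 : M.sourceFactor n ζ v N (.mark m k l) = fun _ => 1 := funext fun ω => h _
      rw [h1, h]
      simp
    · have h1 : M.sourceFactor n ζ v N (.mark m k l) =
          fun ω => Complex.exp (ζ i * (M.mark m k l ω : ℝ)) :=
        funext fun ω => h fun j => Complex.exp (ζ j * (M.mark m k l ω : ℝ))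
      rw [h1, h fun j => M.markTransform k l (ζ j)]
      exact ⟨M.integrable_exp_mark (hζ i) m k l, M.integral_exp_mark (ζ i) m k l⟩

/-- The labels of finitely many sources. -/
def sourceLabel (m₀ : ℕ) : Fin d ⊕ (Fin d × Fin d × Fin m₀) → Source d
  | .inl k => .levy k
  | .inr p => .mark p.2.2 p.1 p.2.1

lemma sourceLabel_injective (m₀ : ℕ) : Function.Injective (sourceLabel (d := d) m₀) := by
  rintro (a | ⟨a, b, c⟩) (a' | ⟨a', b', c'⟩) h
  · simpa [sourceLabel] using h
  · simp [sourceLabel] at h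
  · simp [sourceLabel] at h
  · simp only [sourceLabel, Source.mark.injEq] at h
    obtain ⟨h1, h2, h3⟩ := h
    simp [h2, h3, Fin.ext h1]

lemma prod_sourceLabel {m₀ : ℕ} (f : Source d → ℂ) : ∏ s, f (sourceLabel m₀ s) =
    (∏ k, f (.levy k)) * ∏ k, ∏ l, ∏ m ∈ Finset.range m₀, f (.mark m k l) := by
  rw [Fintype.prod_sum_type, Fintype.prod_prod_type]
  simp_rw [Fintype.prod_prod_type, Finset.prod_range]
  rfl

lemma prod_erase_eq {f : Fin d → Fin d → ℂ} (hf : ∀ k, f k k = 1) :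
    ∏ k, ∏ l ∈ Finset.univ.erase k, f k l = ∏ k, ∏ l, f k l :=
  Finset.prod_congr rfl fun k _ => Finset.prod_erase _ (hf k)

/-- Regroups the exponentials by source instead of by time interval. Beyond index `m₀` no mark has
been used, so finitely many sources suffice. The diagonal marks vanish and may be included. -/
lemma prod_exp_level {n m₀ : ℕ} (ζ : ℕ → ℂ) (v : ℕ → Fin d → ℝ≥0) {N : ℕ → Fin d → Fin d → ℕ}
    (hN : ∀ k l, k ≠ l → Monotone fun j => N j k l) (hm₀ : ∀ j ≤ n, ∀ k l, N j k l ≤ m₀) (ω : Ω) :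
    ∏ j ∈ Finset.range n, Complex.exp (ζ j * ((level (v (j + 1)) (N (j + 1)) (M.rest ω) -
      level (v j) (N j) (M.rest ω) : ℝ) : ℂ)) =
    ∏ s, M.sourceFactor n ζ v N (sourceLabel m₀ s) ω := by
  rw [prod_sourceLabel fun s => M.sourceFactor n ζ v N s ω]
  have hswap : ∏ k, ∏ l, ∏ m ∈ Finset.range m₀, M.sourceFactor n ζ v N (.mark m k l) ω =
      ∏ j ∈ Finset.range n, ∏ k, ∏ l, ∏ m ∈ Finset.range m₀,
        if N j k l ≤ m ∧ m < N (j + 1) k l then Complex.exp (ζ j * (M.mark m k l ω : ℝ)) else 1 := by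
    symm
    rw [Finset.prod_comm]
    refine Finset.prod_congr rfl fun k _ => ?_
    rw [Finset.prod_comm]
    refine Finset.prod_congr rfl fun l _ => ?_
    rw [Finset.prod_comm]
    rfl
  have hswap2 : ∏ k, M.sourceFactor n ζ v N (.levy k) ω = ∏ j ∈ Finset.range n, ∏ k,
      Complex.exp (ζ j * ((M.levy k (v (j + 1) k) ω - M.levy k (v j k) ω : ℝ) : ℂ)) := by
    rw [Finset.prod_comm]
    rfl
  rw [hswap, hswap2, ← Finset.prod_mul_distrib]
  refine Finset.prod_congr rfl fun j hj => ?_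
  have hjn := Finset.mem_range.1 hj
  rw [← prod_erase_eq fun k => by simp [M.mark_diag]]
  rw [Finset.prod_congr rfl fun k _ => Finset.prod_congr rfl fun l hl =>
    prod_range_indicator_exp (hN k l (Finset.ne_of_mem_erase hl).symm (Nat.le_succ j))
      (hm₀ (j + 1) hjn k l) (ζ j) fun m => (M.mark m k l ω : ℝ)]
  simp_rw [← Complex.exp_sum, ← Complex.exp_add, ← Finset.mul_sum, ← mul_add,
    ← Complex.ofReal_sum, ← Complex.ofReal_add]
  congr 3
  simp only [level, Finset.sum_sub_distrib]
  change (∑ k, M.levy k _ ω + _) - (∑ k, M.levy k _ ω + _) = _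
  simp only [rest]
  ring

/-- For fixed clocks the factors of distinct sources are independent. The expectation is taken
source by source and the result regrouped by time interval. -/
lemma integral_prod_exp_level [IsProbabilityMeasure P] (i : Fin d) {n : ℕ} {ζ : ℕ → ℂ}
    (hζ : ∀ j, (ζ j).re ≤ 0) {v : ℕ → Fin d → ℝ≥0} (hv : ∀ k, Monotone fun j => v j k)
    {N : ℕ → Fin d → Fin d → ℕ} (hN : ∀ k l, k ≠ l → Monotone fun j => N j k l) :
    Integrable (fun ω => ∏ j ∈ Finset.range n, Complex.exp (ζ j *
      ((level (v (j + 1)) (N (j + 1)) (M.rest ω) - level (v j) (N j) (M.rest ω) : ℝ) : ℂ))) P ∧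
    ∫ ω, ∏ j ∈ Finset.range n, Complex.exp (ζ j *
      ((level (v (j + 1)) (N (j + 1)) (M.rest ω) - level (v j) (N j) (M.rest ω) : ℝ) : ℂ)) ∂P =
      ∏ j ∈ Finset.range n, M.weight (ζ j) (v j) (v (j + 1)) (N j) (N (j + 1)) := by
  set m₀ := ∑ j ∈ Finset.range (n + 1), ∑ k, ∑ l, N j k l with hm₀def
  have hm₀ : ∀ j ≤ n, ∀ k l, N j k l ≤ m₀ := fun j hj k l =>
    ((Finset.single_le_sum (f := fun l => N j k l) (fun _ _ => Nat.zero_le _)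
      (Finset.mem_univ l)).trans (Finset.single_le_sum (f := fun k => ∑ l, N j k l)
      (fun _ _ => Nat.zero_le _) (Finset.mem_univ k))).trans
      (Finset.single_le_sum (f := fun j => ∑ k, ∑ l, N j k l) (fun _ _ => Nat.zero_le _)
        (Finset.mem_range.2 (Nat.lt_succ_of_le hj)))
  simp_rw [M.prod_exp_level ζ v hN hm₀]
  have hmeas : ∀ s, Measurable (M.sourceFactor n ζ v N s) := fun s =>
    (M.measurable_sourceFactor i n ζ v N s).mono (M.sourceSigma_le i s) le_rfl
  have hind : iIndepFun (M.sourceFactor n ζ v N) P := by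
    rw [iIndepFun_iff_iIndep]
    exact iIndep_of_iIndep_of_le (M.indep i) fun s => (M.measurable_sourceFactor i n ζ v N s).comap_le
  have hind' : iIndepFun (fun s => M.sourceFactor n ζ v N (sourceLabel m₀ s)) P :=
    hind.precomp (sourceLabel_injective m₀)
  have hlevyI : ∀ k, Integrable (M.sourceFactor n ζ v N (.levy k)) P := fun k =>
    (M.isLevy k).integrable_prod_exp_sub (t := fun j => v j k) n hζ (hv k)
  have hlevy : ∀ k, ∫ ω, M.sourceFactor n ζ v N (.levy k) ω ∂P =
      ∏ j ∈ Finset.range n, levyTransform P (M.levy k) (ζ j) (v (j + 1) k - v j k) := fun k => by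
    have := integral_prod_exp_sub (M.isLevy k) n ζ (hv k)
    rw [Finset.prod_range, ← this]
    refine integral_congr_ae (Filter.Eventually.of_forall fun ω => ?_)
    simp only [sourceFactor, Finset.prod_range]
  constructor
  · have := iIndepFun.integrable_prod hind' (fun s => hmeas _) (fun s => ?_) Finset.univ
    · simpa only [Finset.prod_fn] using this
    · rcases s with k | ⟨k, l, m⟩
      · exact hlevyI k
      · exact (M.sourceFactor_mark hζ v hN m k l).1
  · rw [hind'.integral_fun_prod_eq_prod_integral fun s => (hmeas _).aestronglyMeasurable,
      prod_sourceLabel fun s => ∫ ω, M.sourceFactor n ζ v N s ω ∂P]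
    simp_rw [hlevy, (M.sourceFactor_mark hζ v hN _ _ _).2]
    have hswap : ∏ k, ∏ l, ∏ m ∈ Finset.range m₀, ∏ j ∈ Finset.range n,
        (if N j k l ≤ m ∧ m < N (j + 1) k l then M.markTransform k l (ζ j) else 1) =
        ∏ j ∈ Finset.range n, ∏ k, ∏ l, M.markTransform k l (ζ j) ^ (N (j + 1) k l - N j k l) := by
      symm
      rw [Finset.prod_comm]
      refine Finset.prod_congr rfl fun k _ => ?_
      rw [Finset.prod_comm]
      refine Finset.prod_congr rfl fun l _ => ?_
      rw [Finset.prod_comm]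
      refine Finset.prod_congr rfl fun j hj => ?_
      exact (prod_range_indicator (hm₀ _ (Finset.mem_range.1 hj) k l) _).symm
    rw [hswap, Finset.prod_comm, ← Finset.prod_mul_distrib]
    refine Finset.prod_congr rfl fun j _ => ?_
    rw [weight, prod_erase_eq fun k => by rw [M.markTransform_diag, one_pow]]

end Model

/-! ### Conditioning on the background chain. -/

open PathSpace

namespace Model

variable {Ω : Type*} [MeasurableSpace Ω] {P : Measure Ω} {d : ℕ} (M : Model P d)

/-- The Lévy transforms are continuous, hence bounded on `[0, T]`. The mark transforms have modulus
at most `1`, so any number of transitions is harmless. -/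
lemma exists_norm_weight_le [IsProbabilityMeasure P] {ζ : ℂ} (hζ : ζ.re ≤ 0) (T : ℝ≥0) :
    ∃ B : ℝ, ∀ v v' N N', (∀ k, v' k - v k ≤ T) → ‖M.weight ζ v v' N N'‖ ≤ B := by
  have h : ∀ k, ∃ B, ∀ s ∈ Set.Icc 0 T, ‖levyTransform P (M.levy k) ζ s‖ ≤ B := fun k =>
    isCompact_Icc.exists_bound_of_continuousOn (continuous_levyTransform (M.isLevy k) hζ).continuousOn
  choose B hB using h
  refine ⟨∏ k, B k, fun v v' N N' hv => ?_⟩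
  rw [weight, norm_mul, norm_prod, norm_prod]
  have h1 : ∏ k, ‖levyTransform P (M.levy k) ζ (v' k - v k)‖ ≤ ∏ k, B k :=
    Finset.prod_le_prod (fun _ _ => norm_nonneg _) fun k _ => hB k _ ⟨zero_le, hv k⟩
  refine (mul_le_of_le_one_right (Finset.prod_nonneg fun _ _ => norm_nonneg _) ?_).trans h1
  refine Finset.prod_le_one (fun _ _ => norm_nonneg _) fun k _ => ?_
  rw [norm_prod]
  refine Finset.prod_le_one (fun _ _ => norm_nonneg _) fun l _ => ?_
  rw [norm_pow]
  exact pow_le_one₀ (norm_nonneg _) (M.norm_markTransform_le hζ k l)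

/-- Occupation times and numbers of transitions along a sequence of times. -/
def ClockData (d : ℕ) (t : ℕ → ℝ≥0) : Type :=
  {p : (ℕ → Fin d → ℝ≥0) × (ℕ → Fin d → Fin d → ℕ) //
    (∀ k, Monotone fun j => p.1 j k) ∧ (∀ k l, k ≠ l → Monotone fun j => p.2 j k l) ∧
      ∀ j k, p.1 j k ≤ t j}

instance (t : ℕ → ℝ≥0) : MeasurableSpace (ClockData d t) :=
  inferInstanceAs (MeasurableSpace (Subtype _))

lemma measurable_clockData {Ω' : Type*} {m : MeasurableSpace Ω'} {t : ℕ → ℝ≥0}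
    {f : Ω' → ClockData d t} (h1 : ∀ j k, Measurable fun ω => (f ω).1.1 j k)
    (h2 : ∀ j k l, Measurable fun ω => (f ω).1.2 j k l) : Measurable f :=
  Measurable.subtype_mk (p := fun p : (ℕ → Fin d → ℝ≥0) × (ℕ → Fin d → Fin d → ℕ) =>
      (∀ k, Monotone fun j => p.1 j k) ∧ (∀ k l, k ≠ l → Monotone fun j => p.2 j k l) ∧
      ∀ j k, p.1 j k ≤ t j) <| Measurable.prodMk
    (measurable_pi_lambda _ fun j => measurable_pi_lambda _ fun k => h1 j k)
    (measurable_pi_lambda _ fun j => measurable_pi_lambda _ fun k =>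
      measurable_pi_lambda _ fun l => h2 j k l)

/-- The clocks of the background process along a sequence of times. -/
def clock (i : Fin d) {t : ℕ → ℝ≥0} (ht : Monotone t) (ω : Ω) : ClockData d t :=
  ⟨(fun j k => occupation (fun s => M.J i s ω) k (t j),
    fun j k l => if k = l then 0 else transitions (fun s => M.J i s ω) k l (t j)),
    fun k _ _ hab => occupation_mono k (ht hab), fun k l hkl a b hab => by
      simp only [if_neg hkl]
      exact ((M.chain i).cadlag ω).transitions_mono hkl (ht hab), fun _ _ => occupation_le _ _⟩

lemma measurable_clock (i : Fin d) {t : ℕ → ℝ≥0} (ht : Monotone t) :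
    Measurable[sourceSigma (M.J i) M.levy M.mark .chain] (M.clock i ht) := by
  have hJ := M.measurable_chain_J i
  have hc := (M.chain i).cadlag
  refine measurable_clockData (fun j k => measurable_occupation hJ hc k (t j)) fun j k l => ?_
  by_cases hkl : k = l
  · simp only [clock, if_pos hkl]
    exact measurable_const
  · simp only [clock, if_neg hkl]
    exact measurable_transitions hJ hc hkl (t j)

lemma level_clock (i : Fin d) {t : ℕ → ℝ≥0} (ht : Monotone t) (j : ℕ) (ω : Ω) :
    level ((M.clock i ht ω).1.1 j) ((M.clock i ht ω).1.2 j) (M.rest ω) = M.Y i (t j) ω := by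
  rw [Y_eq_level]
  simp only [level, clock]
  congr 1
  refine Finset.sum_congr rfl fun k _ => Finset.sum_congr rfl fun l hl => ?_
  rw [if_neg (Finset.ne_of_mem_erase hl).symm]

/-- The conditional transform of the level increment over `(s, t]`, given the background path. -/
def pathWeight (i : Fin d) (ζ : ℂ) (s t : ℝ≥0) (ω : Ω) : ℂ :=
  M.weight ζ (fun k => occupation (fun s => M.J i s ω) k s)
    (fun k => occupation (fun s => M.J i s ω) k t)
    (fun k l => transitions (fun s => M.J i s ω) k l s)
    (fun k l => transitions (fun s => M.J i s ω) k l t)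

lemma weight_clock (i : Fin d) {t : ℕ → ℝ≥0} (ht : Monotone t) (ζ : ℂ) (j : ℕ) (ω : Ω) :
    M.weight ζ ((M.clock i ht ω).1.1 j) ((M.clock i ht ω).1.1 (j + 1)) ((M.clock i ht ω).1.2 j)
      ((M.clock i ht ω).1.2 (j + 1)) = M.pathWeight i ζ (t j) (t (j + 1)) ω := by
  simp only [pathWeight, weight, clock]
  congr 1
  refine Finset.prod_congr rfl fun k _ => Finset.prod_congr rfl fun l hl => ?_
  rw [if_neg (Finset.ne_of_mem_erase hl).symm, if_neg (Finset.ne_of_mem_erase hl).symm]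

/-- Integrating out everything but the background chain. -/
lemma integral_condition_chain [IsProbabilityMeasure P] (i : Fin d) {t : ℕ → ℝ≥0} (ht : Monotone t)
    (n : ℕ) {ζ : ℕ → ℂ} (hζ : ∀ j, (ζ j).re ≤ 0) {Γ : Ω → ℂ}
    (hΓ : Measurable[sourceSigma (M.J i) M.levy M.mark .chain] Γ) (hΓ1 : ∀ ω, ‖Γ ω‖ ≤ 1) :
    Integrable (fun ω => Γ ω * ∏ j ∈ Finset.range n,
      Complex.exp (ζ j * ((M.Y i (t (j + 1)) ω - M.Y i (t j) ω : ℝ) : ℂ))) P ∧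
    ∫ ω, Γ ω * ∏ j ∈ Finset.range n,
      Complex.exp (ζ j * ((M.Y i (t (j + 1)) ω - M.Y i (t j) ω : ℝ) : ℂ)) ∂P =
      ∫ ω, Γ ω * ∏ j ∈ Finset.range n, M.pathWeight i (ζ j) (t j) (t (j + 1)) ω ∂P := by
  -- The codomain records the bound on `Γ` and the monotonicity of the clocks. The formula for
  -- deterministic clocks therefore holds at every point of it, not merely almost everywhere, when
  -- Fubini is applied.
  set V : Ω → Metric.closedBall (0 : ℂ) 1 × ClockData d t := fun ω =>
    (⟨Γ ω, by simpa using hΓ1 ω⟩, M.clock i ht ω) with hVdef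
  have hV : Measurable[sourceSigma (M.J i) M.levy M.mark .chain] V :=
    (Measurable.subtype_mk hΓ).prodMk (M.measurable_clock i ht)
  have hVm : Measurable V := hV.mono (M.sourceSigma_le i _) le_rfl
  have hR : Measurable M.rest := (M.measurable_rest i).mono
    (iSup₂_le fun s _ => M.sourceSigma_le i s) le_rfl
  have hmap := (indepFun_iff_map_prod_eq_prod_map_map hVm.aemeasurable hR.aemeasurable).1
    (M.indepFun_rest i hV)
  set E : (ℕ → ℂ) → (Metric.closedBall (0 : ℂ) 1 × ClockData d t) ×
      ((Fin d → PathSpace 1) × (ℕ → Fin d → Fin d → ℝ≥0)) → ℂ := fun ζ p =>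
    ∏ j ∈ Finset.range n, Complex.exp (ζ j * ((level (p.1.2.1.1 (j + 1)) (p.1.2.1.2 (j + 1)) p.2 -
      level (p.1.2.1.1 j) (p.1.2.1.2 j) p.2 : ℝ) : ℂ)) with hE
  have hEm : ∀ ζ, Measurable (E ζ) := by
    intro ζ
    refine Finset.measurable_fun_prod _ fun j _ => measurable_cexp_mul ?_ _
    have hd : Measurable fun p : (Metric.closedBall (0 : ℂ) 1 × ClockData d t) ×
      ((Fin d → PathSpace 1) × (ℕ → Fin d → Fin d → ℝ≥0)) => p.1.2.1 :=
      measurable_subtype_coe.comp (measurable_snd.comp measurable_fst)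
    have hl : ∀ j, Measurable fun p : (Metric.closedBall (0 : ℂ) 1 × ClockData d t) ×
        ((Fin d → PathSpace 1) × (ℕ → Fin d → Fin d → ℝ≥0)) =>
        level (p.1.2.1.1 j) (p.1.2.1.2 j) p.2 := fun j => measurable_level
      (fun k => (measurable_pi_apply k).comp ((measurable_pi_apply j).comp (measurable_fst.comp hd)))
      (fun k l _ => (measurable_pi_apply l).comp ((measurable_pi_apply k).comp
        ((measurable_pi_apply j).comp (measurable_snd.comp hd)))) measurable_snd
    exact (hl _).sub (hl _)
  set Φ : (Metric.closedBall (0 : ℂ) 1 × ClockData d t) ×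
      ((Fin d → PathSpace 1) × (ℕ → Fin d → Fin d → ℝ≥0)) → ℂ := fun p => p.1.1.1 * E ζ p with hΦ
  have hΦm : Measurable Φ :=
    (measurable_subtype_coe.comp (measurable_fst.comp measurable_fst)).mul (hEm ζ)
  have hin : ∀ (ζ : ℕ → ℂ), (∀ j, (ζ j).re ≤ 0) → ∀ v,
      Integrable (fun r => E ζ (v, r)) (P.map M.rest) ∧ ∫ r, E ζ (v, r) ∂(P.map M.rest) =
        ∏ j ∈ Finset.range n, M.weight (ζ j) (v.2.1.1 j) (v.2.1.1 (j + 1)) (v.2.1.2 j)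
          (v.2.1.2 (j + 1)) := by
    intro ζ hζ v
    have hm : Measurable fun r => E ζ (v, r) := (hEm ζ).comp measurable_prodMk_left
    have h := M.integral_prod_exp_level i (n := n) hζ v.2.2.1 v.2.2.2.1
    exact ⟨(integrable_map_measure hm.aestronglyMeasurable hR.aemeasurable).2 h.1,
      (integral_map hR.aemeasurable hm.aestronglyMeasurable).trans h.2⟩
  have hPV := Measure.isProbabilityMeasure_map (μ := P) hVm.aemeasurable
  have hPR := Measure.isProbabilityMeasure_map (μ := P) hR.aemeasurable
  have hint : Integrable Φ ((P.map V).prod (P.map M.rest)) := by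
    refine (integrable_prod_iff hΦm.aestronglyMeasurable).2
      ⟨Filter.Eventually.of_forall fun v => (hin ζ hζ v).1.const_mul v.1.1, ?_⟩
    have hζ' : ∀ j, (((ζ j).re : ℂ)).re ≤ 0 := fun j => by simpa using hζ j
    choose B hB using fun j => M.exists_norm_weight_le (hζ' j) (t (j + 1))
    refine Integrable.of_bound
      (hΦm.norm.stronglyMeasurable.integral_prod_right).aestronglyMeasurable
      (∏ j ∈ Finset.range n, B j) (Filter.Eventually.of_forall fun v => ?_)
    -- The modulus of the product is the same product with each `ζ j` replaced by its real part. Its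
    -- inner integral is therefore again a product of weights, bounded uniformly in the clocks.
    have h1 : ∀ r, ((‖E ζ (v, r)‖ : ℝ) : ℂ) = E (fun j => ((ζ j).re : ℂ)) (v, r) := by
      intro r
      simp only [hE]
      rw [norm_prod, Complex.ofReal_prod]
      refine Finset.prod_congr rfl fun j _ => ?_
      rw [norm_exp_mul_real]
      push_cast
      rfl
    have h2 : ((∫ r, ‖E ζ (v, r)‖ ∂(P.map M.rest) : ℝ) : ℂ) =
        ∏ j ∈ Finset.range n, M.weight ((ζ j).re : ℂ) (v.2.1.1 j) (v.2.1.1 (j + 1)) (v.2.1.2 j)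
          (v.2.1.2 (j + 1)) := by
      rw [← (hin _ hζ' v).2, ← integral_complex_ofReal]
      exact integral_congr_ae (Filter.Eventually.of_forall h1)
    have h3 : ∫ r, ‖Φ (v, r)‖ ∂(P.map M.rest) = ‖v.1.1‖ * ∫ r, ‖E ζ (v, r)‖ ∂(P.map M.rest) := by
      rw [← integral_const_mul]
      exact integral_congr_ae (Filter.Eventually.of_forall fun r => norm_mul _ _)
    have h4 : ‖∫ r, ‖E ζ (v, r)‖ ∂(P.map M.rest)‖ ≤ ∏ j ∈ Finset.range n, B j := by
      rw [← Complex.norm_real, h2, norm_prod]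
      refine Finset.prod_le_prod (fun _ _ => norm_nonneg _) fun j _ => hB j _ _ _ _ fun k => ?_
      exact tsub_le_self.trans (v.2.2.2.2 (j + 1) k)
    rw [h3, norm_mul, norm_norm]
    have h5 : ‖v.1.1‖ ≤ 1 := mem_closedBall_zero_iff.1 v.1.2
    exact (mul_le_of_le_one_left (norm_nonneg _) h5).trans h4
  have hpt : ∀ ω, Γ ω * ∏ j ∈ Finset.range n,
      Complex.exp (ζ j * ((M.Y i (t (j + 1)) ω - M.Y i (t j) ω : ℝ) : ℂ)) = Φ (V ω, M.rest ω) := by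
    intro ω
    simp only [hΦ, hE, hVdef, level_clock]
  simp_rw [hpt]
  have hpair : Measurable fun ω => (V ω, M.rest ω) := hVm.prodMk hR
  constructor
  · rw [← hmap] at hint
    exact (integrable_map_measure hΦm.aestronglyMeasurable hpair.aemeasurable).1 hint
  · rw [← integral_map hpair.aemeasurable (f := Φ) hΦm.aestronglyMeasurable, hmap,
      integral_prod _ hint, integral_map hVm.aemeasurable
        hΦm.stronglyMeasurable.integral_prod_right.aestronglyMeasurable]
    refine integral_congr_ae (Filter.Eventually.of_forall fun ω => ?_)
    simp only [hΦ, integral_const_mul, (hin ζ hζ _).2]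
    simp only [hVdef, weight_clock]

end Model

/-! ### Mesh products and the multiplicativity of transforms. -/

open PathSpace

lemma meshPoint_block (h : ℝ≥0) (j N r : ℕ) (hN : N ≠ 0) :
    meshPoint (j * h) ((j + 1 : ℕ) * h) N r = (j * N + r : ℕ) * (h / N) := by
  have hN' : (N : ℝ≥0) ≠ 0 := Nat.cast_ne_zero.2 hN
  rw [meshPoint, Nat.cast_add, Nat.cast_one, add_mul, one_mul, add_tsub_cancel_left]
  push_cast
  rw [add_mul, mul_assoc, mul_div_cancel₀ _ hN']

lemma levyTransform_nat_mul {Ω : Type*} [MeasurableSpace Ω] {P : Measure Ω} {L : ℝ≥0 → Ω → ℝ}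
    [IsProbabilityMeasure P] (hL : IsSpectrallyPositiveLevy P L) (ζ : ℂ) (n : ℕ) (s : ℝ≥0) :
    levyTransform P L ζ (n * s) = levyTransform P L ζ s ^ n := by
  induction n with
  | zero => simpa using levyTransform_zero hL ζ
  | succ n ih => rw [Nat.cast_add, Nat.cast_one, add_mul, one_mul, levyTransform_add hL, ih, pow_succ]

lemma measurable_prod_indicator {Ω : Type*} {m : MeasurableSpace Ω} {d : ℕ} {X : ℝ≥0 → Ω → Fin d}
    (hX : ∀ t, Measurable (X t)) (t : ℕ → ℝ≥0) (s : ℕ → Fin d) (n : ℕ) : Measurable fun ω =>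
      ∏ j ∈ Finset.range n, ((if X (t j) ω = s j then (1 : ℂ) else 0) *
        (if X (t (j + 1)) ω = s (j + 1) then 1 else 0)) := by
  have h : ∀ (t : ℝ≥0) (k : Fin d), Measurable fun ω => if X t ω = k then (1 : ℂ) else 0 :=
    fun t k => (measurable_of_finite fun x : Fin d => if x = k then (1 : ℂ) else 0).comp (hX t)
  exact Finset.measurable_fun_prod _ fun j _ => (h _ _).mul (h _ _)

namespace Model

variable {Ω : Type*} [MeasurableSpace Ω] {P : Measure Ω} {d : ℕ} (M : Model P d)

/-- The transform of the level increment over a time step of length `ε` from state `k` to `l`. -/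
def stepWeight (ζ : ℂ) (ε : ℝ≥0) (k l : Fin d) : ℂ :=
  M.markTransform k l ζ * levyTransform P (M.levy l) ζ ε

/-- Collecting equal factors: the exponent of a mark transform counts the steps with given
endpoints, and the Lévy factors combine into the number of steps ending in `k` times `ε`. This is
the weight of the discretised clocks with the right-endpoint rule. -/
lemma prod_stepWeight [IsProbabilityMeasure P] (ζ : ℂ) (ε : ℝ≥0) (x : ℕ → Fin d) (N : ℕ) :
    ∏ r ∈ Finset.range N, M.stepWeight ζ ε (x r) (x (r + 1)) =
      M.weight ζ 0 (fun k => (∑ r ∈ Finset.range N, if x (r + 1) = k then 1 else 0 : ℕ) * ε) 0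
        fun k l => ∑ r ∈ Finset.range N, if x r = k ∧ x (r + 1) = l then 1 else 0 := by
  simp only [weight, stepWeight, Finset.prod_mul_distrib, Pi.zero_apply, tsub_zero]
  rw [mul_comm]
  congr 1
  · simp_rw [levyTransform_nat_mul (M.isLevy _), ← Finset.prod_pow_eq_pow_sum]
    rw [Finset.prod_comm]
    refine Finset.prod_congr rfl fun r _ => ?_
    rw [Finset.prod_eq_single (x (r + 1)) (fun k _ hk => by simp [hk.symm]) (by simp)]
    simp
  · rw [prod_erase_eq fun k => by rw [M.markTransform_diag, one_pow]]
    simp_rw [← Finset.prod_pow_eq_pow_sum]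
    symm
    calc _ = ∏ k, ∏ r ∈ Finset.range N, ∏ l, M.markTransform k l ζ ^
          (if x r = k ∧ x (r + 1) = l then 1 else 0) :=
        Finset.prod_congr rfl fun k _ => Finset.prod_comm
      _ = ∏ r ∈ Finset.range N, ∏ k, ∏ l, M.markTransform k l ζ ^
          (if x r = k ∧ x (r + 1) = l then 1 else 0) := Finset.prod_comm
      _ = _ := Finset.prod_congr rfl fun r _ => ?_
    rw [Finset.prod_eq_single (x r) (fun k _ hk => by simp [hk.symm]) (by simp),
      Finset.prod_eq_single (x (r + 1)) (fun k _ hk => by simp [hk.symm]) (by simp)]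
    simp

lemma norm_prod_stepWeight_le [IsProbabilityMeasure P] {ζ : ℂ} (hζ : ζ.re ≤ 0) (h : ℝ≥0) :
    ∃ B : ℝ, ∀ (x : ℕ → Fin d) (N : ℕ),
      ‖∏ r ∈ Finset.range N, M.stepWeight ζ (h / N) (x r) (x (r + 1))‖ ≤ B := by
  obtain ⟨B, hB⟩ := M.exists_norm_weight_le hζ h
  refine ⟨B, fun x N => ?_⟩
  rw [prod_stepWeight]
  refine hB _ _ _ _ fun k => ?_
  rw [Pi.zero_apply, tsub_zero]
  rcases Nat.eq_zero_or_pos N with rfl | hN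
  · simp
  have h1 : (∑ r ∈ Finset.range N, if x (r + 1) = k then 1 else 0 : ℕ) ≤ N := by
    refine (Finset.sum_le_card_nsmul _ _ 1 fun r _ => ?_).trans (by simp)
    split_ifs <;> simp
  calc _ ≤ (N : ℝ≥0) * (h / N) := by gcongr
    _ = h := mul_div_cancel₀ _ (Nat.cast_ne_zero.2 hN.ne')

/-- Transition counts on the mesh are eventually exact, and discretised occupation times converge,
so continuity of the Lévy transforms gives the limit. -/
lemma tendsto_prod_stepWeight [IsProbabilityMeasure P] (i : Fin d) {ζ : ℂ} (hζ : ζ.re ≤ 0)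
    (h : ℝ≥0) (j : ℕ) (ω : Ω) :
    Filter.Tendsto (fun N : ℕ => ∏ r ∈ Finset.range N, M.stepWeight ζ (h / N)
        (M.J i ((j * N + r : ℕ) * (h / N)) ω) (M.J i ((j * N + r + 1 : ℕ) * (h / N)) ω))
      Filter.atTop (𝓝 (M.pathWeight i ζ (j * h) ((j + 1 : ℕ) * h) ω)) := by
  have hc := (M.chain i).cadlag ω
  have hjh : (j : ℝ≥0) * h ≤ (j + 1 : ℕ) * h := by gcongr; simp
  have hdiff : ((j + 1 : ℕ) : ℝ≥0) * h - j * h = h := by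
    rw [Nat.cast_add, Nat.cast_one, add_mul, one_mul, add_tsub_cancel_left]
  set w : ℝ≥0 → Fin d := fun s => M.J i s ω
  set p := meshPoint (j * h) ((j + 1 : ℕ) * h)
  have hlim : Filter.Tendsto (fun N : ℕ => (∏ k, levyTransform P (M.levy k) ζ
      ((∑ r ∈ Finset.range N, if w (p N (r + 1)) = k then 1 else 0 : ℕ) * (h / N))) *
      ∏ k, ∏ l ∈ Finset.univ.erase k, M.markTransform k l ζ ^
        (transitions w k l ((j + 1 : ℕ) * h) - transitions w k l (j * h)))
      Filter.atTop (𝓝 (M.pathWeight i ζ (j * h) ((j + 1 : ℕ) * h) ω)) := by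
    refine Filter.Tendsto.mul_const _ (tendsto_finsetProd _ fun k _ => ?_)
    have := hc.tendsto_occupation hjh k
    rw [hdiff] at this
    exact ((continuous_levyTransform (M.isLevy k) hζ).tendsto _).comp this
  refine hlim.congr' ?_
  filter_upwards [hc.eventually_transitions_eq hjh, Filter.eventually_ne_atTop 0] with N hN hN0
  have hp : ∀ r, p N r = (j * N + r : ℕ) * (h / N) := fun r => meshPoint_block h j N r hN0
  have := M.prod_stepWeight ζ (h / N) (fun r => w (p N r)) N
  simp only [hp, ← add_assoc] at this
  change _ = ∏ r ∈ Finset.range N, M.stepWeight ζ (h / N) (w ((j * N + r : ℕ) * (h / N)))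
    (w ((j * N + r + 1 : ℕ) * (h / N)))
  rw [this, weight]
  simp only [hp, Pi.zero_apply, tsub_zero, ← add_assoc]
  congr 1
  refine Finset.prod_congr rfl fun k _ => Finset.prod_congr rfl fun l hl => ?_
  rw [hN k l (Finset.ne_of_mem_erase hl).symm, Nat.add_sub_cancel_left]
  simp only [show ∀ r, meshPoint (j * h) ((j + 1 : ℕ) * h) N r = (j * N + r : ℕ) * (h / N) from hp,
    ← add_assoc]

/-- The transform of the increment of the level over a time step from state `k` to `l`. -/
def transform (ζ : ℂ) (h : ℝ≥0) (k l : Fin d) : ℂ :=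
  ∫ ω, Complex.exp (ζ * (M.Y k h ω : ℝ)) * (if M.J k h ω = l then 1 else 0) ∂P

/-- Conditioning on the chain leaves an integrand that is the pointwise limit of bounded mesh
products. By the block formula their expectations are products of entries of matrix powers.
Dominated convergence identifies the limit without naming it. -/
lemma integral_prod_transform_aux [IsProbabilityMeasure P] (n : ℕ) {ζ : ℕ → ℂ}
    (hζ : ∀ j, (ζ j).re ≤ 0) (h : ℝ≥0) {s : ℕ → Fin d} {i : Fin d} (hs : s 0 = i) :
    Integrable (fun ω => (∏ j ∈ Finset.range n, ((if M.J i (j * h) ω = s j then 1 else 0) *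
        (if M.J i ((j + 1 : ℕ) * h) ω = s (j + 1) then 1 else 0))) *
        ∏ j ∈ Finset.range n, Complex.exp
          (ζ j * ((M.Y i ((j + 1 : ℕ) * h) ω - M.Y i (j * h) ω : ℝ) : ℂ))) P ∧
    Filter.Tendsto (fun N : ℕ => ∏ j ∈ Finset.range n,
        (IsMarkovChainFrom.weightedStep M.Q (h / N) (M.stepWeight (ζ j) (h / N)) ^ N)
          (s j) (s (j + 1))) Filter.atTop
      (𝓝 (∫ ω, (∏ j ∈ Finset.range n, ((if M.J i (j * h) ω = s j then 1 else 0) *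
        (if M.J i ((j + 1 : ℕ) * h) ω = s (j + 1) then 1 else 0))) *
        ∏ j ∈ Finset.range n, Complex.exp
          (ζ j * ((M.Y i ((j + 1 : ℕ) * h) ω - M.Y i (j * h) ω : ℝ) : ℂ)) ∂P)) := by
  have hmono : Monotone fun j : ℕ => (j : ℝ≥0) * h := fun a b hab => by
    beta_reduce; gcongr
  have hJ : ∀ t, Measurable (M.J i t) := (M.chain i).measurable
  have hΓ1 : ∀ ω, ‖∏ j ∈ Finset.range n, ((if M.J i (j * h) ω = s j then (1 : ℂ) else 0) *
        (if M.J i ((j + 1 : ℕ) * h) ω = s (j + 1) then 1 else 0))‖ ≤ 1 := by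
    intro ω
    rw [norm_prod]
    refine Finset.prod_le_one (fun _ _ => norm_nonneg _) fun j _ => ?_
    split_ifs <;> simp
  have hcond := M.integral_condition_chain i hmono n hζ
    (measurable_prod_indicator (M.measurable_chain_J i) (fun j => j * h) s n) hΓ1
  refine ⟨hcond.1, ?_⟩
  rw [hcond.2]
  choose B hB using fun j => M.norm_prod_stepWeight_le (hζ j) h
  set f : ℕ → Ω → ℂ := fun N ω => ∏ j ∈ Finset.range n,
    ((if M.J i ((j * N : ℕ) * (h / N)) ω = s j then 1 else 0) *
      (∏ r ∈ Finset.range N, M.stepWeight (ζ j) (h / N) (M.J i ((j * N + r : ℕ) * (h / N)) ω)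
        (M.J i ((j * N + r + 1 : ℕ) * (h / N)) ω)) *
      (if M.J i ((j * N + N : ℕ) * (h / N)) ω = s (j + 1) then 1 else 0)) with hf
  have hblocks : ∀ N, ∫ ω, f N ω ∂P = ∏ j ∈ Finset.range n,
      (IsMarkovChainFrom.weightedStep M.Q (h / N) (M.stepWeight (ζ j) (h / N)) ^ N)
        (s j) (s (j + 1)) := fun N => (M.chain i).integral_blocks (h / N) N
    (fun j => M.stepWeight (ζ j) (h / N)) s hs n
  simp_rw [← hblocks]
  have hind : ∀ (t : ℝ≥0) (k : Fin d), Measurable fun ω => if M.J i t ω = k then (1 : ℂ) else 0 :=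
    fun t k => (measurable_of_finite fun x : Fin d => if x = k then (1 : ℂ) else 0).comp (hJ t)
  have hgm : ∀ (g : Fin d → Fin d → ℂ) (a b : ℝ≥0),
      Measurable fun ω => g (M.J i a ω) (M.J i b ω) := fun g a b =>
    (measurable_of_finite fun p : Fin d × Fin d => g p.1 p.2).comp ((hJ a).prodMk (hJ b))
  refine tendsto_integral_of_dominated_convergence (fun _ => ∏ j ∈ Finset.range n, B j)
    (fun N => ?_) (integrable_const _) (fun N => Filter.Eventually.of_forall fun ω => ?_)
    (Filter.Eventually.of_forall fun ω => ?_)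
  · refine (Finset.measurable_fun_prod _ fun j _ => ((hind _ _).mul
      (Finset.measurable_fun_prod _ fun r _ => hgm (M.stepWeight (ζ j) (h / N)) _ _)).mul (hind _ _)).aestronglyMeasurable
  · simp only [hf]
    rw [norm_prod]
    refine Finset.prod_le_prod (fun _ _ => norm_nonneg _) fun j _ => ?_
    have h1 := hB j (fun r => M.J i ((j * N + r : ℕ) * (h / N)) ω) N
    simp only [← add_assoc] at h1
    rw [norm_mul, norm_mul]
    refine (mul_le_of_le_one_right (by positivity) (by split_ifs <;> simp)).trans
      ((mul_le_of_le_one_left (norm_nonneg _) (by split_ifs <;> simp)).trans h1)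
  · rw [← Finset.prod_mul_distrib]
    refine tendsto_finsetProd _ fun j _ => ?_
    rw [mul_right_comm]
    have h1 := (M.tendsto_prod_stepWeight i (hζ j) h j ω).const_mul
      (if M.J i (j * h) ω = s j then (1 : ℂ) else 0)
    have h2 := h1.mul_const (if M.J i ((j + 1 : ℕ) * h) ω = s (j + 1) then (1 : ℂ) else 0)
    refine h2.congr' ?_
    filter_upwards [Filter.eventually_ne_atTop 0] with N hN
    have hN' : (N : ℝ≥0) ≠ 0 := Nat.cast_ne_zero.2 hN
    have e1 : ((j * N : ℕ) : ℝ≥0) * (h / N) = j * h := by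
      push_cast; rw [mul_assoc, mul_div_cancel₀ _ hN']
    have e2 : ((j * N + N : ℕ) : ℝ≥0) * (h / N) = (j + 1 : ℕ) * h := by
      rw [← Nat.succ_mul]; push_cast; rw [mul_assoc, mul_div_cancel₀ _ hN']
    rw [e1, e2]

lemma Y_zero (i : Fin d) (ω : Ω) : M.Y i 0 ω = 0 := (M.path i ω).pos_zero

lemma transform_aux [IsProbabilityMeasure P] {ζ : ℂ} (hζ : ζ.re ≤ 0) (h : ℝ≥0) (k l : Fin d) :
    Integrable (fun ω => Complex.exp (ζ * (M.Y k h ω : ℝ)) * (if M.J k h ω = l then 1 else 0)) P ∧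
    Filter.Tendsto (fun N : ℕ =>
        (IsMarkovChainFrom.weightedStep M.Q (h / N) (M.stepWeight ζ (h / N)) ^ N) k l)
      Filter.atTop (𝓝 (M.transform ζ h k l)) := by
  have := M.integral_prod_transform_aux (ζ := fun _ => ζ) 1 (fun _ => hζ) h
    (s := fun j => if j = 0 then k else l) (i := k) (by simp)
  simpa [Y_zero, (M.chain k).init, mul_comm, transform] using this

/-- The Markov additive property in terms of transforms. -/
lemma integral_prod_transform [IsProbabilityMeasure P] (n : ℕ) {ζ : ℕ → ℂ}
    (hζ : ∀ j, (ζ j).re ≤ 0) (h : ℝ≥0) (s : ℕ → Fin d) :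
    ∫ ω, (∏ j ∈ Finset.range n, ((if M.J (s 0) (j * h) ω = s j then 1 else 0) *
        (if M.J (s 0) ((j + 1 : ℕ) * h) ω = s (j + 1) then 1 else 0))) *
        ∏ j ∈ Finset.range n, Complex.exp
          (ζ j * ((M.Y (s 0) ((j + 1 : ℕ) * h) ω - M.Y (s 0) (j * h) ω : ℝ) : ℂ)) ∂P =
      ∏ j ∈ Finset.range n, M.transform (ζ j) h (s j) (s (j + 1)) :=
  -- The joint transform and the product of one-step transforms are limits of the same sequence,
  -- since the matrix expression already factorises for each `N`.
  tendsto_nhds_unique (M.integral_prod_transform_aux n hζ h rfl).2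
    (tendsto_finsetProd _ fun j _ => (M.transform_aux (hζ j) h (s j) (s (j + 1))).2)

end Model

/-! ### The free process is a Markov additive process. -/

open PathSpace

namespace Model

variable {Ω : Type*} [MeasurableSpace Ω] {P : Measure Ω} {d : ℕ} (M : Model P d)

lemma measurable_Y (i : Fin d) (t : ℝ≥0) : Measurable (M.Y i t) :=
  (measurable_pos t).comp (M.measurable_path i)

/-- Every step from `1` to `n` is the end of some factor; step `0` is covered by the initial
condition, also when `n = 0`. -/
lemma prod_indicator_eq (s : ℕ → Fin d) (h : ℝ≥0) (n : ℕ) (ω : Ω) :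
    (∏ j ∈ Finset.range n, ((if M.J (s 0) (j * h) ω = s j then (1 : ℂ) else 0) *
        (if M.J (s 0) ((j + 1 : ℕ) * h) ω = s (j + 1) then 1 else 0))) =
      {ω | ∀ m ≤ n, M.J (s 0) (m * h) ω = s m}.indicator (fun _ => 1) ω := by
  classical
  by_cases hω : ∀ m ≤ n, M.J (s 0) (m * h) ω = s m
  · rw [Set.indicator_of_mem (show ω ∈ {ω | ∀ m ≤ n, M.J (s 0) (m * h) ω = s m} from hω)]
    refine Finset.prod_eq_one fun j hj => ?_
    have := Finset.mem_range.1 hj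
    rw [if_pos (hω j this.le), if_pos (hω (j + 1) this), mul_one]
  · rw [Set.indicator_of_notMem (show ω ∉ {ω | ∀ m ≤ n, M.J (s 0) (m * h) ω = s m} from hω)]
    push Not at hω
    obtain ⟨m, hm, hne⟩ := hω
    rcases m with - | m
    · simp [(M.chain (s 0)).init] at hne
    · exact Finset.prod_eq_zero (Finset.mem_range.2 hm) (by rw [if_neg hne, mul_zero])

/-- The laws of the processes started in the different states form a Markov additive process. -/
theorem isMAP [IsProbabilityMeasure P] : IsMAP fun i => P.map (M.path i) where
  prob i := Measure.isProbabilityMeasure_map (M.measurable_path i).aemeasurable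
  rect h n s C hC := by
    classical
    set S : Set Ω := {ω | ∀ m ≤ n, M.J (s 0) (m * h) ω = s m} with hS
    have hSm : MeasurableSet S := by
      rw [show S = ⋂ m : ℕ, ⋂ _ : m ≤ n, M.J (s 0) (m * h) ⁻¹' {s m} by ext; simp [hS]]
      exact MeasurableSet.iInter fun m => MeasurableSet.iInter fun _ =>
        (M.chain (s 0)).measurable _ (measurableSet_singleton _)
    set Δ : Ω → Fin n → ℝ := fun ω j => M.Y (s 0) ((j + 1 : ℕ) * h) ω - M.Y (s 0) (j * h) ω with hΔ
    have hΔm : Measurable Δ := measurable_pi_lambda _ fun j =>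
      (M.measurable_Y _ _).sub (M.measurable_Y _ _)
    set A : Fin n → Set Ω := fun j => {ω | M.J (s j) h ω = s (j + 1)} with hA
    have hAm : ∀ j, MeasurableSet (A j) := fun j =>
      (M.chain (s j)).measurable h (measurableSet_singleton _)
    set ν : Measure (Fin n → ℝ) := (P.restrict S).map Δ
    set μ : Fin n → Measure ℝ := fun j => (P.restrict (A j)).map (M.Y (s j) h)
    have hν : IsFiniteMeasure ν := Measure.isFiniteMeasure_map _ _
    have hμ : ∀ j, IsFiniteMeasure (μ j) := fun j => Measure.isFiniteMeasure_map _ _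
    -- The increments, restricted to a prescribed state history, have a product law because their
    -- characteristic function factorises. The arguments `θ j * I` have real part zero and are thus
    -- admissible in the transform identity.
    have hpi : ν = Measure.pi μ := by
      refine charFun_eq_pi_iff.1 fun θ => ?_
      have h1 := M.integral_prod_transform n (ζ := fun j => if hj : j < n then θ ⟨j, hj⟩ * Complex.I
        else 0) (fun j => by split_ifs <;> simp) h s
      simp_rw [M.prod_indicator_eq s h n] at h1
      simp only [Finset.prod_range, Fin.is_lt, dif_pos, Fin.eta] at h1
      have h2 : ∀ j, charFun (μ j) (θ j) = M.transform (θ j * Complex.I) h (s j) (s (j + 1)) := by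
        intro j
        rw [charFun_apply_real, integral_map (M.measurable_Y _ _).aemeasurable
          (by fun_prop), ← integral_indicator (hAm j), transform]
        refine integral_congr_ae (Filter.Eventually.of_forall fun ω => ?_)
        simp only [Set.indicator_apply, hA, Set.mem_ofPred_eq]
        split_ifs
        · rw [mul_one]; congr 1; ring
        · rw [mul_zero]
      simp_rw [h2]
      rw [← h1, charFun_apply, integral_map (by fun_prop) (by fun_prop),
        integral_map hΔm.aemeasurable (by fun_prop), ← integral_indicator hSm]
      refine integral_congr_ae (Filter.Eventually.of_forall fun ω => ?_)
      simp only [Set.indicator_apply]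
      split_ifs
      · rw [one_mul, ← Complex.exp_sum]
        congr 1
        rw [PiLp.inner_apply, Complex.ofReal_sum, Finset.sum_mul]
        refine Finset.sum_congr rfl fun j _ => ?_
        simp [hΔ]
        ring
      · rw [zero_mul]
    have h1 : ν (Set.univ.pi fun j => C j) = ∏ j : Fin n, μ j (C j) := by
      rw [hpi, Measure.pi_pi]
    rw [Measure.map_apply hΔm (MeasurableSet.univ_pi fun j => hC j),
      Measure.restrict_apply' hSm] at h1
    rw [Measure.map_apply (M.measurable_path _) (measurableSet_gridRect h n s hC),
      Finset.prod_range]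
    refine Eq.trans ?_ (h1.trans (Finset.prod_congr rfl fun j _ => ?_))
    · congr 1
      ext ω
      simp only [gridRect, Set.mem_preimage, Set.mem_ofPred_eq, Set.mem_inter_iff, Set.mem_pi,
        Set.mem_univ, true_implies, pos_path, st_path, hΔ, hS]
      rw [and_comm]
      refine and_congr_left fun _ => ⟨fun h m => h m m.2, fun h m hm => h ⟨m, hm⟩⟩
    · have hms : MeasurableSet {w : PathSpace d | w.pos h ∈ C j ∧ w.st h = s (j + 1)} :=
        (measurable_pos h (hC j)).inter (measurable_st h (measurableSet_singleton _))
      rw [Measure.map_apply (M.measurable_Y _ _) (hC j), Measure.restrict_apply' (hAm j),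
        Measure.map_apply (M.measurable_path _) hms]
      rfl

end Model

/-! ### Powers of near-identity matrices and the formula `exp(tF(α))`. -/

open PathSpace

lemma norm_pow_sub_pow_le {𝔸 : Type*} [NormedRing 𝔸] [NormOneClass 𝔸] {a b : 𝔸} {m : ℝ}
    (ha : ‖a‖ ≤ m) (hb : ‖b‖ ≤ m) (hm : 1 ≤ m) (n : ℕ) :
    ‖a ^ n - b ^ n‖ ≤ n * m ^ n * ‖a - b‖ := by
  have hm0 : 0 ≤ m := zero_le_one.trans hm
  induction n with
  | zero => simp
  | succ n ih =>
    have h1 : a ^ (n + 1) - b ^ (n + 1) = (a ^ n - b ^ n) * a + b ^ n * (a - b) := by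
      rw [pow_succ, pow_succ]; noncomm_ring
    have hbn : ‖b ^ n‖ ≤ m ^ n := (norm_pow_le b n).trans (pow_le_pow_left₀ (norm_nonneg _) hb n)
    have hmn : m ^ n ≤ m ^ (n + 1) := pow_le_pow_right₀ hm (Nat.le_succ n)
    calc ‖a ^ (n + 1) - b ^ (n + 1)‖ ≤ ‖a ^ n - b ^ n‖ * ‖a‖ + ‖b ^ n‖ * ‖a - b‖ := by
          rw [h1]
          exact (norm_add_le _ _).trans (add_le_add (norm_mul_le _ _) (norm_mul_le _ _))
      _ ≤ (n * m ^ n * ‖a - b‖) * m + m ^ (n + 1) * ‖a - b‖ := by gcongr; exact hbn.trans hmn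
      _ = _ := by push_cast; ring

/-- `A (t / N)` and `exp((t / N) F)` differ by `o(1 / N)`, and telescoping the `N`-th powers
multiplies this by `N` times a bounded factor. -/
lemma tendsto_pow_exp {𝔸 : Type*} [NormedRing 𝔸] [NormedAlgebra ℝ 𝔸] [CompleteSpace 𝔸]
    [NormOneClass 𝔸] {A : ℝ → 𝔸} {F : 𝔸}
    (hA : (fun h => A h - NormedSpace.exp (h • F)) =o[𝓝 0] fun h => h) (t : ℝ) :
    Filter.Tendsto (fun N : ℕ => A (t / N) ^ N) Filter.atTop (𝓝 (NormedSpace.exp (t • F))) := by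
  let _ : NormedAlgebra ℚ 𝔸 := NormedAlgebra.restrictScalars ℚ ℝ 𝔸
  have hlim : Filter.Tendsto (fun N : ℕ => t / (N : ℝ)) Filter.atTop (𝓝 0) :=
    tendsto_const_div_atTop_nhds_zero_nat t
  have hE : (fun h : ℝ => NormedSpace.exp (h • F) - 1) =O[𝓝 0] fun h => h := by
    have := (hasDerivAt_exp_smul_const (𝕂 := ℝ) F 0).isBigO_sub
    simpa using this
  obtain ⟨C, hC0, hC⟩ := hE.exists_pos
  have hC1 := hC.bound
  refine tendsto_iff_norm_sub_tendsto_zero.2 (squeeze_zero' (Filter.Eventually.of_forall fun N =>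
    norm_nonneg _) (g := fun N : ℕ => Real.exp (|t| * (C + 1)) *
      (N * ‖A (t / N) - NormedSpace.exp ((t / N) • F)‖)) ?_ ?_)
  · filter_upwards [hlim.eventually hC1, hlim.eventually (hA.bound one_pos),
      Filter.eventually_ne_atTop 0] with N h1 h2 hN
    have hN' : (N : ℝ) ≠ 0 := Nat.cast_ne_zero.2 hN
    set e := NormedSpace.exp ((t / N) • F)
    -- `C` bounds `exp(hF) - 1` to first order and the extra `1` absorbs the difference to `A`, so
    -- `m` dominates both norms. Its `N`-th power does not depend on `N`.
    set m := Real.exp (|t / N| * (C + 1))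
    have hexp : 1 + |t / N| * (C + 1) ≤ m := by
      rw [add_comm]; exact Real.add_one_le_exp _
    rw [Real.norm_eq_abs] at h1 h2
    have habs := abs_nonneg (t / N)
    have he : ‖e‖ ≤ 1 + C * |t / N| := by
      calc ‖e‖ = ‖1 + (e - 1)‖ := by rw [add_sub_cancel]
        _ ≤ ‖(1 : 𝔸)‖ + ‖e - 1‖ := norm_add_le _ _
        _ ≤ _ := by rw [norm_one]; gcongr
    have ha : ‖A (t / N)‖ ≤ m := by
      calc ‖A (t / N)‖ = ‖e + (A (t / N) - e)‖ := by rw [add_sub_cancel]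
        _ ≤ ‖e‖ + ‖A (t / N) - e‖ := norm_add_le _ _
        _ ≤ m := by linarith
    have hpow : m ^ N = Real.exp (|t| * (C + 1)) := by
      rw [← Real.exp_nat_mul, ← mul_assoc, abs_div, Nat.abs_cast, mul_div_cancel₀ _ hN']
    have hpow2 : NormedSpace.exp (t • F) = e ^ N := by
      rw [← NormedSpace.exp_nsmul, ← Nat.cast_smul_eq_nsmul ℝ, smul_smul, mul_div_cancel₀ _ hN']
    rw [hpow2]
    refine (norm_pow_sub_pow_le ha (by linarith) (by nlinarith) N).trans_eq ?_
    rw [hpow]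
    ring
  · rw [← mul_zero (Real.exp (|t| * (C + 1)))]
    refine Filter.Tendsto.const_mul _ ?_
    have h1 := (hA.comp_tendsto hlim).norm_left
    have h2 : (fun N : ℕ => (N : ℝ) * ‖A (t / N) - NormedSpace.exp ((t / N) • F)‖)
        =o[Filter.atTop] fun _ : ℕ => t := by
      refine ((Asymptotics.isBigO_refl (fun N : ℕ => (N : ℝ)) Filter.atTop).mul_isLittleO
        h1).trans_isBigO (Asymptotics.IsBigO.of_bound 1 ?_)
      filter_upwards [Filter.eventually_ne_atTop 0] with N hN
      rw [Function.comp_apply, mul_div_cancel₀ _ (Nat.cast_ne_zero.2 hN), one_mul]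
    exact (Asymptotics.isLittleO_one_iff ℝ).1 (h2.trans_isBigO (Asymptotics.isBigO_const_one ℝ t _))

open scoped Matrix.Norms.Operator in
lemma tendsto_matrix_pow_exp {d : ℕ} {A : ℝ → Matrix (Fin d) (Fin d) ℝ}
    {F : Matrix (Fin d) (Fin d) ℝ} (hA0 : A 0 = 1)
    (hA : ∀ k l, HasDerivAt (fun h => A h k l) (F k l) 0) (t : ℝ) :
    Filter.Tendsto (fun N : ℕ => A (t / N) ^ N) Filter.atTop (𝓝 (NormedSpace.exp (t • F))) := by
  -- For `d = 0` the identity matrix has norm `0`, and the general statement does not apply.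
  rcases isEmpty_or_nonempty (Fin d) with hd | hd
  · exact tendsto_const_nhds.congr fun N => Subsingleton.elim _ _
  refine tendsto_pow_exp ?_ t
  have hE : ∀ k l, HasDerivAt (fun h : ℝ => NormedSpace.exp (h • F) k l) (F k l) 0 := by
    intro k l
    have h1 := hasDerivAt_exp_smul_const (𝕂 := ℝ) F 0
    rw [zero_smul, NormedSpace.exp_zero, one_mul] at h1
    exact (LinearMap.toContinuousLinearMap (Matrix.entryLinearMap ℝ ℝ k l)).hasFDerivAt.comp_hasDerivAt
      0 h1
  have hent : ∀ k l, (fun h => (A h - NormedSpace.exp (h • F)) k l) =o[𝓝 0] fun h => h := by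
    intro k l
    have := ((hA k l).sub (hE k l)).isLittleO
    simpa [hA0] using this
  refine Asymptotics.IsBigO.trans_isLittleO (g := fun h => ∑ k, ∑ l,
    ‖(A h - NormedSpace.exp (h • F)) k l‖) (Asymptotics.IsBigO.of_bound 1
      (Filter.Eventually.of_forall fun h => ?_))
    (Asymptotics.IsLittleO.fun_sum fun k _ => Asymptotics.IsLittleO.fun_sum fun l _ => (hent k l).norm_left)
  rw [one_mul, Matrix.linfty_opNorm_def, Real.norm_of_nonneg (by positivity)]
  have : (Finset.univ.sup fun i => ∑ j, ‖(A h - NormedSpace.exp (h • F)) i j‖₊) ≤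
      ∑ i, ∑ j, ‖(A h - NormedSpace.exp (h • F)) i j‖₊ :=
    Finset.sup_le fun i _ => Finset.single_le_sum
      (f := fun i => ∑ j, ‖(A h - NormedSpace.exp (h • F)) i j‖₊) (fun _ _ => zero_le)
      (Finset.mem_univ i)
  exact (NNReal.coe_le_coe.2 this).trans_eq (by simp)

namespace Model

variable {Ω : Type*} [MeasurableSpace Ω] {P : Measure Ω} {d : ℕ} (M : Model P d)

lemma levyTransform_neg_eq [IsProbabilityMeasure P] {α : ℝ} (hα : 0 ≤ α) (k : Fin d) (t : ℝ≥0) :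
    levyTransform P (M.levy k) (-α : ℝ) t = (Real.exp (t * M.laplaceExponent k α) : ℝ) := by
  rw [levyTransform_neg_real, integral_exp_neg_levy (M.isLevy k) hα]
  rfl

lemma markTransform_neg_eq (α : ℝ) (k l : Fin d) :
    M.markTransform k l (-α : ℝ) = (M.markLST k l α : ℝ) := by
  rw [markTransform, markLST, ← integral_complex_ofReal]
  congr 1
  funext ω
  push_cast
  rfl

lemma markLST_diag [IsProbabilityMeasure P] (α : ℝ) (k : Fin d) : M.markLST k k α = 1 := by
  simp [markLST, M.mark_diag]

open scoped Matrix.Norms.Operator in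
-- The weighted one-step matrix is the identity at `h = 0` and has derivative `F(α)` there, so its
-- powers converge to the exponential. They also converge to the transform.
lemma transform_neg_eq [IsProbabilityMeasure P] {α : ℝ} (hα : 0 ≤ α) (t : ℝ≥0) (k l : Fin d) :
    M.transform (-α : ℝ) t k l = ((NormedSpace.exp ((t : ℝ) • M.F α)) k l : ℝ) := by
  set A : ℝ → Matrix (Fin d) (Fin d) ℝ := fun h => Matrix.of fun k l =>
    (NormedSpace.exp (h • M.Q) : Matrix (Fin d) (Fin d) ℝ) k l *
      (M.markLST k l α * Real.exp (h * M.laplaceExponent l α)) with hA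
  have hA0 : A 0 = 1 := by
    ext k l
    simp only [hA, Matrix.of_apply, zero_smul, NormedSpace.exp_zero, zero_mul, Real.exp_zero,
      mul_one, Matrix.one_apply]
    split_ifs with h
    · rw [h, M.markLST_diag, one_mul]
    · rw [zero_mul]
  have hAd : ∀ k l, HasDerivAt (fun h => A h k l) (M.F α k l) 0 := by
    intro k l
    have h1 := hasDerivAt_exp_smul_const (𝕂 := ℝ) M.Q 0
    rw [zero_smul, NormedSpace.exp_zero, one_mul] at h1
    have h2 : HasDerivAt (fun h : ℝ => (NormedSpace.exp (h • M.Q) : Matrix (Fin d) (Fin d) ℝ) k l)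
        (M.Q k l) 0 :=
      (LinearMap.toContinuousLinearMap
        (Matrix.entryLinearMap ℝ ℝ k l)).hasFDerivAt.comp_hasDerivAt 0 h1
    have h3 : HasDerivAt (fun h : ℝ => Real.exp (h * M.laplaceExponent l α))
        (M.laplaceExponent l α) 0 := by
      simpa using ((hasDerivAt_id (0 : ℝ)).mul_const (M.laplaceExponent l α)).exp
    -- At `h = 0` the transition matrix is the identity, so the Laplace exponent survives only on
    -- the diagonal, where the mark transform is `1`.
    refine (h2.mul (h3.const_mul (M.markLST k l α))).congr_deriv ?_
    simp only [F, Matrix.of_apply, zero_smul, NormedSpace.exp_zero, zero_mul, Real.exp_zero, mul_one,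
      Matrix.one_apply]
    split_ifs with h
    · subst h; rw [M.markLST_diag, one_mul, one_mul]
    · rw [zero_mul]
  have hlim := tendsto_matrix_pow_exp hA0 hAd t
  have hent : Filter.Tendsto (fun N : ℕ => ((A (t / N) ^ N) k l : ℂ)) Filter.atTop
      (𝓝 ((NormedSpace.exp ((t : ℝ) • M.F α)) k l : ℝ)) :=
    (Complex.continuous_ofReal.tendsto _).comp
      (((LinearMap.toContinuousLinearMap
        (Matrix.entryLinearMap ℝ ℝ k l)).continuous.tendsto _).comp hlim)
  refine tendsto_nhds_unique (M.transform_aux (ζ := (-α : ℝ)) (by simpa using hα) t k l).2 ?_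
  refine hent.congr fun N => ?_
  have hmap : IsMarkovChainFrom.weightedStep M.Q (t / N) (M.stepWeight (-α : ℝ) (t / N)) =
      (A (t / N)).map Complex.ofRealHom := by
    ext a b
    simp only [IsMarkovChainFrom.weightedStep, stepWeight, Matrix.of_apply, Matrix.map_apply, hA,
      M.levyTransform_neg_eq hα, M.markTransform_neg_eq, Complex.ofRealHom_eq_coe]
    push_cast
    rfl
  rw [hmap, ← Matrix.map_pow]
  rfl

lemma integrable_exp_neg_Y [IsProbabilityMeasure P] {α : ℝ} (hα : 0 ≤ α) (t : ℝ≥0) (k : Fin d) :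
    Integrable (fun ω => Real.exp (-α * M.Y k t ω)) P := by
  have h : ∀ l, Integrable (fun ω => Real.exp (-α * M.Y k t ω) *
      (if M.J k t ω = l then 1 else 0)) P := by
    intro l
    have := (M.transform_aux (ζ := (-α : ℝ)) (by simpa using hα) t k l).1.re
    refine this.congr (Filter.Eventually.of_forall fun ω => ?_)
    have e : Complex.exp ((-α : ℝ) * (M.Y k t ω : ℝ)) * (if M.J k t ω = l then 1 else 0) =
        ((Real.exp (-α * M.Y k t ω) * (if M.J k t ω = l then 1 else 0) : ℝ) : ℂ) := by
      split_ifs <;> simp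
    beta_reduce
    rw [e]
    exact Complex.ofReal_re _
  have hsum := integrable_finsetSum Finset.univ fun l _ => h l
  refine hsum.congr (Filter.Eventually.of_forall fun ω => ?_)
  simp

/-- The Laplace transform of the level, jointly with the background state. -/
lemma integral_exp_neg_Y [IsProbabilityMeasure P] {α : ℝ} (hα : 0 ≤ α) (t : ℝ≥0) (k l : Fin d) :
    ∫ ω, Real.exp (-α * M.Y k t ω) * (if M.J k t ω = l then 1 else 0) ∂P =
      (NormedSpace.exp ((t : ℝ) • M.F α)) k l := by
  have h := M.transform_neg_eq hα t k l
  rw [transform] at h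
  have : ∀ ω, Complex.exp ((-α : ℝ) * (M.Y k t ω : ℝ)) * (if M.J k t ω = l then 1 else 0) =
      ((Real.exp (-α * M.Y k t ω) * (if M.J k t ω = l then 1 else 0) : ℝ) : ℂ) := fun ω => by
    split_ifs <;> simp
  simp_rw [this] at h
  rw [integral_complex_ofReal] at h
  exact_mod_cast h

end Model

/-! ### Exit from an interval and the decomposition of the semigroup. -/

open PathSpace

/-- The levels above `b`. -/
def upSet (b : ℝ) : Set ℝ := {y | b < y}

/-- The levels outside `[-a, b]`. -/
def exitSet (a b : ℝ) : Set ℝ := lowSet a ∪ upSet b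

lemma isOpen_upSet (b : ℝ) : IsOpen (upSet b) := isOpen_lt continuous_const continuous_id

lemma isOpen_exitSet (a b : ℝ) : IsOpen (exitSet a b) := (isOpen_lowSet a).union (isOpen_upSet b)

lemma hit_union (A B : Set ℝ) (f : ℝ≥0 → ℝ) : hit (A ∪ B) f = min (hit A f) (hit B f) := by
  refine le_antisymm (le_min ?_ ?_) ?_
  · exact le_hit_iff.2 fun t ht => hit_le (Or.inl ht)
  · exact le_hit_iff.2 fun t ht => hit_le (Or.inr ht)
  · exact le_hit_iff.2 fun t ht => ht.elim (fun h => (min_le_left _ _).trans (hit_le h))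
      fun h => (min_le_right _ _).trans (hit_le h)

section Exit

variable {d : ℕ} {a b : ℝ} {w : PathSpace d}

/-- The bound includes the passage time itself, again because jumps are upwards. -/
lemma neg_le_pos_of_le_hit (ha : 0 ≤ a) {t : ℝ≥0} (h : t ≤ hit (lowSet a) w.pos) :
    -a ≤ w.pos t := by
  rcases eq_or_ne t 0 with rfl | h0
  · rw [w.pos_zero]; linarith
  · refine w.le_pos_of_forall_lt (r := 0) (pos_iff_ne_zero.2 h0) fun s _ hs => ?_
    have : w.pos s ∉ lowSet a := notMem_of_lt_hit (lt_of_lt_of_le (by exact_mod_cast hs) h)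
    simp only [lowSet, Set.mem_ofPred_eq, not_lt] at this
    linarith

lemma le_pos_hit_upSet (h : hit (upSet b) w.pos ≠ ∞) :
    b ≤ w.pos (hit (upSet b) w.pos).toNNReal := by
  have h1 := mem_closure_hit (isOpen_upSet b) w.rightCts_pos h
  have h2 : closure (upSet b) ⊆ Set.Ici b := closure_minimal (fun y (hy : b < y) => hy.le) isClosed_Ici
  exact h2 h1

/-- The side of the exit can be read off from the level: it is `-a` below and at least `b > -a`
above. Hence the event that the lower boundary comes first is a function of the exit data, as the
strong Markov property requires. -/
lemma hitSet_exitSet_inter_eq (ha : 0 ≤ a) (hab : 0 < a + b) (k : Fin d) :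
    hitSet (exitSet a b) k ∩ {w | w.pos (hit (exitSet a b) w.pos).toNNReal = -a} =
      hitSet (lowSet a) k ∩ {w | hit (lowSet a) w.pos ≤ hit (upSet b) w.pos} := by
  ext w
  simp only [hitSet, exitSet, hit_union, Set.mem_inter_iff, Set.mem_ofPred_eq]
  rcases le_or_gt (hit (lowSet a) w.pos) (hit (upSet b) w.pos) with h | h
  · rw [min_eq_left h]
    exact ⟨fun h1 => ⟨h1.1, h⟩, fun h1 => ⟨h1.1, pos_hit_lowSet ha h1.1.1⟩⟩
  · rw [min_eq_right h.le]
    refine ⟨fun h1 => ?_, fun h1 => absurd h1.2 (not_le.2 h)⟩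
    have := le_pos_hit_upSet h1.1.1
    rw [h1.2] at this
    linarith

lemma hitSet_exitSet_diff_eq (ha : 0 ≤ a) (hab : 0 < a + b) (k : Fin d) :
    hitSet (exitSet a b) k \ {w | w.pos (hit (exitSet a b) w.pos).toNNReal = -a} =
      hitSet (upSet b) k \ {w | hit (lowSet a) w.pos ≤ hit (upSet b) w.pos} := by
  ext w
  simp only [hitSet, exitSet, hit_union, Set.mem_sdiff, Set.mem_ofPred_eq]
  rcases le_or_gt (hit (lowSet a) w.pos) (hit (upSet b) w.pos) with h | h
  · rw [min_eq_left h]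
    exact ⟨fun h1 => absurd (pos_hit_lowSet ha h1.1.1) h1.2, fun h1 => absurd h h1.2⟩
  · rw [min_eq_right h.le]
    refine ⟨fun h1 => ⟨h1.1, not_le.2 h⟩, fun h1 => ⟨h1.1, fun h2 => ?_⟩⟩
    have := le_pos_hit_upSet h1.1.1
    rw [h2] at this
    linarith

lemma hit_upSet_eq_add (hw : w.pos (hit (exitSet a b) w.pos).toNNReal = -a)
    (h : hit (exitSet a b) w.pos ≠ ∞) :
    hit (upSet b) w.pos = (hit (exitSet a b) w.pos).toNNReal +
      hit (upSet (a + b)) (shift (hit (exitSet a b) w.pos).toNNReal w).pos := by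
  rw [hit_eq_add (r := (hit (exitSet a b) w.pos).toNNReal)]
  · rw [hw]
    congr 2
    · ext y
      simp only [upSet, Set.mem_ofPred_eq]
      constructor <;> intro <;> linarith
    · funext t
      rw [pos_shift, hw]
  · intro t ht hmem
    exact notMem_of_lt_hit (by rw [← ENNReal.coe_toNNReal h]; exact_mod_cast ht)
      (show w.pos t ∈ exitSet a b from Or.inr hmem)

end Exit

namespace IsMAP

variable {d : ℕ} {μ : Fin d → Measure (PathSpace d)}

/-- The strong Markov property in integrated form. -/
lemma setIntegral_hitSet (hμ : IsMAP μ) {O : Set ℝ} (hO : IsOpen O) (i k : Fin d)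
    {G : (ℝ≥0 × ℝ) × PathSpace d → ℝ} (hG : Measurable G)
    (hGi : IntegrableOn (fun w => G (((hit O w.pos).toNNReal, w.pos (hit O w.pos).toNNReal),
      shift (hit O w.pos).toNNReal w)) (hitSet O k) (μ i)) :
    ∫ w in hitSet O k, G (((hit O w.pos).toNNReal, w.pos (hit O w.pos).toNNReal),
      shift (hit O w.pos).toNNReal w) ∂μ i =
    ∫ w in hitSet O k, ∫ w', G (((hit O w.pos).toNNReal, w.pos (hit O w.pos).toNNReal), w') ∂μ k
      ∂μ i := by
  have := hμ.prob
  have hρ : Measurable fun w : PathSpace d => (hit O w.pos).toNNReal :=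
    (measurable_hit_pos hO).ennreal_toNNReal
  have hZ : Measurable fun w : PathSpace d => ((hit O w.pos).toNNReal,
      w.pos (hit O w.pos).toNNReal) := hρ.prodMk (measurable_pos_comp hρ measurable_id)
  have hZs : Measurable fun w : PathSpace d => (((hit O w.pos).toNNReal,
      w.pos (hit O w.pos).toNNReal), shift (hit O w.pos).toNNReal w) :=
    hZ.prodMk (measurable_shift_comp hρ measurable_id)
  have hsm := hμ.strongMarkov hO i k
  have hint := (integrable_map_measure hG.aestronglyMeasurable hZs.aemeasurable).2 hGi
  have hfin := Measure.isFiniteMeasure_map ((μ i).restrict (hitSet O k))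
    fun w : PathSpace d => ((hit O w.pos).toNNReal, w.pos (hit O w.pos).toNNReal)
  rw [hsm] at hint
  rw [← integral_map hZs.aemeasurable hG.aestronglyMeasurable, hsm, integral_prod _ hint,
    integral_map hZ.aemeasurable hG.stronglyMeasurable.integral_prod_right'.aestronglyMeasurable]

end IsMAP

/-- The exponential moments of the level are given by the matrix semigroup generated by `F`. -/
structure HasLaplaceSemigroup {d : ℕ} (μ : Fin d → Measure (PathSpace d)) (α : ℝ)
    (F : Matrix (Fin d) (Fin d) ℝ) : Prop where
  integrable : ∀ i t, Integrable (fun w => Real.exp (-α * w.pos t)) (μ i)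
  integral : ∀ i j (t : ℝ≥0), ∫ w in {w | w.st t = j}, Real.exp (-α * w.pos t) ∂μ i =
    (NormedSpace.exp ((t : ℝ) • F) : Matrix (Fin d) (Fin d) ℝ) i j

/-- The transform of the level at time `t`, killed outside `[-a, b]`. -/
def killed {d : ℕ} (μ : Fin d → Measure (PathSpace d)) (α a b : ℝ) (i j : Fin d) (t : ℝ≥0) : ℝ :=
  ∫ w in {w | (t : ℝ≥0∞) ≤ hit (exitSet a b) w.pos ∧ w.st t = j}, Real.exp (-α * w.pos t) ∂μ i

/-- The paths that leave `[-a, b]` before `t`, in state `k`. -/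
def exitBefore {d : ℕ} (a b : ℝ) (k : Fin d) (t : ℝ≥0) : Set (PathSpace d) :=
  hitSet (exitSet a b) k ∩ {w | hit (exitSet a b) w.pos < t}

section Killed

variable {d : ℕ} {μ : Fin d → Measure (PathSpace d)} {α a b : ℝ} {F : Matrix (Fin d) (Fin d) ℝ}

lemma measurableSet_exitBefore (k : Fin d) (t : ℝ≥0) :
    MeasurableSet (exitBefore (d := d) a b k t) :=
  (measurableSet_hitSet (isOpen_exitSet a b) k).inter
    (measurable_hit_pos (isOpen_exitSet a b) measurableSet_Iio)

/-- Decomposition of the semigroup at the first exit from `[-a, b]`. -/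
lemma exp_eq_killed_add (hμ : IsMAP μ) (hF : HasLaplaceSemigroup μ α F) (a b : ℝ) (i j : Fin d)
    (t : ℝ≥0) :
    (NormedSpace.exp ((t : ℝ) • F) : Matrix (Fin d) (Fin d) ℝ) i j = killed μ α a b i j t +
      ∑ k, ∫ w in exitBefore a b k t, Real.exp (-α * w.pos (hit (exitSet a b) w.pos).toNNReal) *
        (NormedSpace.exp (((t - (hit (exitSet a b) w.pos).toNNReal : ℝ≥0) : ℝ) • F) :
          Matrix (Fin d) (Fin d) ℝ) k j ∂μ i := by
  classical
  have := hμ.prob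
  have hO := isOpen_exitSet a b
  set O := exitSet a b
  have hhit := measurable_hit_pos (d := d) hO
  have hst' : ∀ (t : ℝ≥0) j, MeasurableSet {w : PathSpace d | w.st t = j} := fun t j =>
    measurable_st t (measurableSet_singleton j)
  have hst := hst' t
  have hlt : MeasurableSet {w : PathSpace d | (t : ℝ≥0∞) ≤ hit O w.pos} := hhit measurableSet_Ici
  have hE := hF.integrable i t
  rw [← hF.integral i j t, ← integral_inter_add_sdiff hlt hE.integrableOn]
  congr 1
  · rw [killed]
    congr 2
    ext w
    exact and_comm
  · have hset : {w : PathSpace d | w.st t = j} \ {w | (t : ℝ≥0∞) ≤ hit O w.pos} =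
        ⋃ k, exitBefore a b k t ∩ {w | w.st t = j} := by
      ext w
      simp only [exitBefore, hitSet, Set.mem_sdiff, Set.mem_ofPred_eq, not_le, Set.mem_iUnion,
        Set.mem_inter_iff]
      constructor
      · rintro ⟨h1, h2⟩
        exact ⟨_, ⟨⟨(h2.trans_le le_top).ne, rfl⟩, h2⟩, h1⟩
      · rintro ⟨k, ⟨-, h2⟩, h1⟩
        exact ⟨h1, h2⟩
    rw [hset, integral_iUnion_fintype (fun k => (measurableSet_exitBefore k t).inter (hst j))
      _ fun k => hE.integrableOn]
    · refine Finset.sum_congr rfl fun k _ => ?_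
      -- `G` expresses the payoff at time `t` through the exit time, the exit level and the path
      -- afterwards. Integrating out the latter produces the semigroup over the remaining time.
      set G : (ℝ≥0 × ℝ) × PathSpace d → ℝ := fun p => if p.1.1 < t ∧ p.2.st (t - p.1.1) = j then
        Real.exp (-α * p.1.2) * Real.exp (-α * p.2.pos (t - p.1.1)) else 0 with hG
      have hsub : Measurable fun p : (ℝ≥0 × ℝ) × PathSpace d => t - p.1.1 :=
        measurable_const.sub (measurable_fst.comp measurable_fst)
      have hGm : Measurable G := by
        refine Measurable.ite ?_ ?_ measurable_const
        · exact ((measurable_fst.comp measurable_fst) measurableSet_Iio).inter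
            (measurable_st_comp hsub measurable_snd (measurableSet_singleton j))
        · exact (Real.measurable_exp.comp ((measurable_snd.comp measurable_fst).const_mul _)).mul
            (Real.measurable_exp.comp ((measurable_pos_comp hsub measurable_snd).const_mul _))
      have hGw : ∀ w ∈ hitSet O k, G (((hit O w.pos).toNNReal, w.pos (hit O w.pos).toNNReal),
          shift (hit O w.pos).toNNReal w) = ({w | hit O w.pos < t} ∩ {w | w.st t = j}).indicator
            (fun w => Real.exp (-α * w.pos t)) w := by
        intro w hw
        have hiff : (hit O w.pos).toNNReal < t ↔ hit O w.pos < t := by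
          rw [← ENNReal.coe_lt_coe, ENNReal.coe_toNNReal hw.1]
        by_cases hlt : hit O w.pos < t
        · have hadd : (hit O w.pos).toNNReal + (t - (hit O w.pos).toNNReal) = t :=
            add_tsub_cancel_of_le (hiff.2 hlt).le
          simp only [hG, hiff, hlt, true_and, st_shift, pos_shift, hadd, ← Real.exp_add]
          by_cases hj : w.st t = j
          · rw [if_pos hj, Set.indicator_of_mem
              (show w ∈ {w | hit O w.pos < t} ∩ {w | w.st t = j} from ⟨hlt, hj⟩)]
            congr 1
            ring
          · rw [if_neg hj, Set.indicator_of_notMem fun h => hj h.2]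
        · simp only [hG, hiff, hlt, false_and, if_false]
          rw [Set.indicator_of_notMem fun h => hlt h.1]
      have hltm : MeasurableSet {w : PathSpace d | hit O w.pos < t} := hhit measurableSet_Iio
      have hhk := measurableSet_hitSet (d := d) hO k
      have hGi : IntegrableOn (fun w => G (((hit O w.pos).toNNReal, w.pos (hit O w.pos).toNNReal),
          shift (hit O w.pos).toNNReal w)) (hitSet O k) (μ i) :=
        ((hE.indicator (hltm.inter (hst j))).integrableOn).congr_fun (fun w hw => (hGw w hw).symm) hhk
      rw [exitBefore, Set.inter_assoc, ← setIntegral_indicator (hltm.inter (hst j)),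
        ← setIntegral_congr_fun hhk hGw, hμ.setIntegral_hitSet hO i k hGm hGi,
        ← setIntegral_indicator hltm]
      refine setIntegral_congr_fun hhk fun w hw => ?_
      have hiff : (hit O w.pos).toNNReal < t ↔ hit O w.pos < t := by
        rw [← ENNReal.coe_lt_coe, ENNReal.coe_toNNReal hw.1]
      by_cases hlt : hit O w.pos < t
      · rw [Set.indicator_of_mem (show w ∈ {w : PathSpace d | hit O w.pos < t} from hlt),
          ← hF.integral, ← integral_const_mul, ← integral_indicator (hst' _ j)]
        refine integral_congr_ae (Filter.Eventually.of_forall fun w' => ?_)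
        simp only [hG, hiff, hlt, true_and, Set.indicator_apply, Set.mem_ofPred_eq]
      · rw [Set.indicator_of_notMem (show w ∉ {w : PathSpace d | hit O w.pos < t} from hlt)]
        simp [hG, hiff, hlt]
    · intro k l hkl
      refine Set.disjoint_left.2 fun w h1 h2 => hkl ?_
      exact h1.1.1.2.symm.trans h2.1.1.2

end Killed

/-! ### The discounted matrix semigroup and an exchange of integrals. -/

open PathSpace

section MatrixSemigroup

variable {d : ℕ}

/-- The entries of the matrix semigroup generated by `F`. -/
def expEntry (F : Matrix (Fin d) (Fin d) ℝ) (t : ℝ) (k l : Fin d) : ℝ :=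
  (NormedSpace.exp (t • F) : Matrix (Fin d) (Fin d) ℝ) k l

open scoped Matrix.Norms.Operator in
lemma hasDerivAt_expEntry (F : Matrix (Fin d) (Fin d) ℝ) (t : ℝ) (k l : Fin d) :
    HasDerivAt (fun t => expEntry F t k l) (∑ j, expEntry F t k j * F j l) t := by
  have h1 := hasDerivAt_exp_smul_const (𝕂 := ℝ) F t
  exact (LinearMap.toContinuousLinearMap
    (Matrix.entryLinearMap ℝ ℝ k l)).hasFDerivAt.comp_hasDerivAt t h1

lemma expEntry_zero (F : Matrix (Fin d) (Fin d) ℝ) (k l : Fin d) :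
    expEntry F 0 k l = (1 : Matrix (Fin d) (Fin d) ℝ) k l := by
  rw [expEntry, zero_smul, NormedSpace.exp_zero]

lemma continuous_expEntry (F : Matrix (Fin d) (Fin d) ℝ) (k l : Fin d) :
    Continuous fun t => expEntry F t k l :=
  continuous_iff_continuousAt.2 fun t => (hasDerivAt_expEntry F t k l).continuousAt

/-- The discounted semigroup, multiplied by the resolvent matrix `βI - F`. -/
def discounted (F : Matrix (Fin d) (Fin d) ℝ) (β t : ℝ) (k l : Fin d) : ℝ :=
  Real.exp (-β * t) * ∑ j, expEntry F t k j * (β • (1 : Matrix (Fin d) (Fin d) ℝ) - F) j l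

lemma hasDerivAt_discounted (F : Matrix (Fin d) (Fin d) ℝ) (β t : ℝ) (k l : Fin d) :
    HasDerivAt (fun t => Real.exp (-β * t) * expEntry F t k l) (-discounted F β t k l) t := by
  have h1 : HasDerivAt (fun t : ℝ => Real.exp (-β * t)) (Real.exp (-β * t) * -β) t := by
    simpa using ((hasDerivAt_id t).const_mul (-β)).exp
  refine (h1.mul (hasDerivAt_expEntry F t k l)).congr_deriv ?_
  simp only [discounted, Matrix.sub_apply, Matrix.smul_apply, mul_sub, Finset.sum_sub_distrib,
    Matrix.one_apply, smul_eq_mul, mul_ite, mul_one, mul_zero]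
  rw [Finset.sum_ite_eq' Finset.univ l]
  simp only [Finset.mem_univ, if_true]
  ring

lemma continuous_discounted (F : Matrix (Fin d) (Fin d) ℝ) (β : ℝ) (k l : Fin d) :
    Continuous fun t => discounted F β t k l :=
  (by fun_prop : Continuous fun t : ℝ => Real.exp (-β * t)).mul
    (continuous_finsetSum _ fun j _ => (continuous_expEntry F k j).mul_const _)

lemma integral_discounted (F : Matrix (Fin d) (Fin d) ℝ) (β s : ℝ) (k l : Fin d) :
    ∫ t in (0 : ℝ)..s, discounted F β t k l =
      (1 : Matrix (Fin d) (Fin d) ℝ) k l - Real.exp (-β * s) * expEntry F s k l := by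
  have h := intervalIntegral.integral_eq_sub_of_hasDerivAt
    (fun t _ => (hasDerivAt_discounted F β t k l).neg)
    (by simpa using ((continuous_discounted F β k l).intervalIntegrable 0 s))
  simp only [neg_neg, Pi.neg_apply, mul_zero, Real.exp_zero, one_mul, expEntry_zero] at h
  rw [h]
  ring

end MatrixSemigroup

/-- Exchanging the order of integration over times after a random time. -/
lemma intervalIntegral_setIntegral_swap {W : Type*} [MeasurableSpace W] {ν : Measure W}
    [IsFiniteMeasure ν] {ρ c : W → ℝ} (hρ : Measurable ρ) (hρ0 : ∀ w, 0 ≤ ρ w) (hc : Measurable c)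
    {C : ℝ} (hC : ∀ᵐ w ∂ν, |c w| ≤ C) {φ : ℝ → ℝ} (hφ : Continuous φ) {U : ℝ} (hU : 0 ≤ U) :
    IntervalIntegrable (fun s => ∫ w in {w | ρ w < s}, c w * φ (s - ρ w) ∂ν) volume 0 U ∧
    (∫ s in (0 : ℝ)..U, ∫ w in {w | ρ w < s}, c w * φ (s - ρ w) ∂ν) =
      ∫ w in {w | ρ w < U}, c w * (∫ s in (0 : ℝ)..(U - ρ w), φ s) ∂ν := by
  have hlt : ∀ s, MeasurableSet {w | ρ w < s} := fun s => hρ measurableSet_Iio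
  set f : ℝ × W → ℝ := fun p => if ρ p.2 < p.1 then c p.2 * φ (p.1 - ρ p.2) else 0 with hf
  have hfm : Measurable f := by
    refine Measurable.ite (measurableSet_lt (hρ.comp measurable_snd) measurable_fst) ?_
      measurable_const
    exact (hc.comp measurable_snd).mul
      (hφ.measurable.comp (measurable_fst.sub (hρ.comp measurable_snd)))
  -- On the support of the integrand `s - ρ` lies in `[0, U]`, so a bound for `φ` there gives
  -- integrability on the product.
  obtain ⟨B, hB⟩ := isCompact_Icc.exists_bound_of_continuousOn (s := Set.Icc 0 U) hφ.continuousOn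
  have hB0 : 0 ≤ B := (norm_nonneg _).trans (hB 0 ⟨le_rfl, hU⟩)
  have hint : Integrable f ((volume.restrict (Set.Ioc 0 U)).prod ν) := by
    refine Integrable.of_bound hfm.aestronglyMeasurable (|C| * B) ?_
    have h1 : ∀ᵐ p ∂((volume.restrict (Set.Ioc 0 U)).prod ν), p.1 ∈ Set.Ioc 0 U :=
      Measure.quasiMeasurePreserving_fst.ae (ae_restrict_mem measurableSet_Ioc)
    have h2 : ∀ᵐ p ∂((volume.restrict (Set.Ioc 0 U)).prod ν), |c p.2| ≤ C :=
      Measure.quasiMeasurePreserving_snd.ae hC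
    filter_upwards [h1, h2] with p h1 h2
    simp only [hf]
    split_ifs with h
    · rw [norm_mul, Real.norm_eq_abs]
      refine mul_le_mul (h2.trans (le_abs_self C)) (hB _ ⟨?_, ?_⟩) (norm_nonneg _) (abs_nonneg _)
      · linarith
      · linarith [hρ0 p.2, h1.2]
    · rw [norm_zero]; positivity
  have e1 : ∀ s, ∫ w in {w | ρ w < s}, c w * φ (s - ρ w) ∂ν = ∫ w, f (s, w) ∂ν := fun s => by
    rw [← integral_indicator (hlt s)]
    rfl
  simp_rw [e1]
  constructor
  · rw [intervalIntegrable_iff_integrableOn_Ioc_of_le hU]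
    exact hint.integral_prod_left
  · rw [intervalIntegral.integral_of_le hU, integral_integral_swap (f := fun s w => f (s, w)) hint,
      ← integral_indicator (hlt U)]
    refine integral_congr_ae (Filter.Eventually.of_forall fun w => ?_)
    by_cases hw : ρ w < U
    · rw [Set.indicator_of_mem (show w ∈ {w | ρ w < U} from hw)]
      have e2 : ∀ s ∈ Set.Ioc 0 U, f (s, w) =
          (Set.Ioc (ρ w) U).indicator (fun s => c w * φ (s - ρ w)) s := by
        intro s hs
        simp only [hf, Set.indicator_apply, Set.mem_Ioc, hs.2, and_true]
      beta_reduce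
      rw [setIntegral_congr_fun measurableSet_Ioc e2, setIntegral_indicator measurableSet_Ioc,
        Set.Ioc_inter_Ioc, max_eq_right (hρ0 w), min_self, integral_const_mul,
        ← intervalIntegral.integral_of_le hw.le, intervalIntegral.integral_comp_sub_right φ (ρ w),
        sub_self]
    · rw [Set.indicator_of_notMem (show w ∉ {w | ρ w < U} from hw)]
      refine (setIntegral_congr_fun measurableSet_Ioc fun s hs => ?_).trans (integral_zero _ _)
      exact if_neg fun h => hw (h.trans_le hs.2)

/-! ### The decomposition in real time. -/

section Killed

variable {d : ℕ} {μ : Fin d → Measure (PathSpace d)} {α a b : ℝ} {F : Matrix (Fin d) (Fin d) ℝ}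

/-- The first exit time from `[-a, b]`, as a real number. -/
def exitTime (a b : ℝ) (w : PathSpace d) : ℝ := ((hit (exitSet a b) w.pos).toNNReal : ℝ)

/-- The level at the first exit from `[-a, b]`. -/
def exitPos (a b : ℝ) (w : PathSpace d) : ℝ := w.pos (hit (exitSet a b) w.pos).toNNReal

lemma measurable_exitTime : Measurable (exitTime (d := d) a b) :=
  measurable_coe_nnreal_real.comp (measurable_hit_pos (isOpen_exitSet a b)).ennreal_toNNReal

lemma measurable_exitPos : Measurable (exitPos (d := d) a b) :=
  measurable_pos_comp (measurable_hit_pos (isOpen_exitSet a b)).ennreal_toNNReal measurable_id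

lemma neg_le_exitPos (ha : 0 ≤ a) {w : PathSpace d} (h : hit (exitSet a b) w.pos ≠ ∞) :
    -a ≤ exitPos a b w := by
  refine neg_le_pos_of_le_hit ha ?_
  rw [ENNReal.coe_toNNReal h, exitSet, hit_union]
  exact min_le_left _ _

lemma exp_exitPos_le (hα : 0 ≤ α) (ha : 0 ≤ a) {w : PathSpace d}
    (h : hit (exitSet a b) w.pos ≠ ∞) : Real.exp (-α * exitPos a b w) ≤ Real.exp (α * a) :=
  Real.exp_le_exp.2 (by nlinarith [neg_le_exitPos (b := b) ha h])

lemma expEntry_eq_killed_add (hμ : IsMAP μ) (hF : HasLaplaceSemigroup μ α F) (a b : ℝ)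
    (i j : Fin d) {s : ℝ} (hs : 0 ≤ s) :
    expEntry F s i j = killed μ α a b i j s.toNNReal +
      ∑ k, ∫ w in {w | exitTime a b w < s}, Real.exp (-α * exitPos a b w) *
        expEntry F (s - exitTime a b w) k j ∂(μ i).restrict (hitSet (exitSet a b) k) := by
  have h := exp_eq_killed_add hμ hF a b i j s.toNNReal
  rw [Real.coe_toNNReal s hs] at h
  rw [expEntry, h]
  congr 1
  refine Finset.sum_congr rfl fun k _ => ?_
  -- A path that never leaves has `exitTime` equal to `0`, the default of `toNNReal` at infinity.
  -- Restricting to `hitSet` removes it.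
  have hset : exitBefore a b k s.toNNReal =
      {w | exitTime a b w < s} ∩ hitSet (exitSet a b) k := by
    ext w
    rw [exitBefore, Set.inter_comm]
    refine and_congr_left fun hw => ?_
    simp only [Set.mem_ofPred_eq, exitTime]
    rw [← ENNReal.coe_toNNReal hw.1, ENNReal.coe_lt_coe, ENNReal.toNNReal_coe,
      ← NNReal.coe_lt_coe, Real.coe_toNNReal s hs]
  have hm : MeasurableSet {w : PathSpace d | exitTime a b w < s} :=
    measurable_exitTime measurableSet_Iio
  refine Eq.trans ?_ (congrArg (fun ν => ∫ w, Real.exp (-α * exitPos a b w) *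
    expEntry F (s - exitTime a b w) k j ∂ν)
      (by rw [Measure.restrict_restrict hm, ← hset])).symm
  refine setIntegral_congr_fun (measurableSet_exitBefore k _) fun w hw => ?_
  have hlt : exitTime a b w < s := by
    rw [hset] at hw
    exact hw.1
  rw [NNReal.coe_sub, Real.coe_toNNReal s hs]
  · rfl
  · rw [← NNReal.coe_le_coe, Real.coe_toNNReal s hs]
    exact hlt.le

lemma measurable_ite_le_hit (α a b : ℝ) (j : Fin d) : Measurable fun p : ℝ≥0 × PathSpace d =>
    if (p.1 : ℝ≥0∞) ≤ hit (exitSet a b) p.2.pos ∧ p.2.st p.1 = j then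
      Real.exp (-α * p.2.pos p.1) else 0 := by
  refine Measurable.ite ?_
    (Real.measurable_exp.comp (measurable_pos_uncurry.const_mul _)) measurable_const
  exact (measurableSet_le (measurable_coe_nnreal_ennreal.comp measurable_fst)
    ((measurable_hit_pos (isOpen_exitSet a b)).comp measurable_snd)).inter
    (measurable_st_uncurry (measurableSet_singleton j))

lemma killed_eq_integral (i j : Fin d) (t : ℝ≥0) : killed μ α a b i j t =
    ∫ w, (if (t : ℝ≥0∞) ≤ hit (exitSet a b) w.pos ∧ w.st t = j then
      Real.exp (-α * w.pos t) else 0) ∂μ i := by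
  rw [killed, ← integral_indicator]
  · simp only [Set.indicator_apply, Set.mem_ofPred_eq]
  · exact ((measurable_hit_pos (isOpen_exitSet a b)) measurableSet_Ici).inter
      (measurable_st t (measurableSet_singleton j))

lemma measurable_killed (hμ : IsMAP μ) (i j : Fin d) : Measurable (killed μ α a b i j) := by
  have := hμ.prob
  rw [funext (killed_eq_integral i j)]
  exact ((measurable_ite_le_hit α a b j).stronglyMeasurable.integral_prod_right' (ν := μ i)).measurable

/-- Up to the exit the level is at least `-a`. This bound, uniform in time, is what makes the killed
resolvent finite for every `β > 0`. -/
lemma norm_killed_le (hμ : IsMAP μ) (hα : 0 ≤ α) (ha : 0 ≤ a) (i j : Fin d) (t : ℝ≥0) :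
    ‖killed μ α a b i j t‖ ≤ Real.exp (α * a) := by
  have := hμ.prob
  rw [killed]
  refine (norm_setIntegral_le_of_norm_le_const (measure_lt_top _ _) fun w hw => ?_).trans
    (mul_le_of_le_one_right (Real.exp_pos _).le measureReal_le_one)
  · rw [Real.norm_of_nonneg (Real.exp_pos _).le, Real.exp_le_exp]
    have h1 : (t : ℝ≥0∞) ≤ hit (lowSet a) w.pos := hw.1.trans (by
      rw [exitSet, hit_union]; exact min_le_left _ _)
    nlinarith [neg_le_pos_of_le_hit ha h1]

end Killed

/-! ### The resolvent equation for the killed process. -/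

open PathSpace

section Resolvent

variable {d : ℕ} {μ : Fin d → Measure (PathSpace d)} {α β a b : ℝ}
  {F : Matrix (Fin d) (Fin d) ℝ}

/-- The discounted transform of the level at the exit from `[-a, b]`. -/
def exitWeight (α β a b : ℝ) (w : PathSpace d) : ℝ :=
  Real.exp (-β * exitTime a b w) * Real.exp (-α * exitPos a b w)

lemma measurable_exitWeight : Measurable (exitWeight (d := d) α β a b) :=
  (Real.measurable_exp.comp (measurable_exitTime.const_mul _)).mul
    (Real.measurable_exp.comp (measurable_exitPos.const_mul _))

lemma exitTime_nonneg (w : PathSpace d) : 0 ≤ exitTime a b w := NNReal.coe_nonneg _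

lemma exitWeight_nonneg (w : PathSpace d) : 0 ≤ exitWeight α β a b w := by
  unfold exitWeight
  positivity

lemma exitWeight_le (hα : 0 ≤ α) (hβ : 0 ≤ β) (ha : 0 ≤ a) {w : PathSpace d}
    (h : hit (exitSet a b) w.pos ≠ ∞) : exitWeight α β a b w ≤ Real.exp (α * a) := by
  refine (mul_le_of_le_one_left (Real.exp_pos _).le ?_).trans (exp_exitPos_le hα ha h)
  exact Real.exp_le_one_iff.2 (by nlinarith [exitTime_nonneg (a := a) (b := b) w])

lemma integrable_restrict_hitSet (hμ : IsMAP μ) (i k : Fin d) {f : PathSpace d → ℝ}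
    (hf : Measurable f) {s : Set (PathSpace d)} (hs : MeasurableSet s) {C : ℝ}
    (hC : ∀ w ∈ s, hit (exitSet a b) w.pos ≠ ∞ → |f w| ≤ C) :
    IntegrableOn f s ((μ i).restrict (hitSet (exitSet a b) k)) := by
  have := hμ.prob
  refine Integrable.of_bound hf.aestronglyMeasurable C ?_
  rw [Measure.restrict_restrict hs]
  filter_upwards [ae_restrict_mem (hs.inter (measurableSet_hitSet (isOpen_exitSet a b) k))] with w hw
  exact hC w hw.1 hw.2.1

lemma integrableOn_exp_exitPos_mul_expEntry (hμ : IsMAP μ) (hα : 0 ≤ α) (ha : 0 ≤ a)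
    (i k j : Fin d) (s : ℝ) : IntegrableOn (fun w => Real.exp (-α * exitPos a b w) *
      expEntry F (s - exitTime a b w) k j) {w : PathSpace d | exitTime a b w < s}
      ((μ i).restrict (hitSet (exitSet a b) k)) := by
  obtain ⟨B, hB⟩ := isCompact_Icc.exists_bound_of_continuousOn (s := Set.Icc 0 s)
    (continuous_expEntry F k j).continuousOn
  refine integrable_restrict_hitSet hμ i k (f := fun w => Real.exp (-α * exitPos a b w) *
      expEntry F (s - exitTime a b w) k j)
    ((Real.measurable_exp.comp (measurable_exitPos.const_mul _)).mul
      ((continuous_expEntry F k j).measurable.comp (measurable_const.sub measurable_exitTime)))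
    (measurable_exitTime measurableSet_Iio) (C := Real.exp (α * a) * B) fun w hw hw' => ?_
  rw [abs_mul, abs_of_nonneg (Real.exp_pos _).le]
  refine mul_le_mul (exp_exitPos_le hα ha hw') (hB _ ⟨?_, ?_⟩) (abs_nonneg _) (Real.exp_pos _).le
  · exact sub_nonneg.2 (le_of_lt hw)
  · linarith [exitTime_nonneg (a := a) (b := b) w]

/-- The exit decomposition multiplied by `e^{-βs}(βI - F)`. The discount factor splits at the exit
time, so the part after the exit is again a discounted semigroup, started afresh. -/
lemma discounted_eq_killed_add (hμ : IsMAP μ) (hF : HasLaplaceSemigroup μ α F) (hα : 0 ≤ α)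
    (ha : 0 ≤ a) (i l : Fin d) {s : ℝ} (hs : 0 ≤ s) :
    discounted F β s i l = ∑ j, Real.exp (-β * s) * killed μ α a b i j s.toNNReal *
        (β • (1 : Matrix (Fin d) (Fin d) ℝ) - F) j l +
      ∑ k, ∫ w in {w | exitTime a b w < s}, exitWeight α β a b w *
        discounted F β (s - exitTime a b w) k l ∂(μ i).restrict (hitSet (exitSet a b) k) := by
  have hterm : ∀ k, ∫ w in {w | exitTime a b w < s}, exitWeight α β a b w *
        discounted F β (s - exitTime a b w) k l ∂(μ i).restrict (hitSet (exitSet a b) k) =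
      ∑ j, Real.exp (-β * s) * (∫ w in {w | exitTime a b w < s}, Real.exp (-α * exitPos a b w) *
        expEntry F (s - exitTime a b w) k j ∂(μ i).restrict (hitSet (exitSet a b) k)) *
          (β • (1 : Matrix (Fin d) (Fin d) ℝ) - F) j l := fun k => by
    simp_rw [← integral_const_mul, ← integral_mul_const]
    rw [← integral_finsetSum _ fun j _ => ((integrableOn_exp_exitPos_mul_expEntry hμ hα ha i k j s).const_mul _).mul_const _]
    refine integral_congr_ae (.of_forall fun w => ?_)
    have hexp : Real.exp (-β * s) =
        Real.exp (-β * exitTime a b w) * Real.exp (-β * (s - exitTime a b w)) := by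
      rw [← Real.exp_add]; ring_nf
    simp only [exitWeight, discounted, Finset.mul_sum, hexp]
    exact Finset.sum_congr rfl fun j _ => by ring
  simp_rw [hterm]
  rw [discounted, Finset.sum_comm, ← Finset.sum_add_distrib, Finset.mul_sum]
  refine Finset.sum_congr rfl fun j _ => ?_
  rw [expEntry_eq_killed_add hμ hF a b i j hs, ← Finset.sum_mul, ← Finset.mul_sum]
  ring

lemma integrableOn_exp_mul_killed (hμ : IsMAP μ) (hα : 0 ≤ α) (hβ : 0 < β) (ha : 0 ≤ a)
    (i j : Fin d) : IntegrableOn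
      (fun s : ℝ => Real.exp (-β * s) * killed μ α a b i j s.toNNReal) (Set.Ioi 0) := by
  refine Integrable.mul_bdd (c := Real.exp (α * a)) (integrableOn_exp_mul_Ioi (neg_lt_zero.2 hβ) 0)
    ((measurable_killed hμ i j).comp measurable_real_toNNReal).aestronglyMeasurable
    (.of_forall fun s => norm_killed_le hμ hα ha i j _)

lemma intervalIntegrable_fun_sum {ι : Type*} {s : Finset ι} {f : ι → ℝ → ℝ} {u v : ℝ}
    (h : ∀ k ∈ s, IntervalIntegrable (f k) volume u v) :
    IntervalIntegrable (fun x => ∑ k ∈ s, f k x) volume u v := by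
  simpa only [Finset.sum_fn] using IntervalIntegrable.sum s h

/-- After integration over `[0, U]` and Fubini, both sides contain discounted semigroups whose
integrals are explicit: the identity minus a boundary term. The boundary terms involving `exp` are
the exit decomposition at time `U`, so all that remains of them is the killed semigroup at `U`. -/
lemma integral_discounted_killed (hμ : IsMAP μ) (hF : HasLaplaceSemigroup μ α F) (hα : 0 ≤ α)
    (hβ : 0 < β) (ha : 0 ≤ a) (i l : Fin d) {U : ℝ} (hU : 0 ≤ U) :
    ∑ j, (∫ s in (0 : ℝ)..U, Real.exp (-β * s) * killed μ α a b i j s.toNNReal) *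
        (β • (1 : Matrix (Fin d) (Fin d) ℝ) - F) j l =
      (1 : Matrix (Fin d) (Fin d) ℝ) i l -
        ∫ w in {w | exitTime a b w < U}, exitWeight α β a b w
          ∂(μ i).restrict (hitSet (exitSet a b) l) -
        Real.exp (-β * U) * killed μ α a b i l U.toNNReal := by
  have := hμ.prob
  have hm : MeasurableSet {w : PathSpace d | exitTime a b w < U} :=
    measurable_exitTime measurableSet_Iio
  have hki : ∀ j, IntervalIntegrable
      (fun s : ℝ => Real.exp (-β * s) * killed μ α a b i j s.toNNReal) volume 0 U := fun j =>
    (intervalIntegrable_iff_integrableOn_Ioc_of_le hU).2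
      ((integrableOn_exp_mul_killed hμ hα hβ ha i j).mono_set Set.Ioc_subset_Ioi_self)
  have hsw : ∀ k, _ := fun k => intervalIntegral_setIntegral_swap
    (ν := (μ i).restrict (hitSet (exitSet a b) k)) (measurable_exitTime (a := a) (b := b))
    exitTime_nonneg (measurable_exitWeight (α := α) (β := β) (a := a) (b := b))
    (C := Real.exp (α * a)) (by
      filter_upwards [ae_restrict_mem (measurableSet_hitSet (isOpen_exitSet a b) k)] with w hw
      rw [abs_of_nonneg (exitWeight_nonneg w)]
      exact exitWeight_le hα hβ.le ha hw.1) (continuous_discounted F β k l) hU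
  have h1 := integral_discounted F β U i l
  rw [intervalIntegral.integral_congr (g := fun s => ∑ j, Real.exp (-β * s) *
      killed μ α a b i j s.toNNReal * (β • (1 : Matrix (Fin d) (Fin d) ℝ) - F) j l +
      ∑ k, ∫ w in {w | exitTime a b w < s}, exitWeight α β a b w *
        discounted F β (s - exitTime a b w) k l ∂(μ i).restrict (hitSet (exitSet a b) k))
      fun s hs => discounted_eq_killed_add hμ hF hα ha i l
        (by rw [Set.uIcc_of_le hU] at hs; exact hs.1),
    intervalIntegral.integral_add
      (intervalIntegrable_fun_sum fun j _ => (hki j).mul_const _)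
      (intervalIntegrable_fun_sum fun k _ => (hsw k).1),
    intervalIntegral.integral_finsetSum fun j _ => (hki j).mul_const _,
    intervalIntegral.integral_finsetSum fun k _ => (hsw k).1] at h1
  simp_rw [intervalIntegral.integral_mul_const] at h1
  have hwi : ∀ k, IntegrableOn (exitWeight α β a b) {w : PathSpace d | exitTime a b w < U}
      ((μ i).restrict (hitSet (exitSet a b) k)) := fun k =>
    integrable_restrict_hitSet hμ i k measurable_exitWeight hm fun w _ hw => by
      rw [abs_of_nonneg (exitWeight_nonneg w)]
      exact exitWeight_le hα hβ.le ha hw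
  have h2 : ∀ k, (∫ s in (0 : ℝ)..U, ∫ w in {w | exitTime a b w < s}, exitWeight α β a b w *
        discounted F β (s - exitTime a b w) k l ∂(μ i).restrict (hitSet (exitSet a b) k)) =
      (∫ w in {w | exitTime a b w < U}, exitWeight α β a b w
          ∂(μ i).restrict (hitSet (exitSet a b) k)) * (1 : Matrix (Fin d) (Fin d) ℝ) k l -
        Real.exp (-β * U) * ∫ w in {w | exitTime a b w < U}, Real.exp (-α * exitPos a b w) *
          expEntry F (U - exitTime a b w) k l ∂(μ i).restrict (hitSet (exitSet a b) k) := fun k => by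
    rw [(hsw k).2, ← integral_mul_const, ← integral_const_mul,
      ← integral_sub ((hwi k).mul_const _) ((integrableOn_exp_exitPos_mul_expEntry hμ hα ha i k l U).const_mul _)]
    refine integral_congr_ae (.of_forall fun w => ?_)
    beta_reduce
    have hexp : Real.exp (-β * U) =
        Real.exp (-β * exitTime a b w) * Real.exp (-β * (U - exitTime a b w)) := by
      rw [← Real.exp_add]; ring_nf
    rw [integral_discounted, hexp, exitWeight]
    ring
  simp_rw [h2] at h1
  rw [Finset.sum_sub_distrib, ← Finset.mul_sum] at h1
  have h3 := expEntry_eq_killed_add hμ hF a b i l hU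
  simp only [Matrix.one_apply, mul_ite, mul_one, mul_zero] at h1 ⊢
  rw [Finset.sum_ite_eq' Finset.univ l] at h1
  simp only [Finset.mem_univ, if_true] at h1
  rw [h3] at h1
  linarith

/-- The resolvent of the process killed at the exit from `[-a, b]`. -/
def killedResolvent (μ : Fin d → Measure (PathSpace d)) (α β a b : ℝ) : Matrix (Fin d) (Fin d) ℝ :=
  Matrix.of fun i j => ∫ s in Set.Ioi (0 : ℝ), Real.exp (-β * s) * killed μ α a b i j s.toNNReal

/-- The discounted transform of the level and the state at the exit from `[-a, b]`. -/
def exitTransform (μ : Fin d → Measure (PathSpace d)) (α β a b : ℝ) : Matrix (Fin d) (Fin d) ℝ :=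
  Matrix.of fun i j => ∫ w in hitSet (exitSet a b) j, exitWeight α β a b w ∂μ i

/-- Let `U → ∞` along the integers: the killed semigroup is bounded, so the boundary term is
discounted to zero, and the events `{exitTime < n}` exhaust the space. -/
theorem killedResolvent_mul (hμ : IsMAP μ) (hF : HasLaplaceSemigroup μ α F) (hα : 0 ≤ α)
    (hβ : 0 < β) (ha : 0 ≤ a) :
    killedResolvent μ α β a b * (β • (1 : Matrix (Fin d) (Fin d) ℝ) - F) =
      1 - exitTransform μ α β a b := by
  have := hμ.prob
  ext i l
  have hN : Filter.Tendsto (fun n : ℕ => (n : ℝ)) Filter.atTop Filter.atTop :=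
    tendsto_natCast_atTop_atTop
  have hL : Filter.Tendsto (fun n : ℕ => ∑ j, (∫ s in (0 : ℝ)..n, Real.exp (-β * s) *
      killed μ α a b i j s.toNNReal) * (β • (1 : Matrix (Fin d) (Fin d) ℝ) - F) j l) Filter.atTop
      (𝓝 ((killedResolvent μ α β a b * (β • (1 : Matrix (Fin d) (Fin d) ℝ) - F)) i l)) :=
    tendsto_finsetSum _ fun j _ => (intervalIntegral_tendsto_integral_Ioi 0
      (integrableOn_exp_mul_killed hμ hα hβ ha i j) hN).mul_const _
  refine tendsto_nhds_unique (hL.congr fun n =>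
    integral_discounted_killed hμ hF hα hβ ha i l n.cast_nonneg) ?_
  rw [Matrix.sub_apply]
  have hwi : Integrable (exitWeight (d := d) α β a b) ((μ i).restrict (hitSet (exitSet a b) l)) :=
    integrableOn_univ.1 (integrable_restrict_hitSet hμ i l measurable_exitWeight .univ
      fun w _ hw => by
        rw [abs_of_nonneg (exitWeight_nonneg w)]
        exact exitWeight_le hα hβ.le ha hw)
  have hE : Filter.Tendsto (fun n : ℕ => ∫ w in {w | exitTime a b w < n}, exitWeight α β a b w
      ∂(μ i).restrict (hitSet (exitSet a b) l)) Filter.atTop (𝓝 (exitTransform μ α β a b i l)) := by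
    have h := tendsto_setIntegral_of_monotone (μ := (μ i).restrict (hitSet (exitSet a b) l))
      (f := exitWeight α β a b) (s := fun n : ℕ => {w : PathSpace d | exitTime a b w < n})
      (fun n => measurable_exitTime measurableSet_Iio)
      (fun m n hmn => Set.ofPred_subset_ofPred.2 fun w hw => lt_of_lt_of_le hw (Nat.cast_le.2 hmn)) hwi.integrableOn
    have hu : (⋃ n : ℕ, {w : PathSpace d | exitTime a b w < n}) = Set.univ :=
      Set.eq_univ_of_forall fun w => Set.mem_iUnion.2 (exists_nat_gt (exitTime a b w))
    rw [hu, setIntegral_univ] at h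
    exact h
  have hk : Filter.Tendsto (fun n : ℕ => Real.exp (-β * n) *
      killed μ α a b i l (n : ℝ).toNNReal) Filter.atTop (𝓝 0) := by
    refine squeeze_zero_norm (a := fun n : ℕ => Real.exp (-β * n) * Real.exp (α * a))
      (fun n => ?_) ?_
    · rw [norm_mul, Real.norm_of_nonneg (Real.exp_pos _).le]
      exact mul_le_mul_of_nonneg_left (norm_killed_le hμ hα ha i l _) (Real.exp_pos _).le
    · rw [← zero_mul (Real.exp (α * a))]
      exact (Real.tendsto_exp_atBot.comp (hN.const_mul_atTop_of_neg (neg_lt_zero.2 hβ))).mul_const _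
  simpa using (hE.const_sub ((1 : Matrix (Fin d) (Fin d) ℝ) i l)).sub hk

end Resolvent

/-! ### The exit transform through one-sided passages. -/

open PathSpace

section Exit

variable {d : ℕ} {μ : Fin d → Measure (PathSpace d)} {α β a b u : ℝ}

/-- The discounted transform of the overshoot at the first passage above `u`. -/
def upWeight (α β u : ℝ) (w : PathSpace d) : ℝ :=
  Real.exp (-β * ((hit (upSet u) w.pos).toNNReal : ℝ)) *
    Real.exp (-α * (w.pos (hit (upSet u) w.pos).toNNReal - u))

/-- The discount factor at the first passage below `-a`. -/
def lowWeight (β a : ℝ) (w : PathSpace d) : ℝ :=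
  Real.exp (-β * ((hit (lowSet a) w.pos).toNNReal : ℝ))

/-- The discounted probabilities of leaving `[-a, b]` below. -/
def lowTransform (μ : Fin d → Measure (PathSpace d)) (β a b : ℝ) : Matrix (Fin d) (Fin d) ℝ :=
  Matrix.of fun i j => ∫ w in hitSet (lowSet a) j ∩
    {w | hit (lowSet a) w.pos ≤ hit (upSet b) w.pos}, lowWeight β a w ∂μ i

/-- The discounted transform of the overshoot above `u`. -/
def upTransform (μ : Fin d → Measure (PathSpace d)) (α β u : ℝ) : Matrix (Fin d) (Fin d) ℝ :=
  Matrix.of fun i j => ∫ w in hitSet (upSet u) j, upWeight α β u w ∂μ i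

lemma measurable_upWeight : Measurable (upWeight (d := d) α β u) := by
  have h : Measurable fun w : PathSpace d => (hit (upSet u) w.pos).toNNReal :=
    (measurable_hit_pos (isOpen_upSet u)).ennreal_toNNReal
  exact (Real.measurable_exp.comp ((measurable_coe_nnreal_real.comp h).const_mul _)).mul
    (Real.measurable_exp.comp (((measurable_pos_comp h measurable_id).sub_const _).const_mul _))

lemma upWeight_nonneg (w : PathSpace d) : 0 ≤ upWeight α β u w := by
  unfold upWeight
  positivity

lemma upWeight_le_one (hα : 0 ≤ α) (hβ : 0 ≤ β) {w : PathSpace d}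
    (h : hit (upSet u) w.pos ≠ ∞) : upWeight α β u w ≤ 1 := by
  refine mul_le_one₀ (Real.exp_le_one_iff.2 ?_) (Real.exp_pos _).le (Real.exp_le_one_iff.2 ?_)
  · nlinarith [NNReal.coe_nonneg (hit (upSet u) w.pos).toNNReal]
  · nlinarith [le_pos_hit_upSet h]

lemma integrableOn_upWeight (hμ : IsMAP μ) (hα : 0 ≤ α) (hβ : 0 ≤ β) (i j : Fin d) :
    IntegrableOn (upWeight α β u) (hitSet (upSet u) j) (μ i) := by
  have := hμ.prob
  refine Integrable.of_bound measurable_upWeight.aestronglyMeasurable 1 ?_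
  filter_upwards [ae_restrict_mem (measurableSet_hitSet (isOpen_upSet u) j)] with w hw
  rw [Real.norm_of_nonneg (upWeight_nonneg w)]
  exact upWeight_le_one hα hβ hw.1

lemma exitPos_eq_of_le (ha : 0 ≤ a) {w : PathSpace d} (h : hit (lowSet a) w.pos ≠ ∞)
    (hle : hit (lowSet a) w.pos ≤ hit (upSet b) w.pos) : exitPos a b w = -a := by
  rw [exitPos, exitSet, hit_union, min_eq_left hle]
  exact pos_hit_lowSet ha h

/-- The strong Markov property at the exit from `[-a, b]` below. -/
lemma integral_upWeight_after_low (hμ : IsMAP μ) (hα : 0 ≤ α) (hβ : 0 ≤ β) (ha : 0 ≤ a)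
    (hab : 0 < a + b) (i k j : Fin d) :
    ∫ w in hitSet (upSet b) j ∩ (hitSet (lowSet a) k ∩
        {w | hit (lowSet a) w.pos ≤ hit (upSet b) w.pos}), upWeight α β b w ∂μ i =
      lowTransform μ β a b i k * upTransform μ α β (a + b) k j := by
  have := hμ.prob
  have hO := isOpen_exitSet a b
  have hup := measurableSet_hitSet (d := d) (isOpen_upSet b) j
  have hup' := measurableSet_hitSet (d := d) (isOpen_upSet (a + b)) j
  have hD : MeasurableSet {w : PathSpace d | exitPos a b w = -a} :=
    measurable_exitPos (measurableSet_singleton (-a))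
  have hk := measurableSet_hitSet (d := d) hO k
  -- The strong Markov property is used at the exit from the interval, not at the passage below
  -- `-a`. There the condition that the lower boundary was reached first becomes a condition on the
  -- level. From `-a`, passage above `b` is passage above `a + b` of the restarted path, with the
  -- same overshoot.
  set G : (ℝ≥0 × ℝ) × PathSpace d → ℝ := fun p => if p.1.2 = -a then
    Real.exp (-β * (p.1.1 : ℝ)) *
      (hitSet (upSet (a + b)) j).indicator (upWeight α β (a + b)) p.2 else 0 with hG
  have hGm : Measurable G := by
    have h1 : Measurable fun p : (ℝ≥0 × ℝ) × PathSpace d => Real.exp (-β * (p.1.1 : ℝ)) *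
        (hitSet (upSet (a + b)) j).indicator (upWeight α β (a + b)) p.2 :=
      (Real.measurable_exp.comp ((measurable_coe_nnreal_real.comp
        (measurable_fst.comp measurable_fst)).const_mul _)).mul
        ((measurable_upWeight.indicator hup').comp measurable_snd)
    exact h1.ite ((measurable_snd.comp measurable_fst) (measurableSet_singleton (-a)))
      measurable_const
  have hGw : ∀ w ∈ hitSet (exitSet a b) k, G (((hit (exitSet a b) w.pos).toNNReal,
      w.pos (hit (exitSet a b) w.pos).toNNReal), shift (hit (exitSet a b) w.pos).toNNReal w) =
      (hitSet (upSet b) j ∩ {w | exitPos a b w = -a}).indicator (upWeight α β b) w := by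
    intro w hw
    by_cases hwD : exitPos a b w = -a
    · have hadd := hit_upSet_eq_add hwD hw.1
      have hval : G (((hit (exitSet a b) w.pos).toNNReal,
          w.pos (hit (exitSet a b) w.pos).toNNReal), shift (hit (exitSet a b) w.pos).toNNReal w) =
          Real.exp (-β * ((hit (exitSet a b) w.pos).toNNReal : ℝ)) *
            (hitSet (upSet (a + b)) j).indicator (upWeight α β (a + b))
              (shift (hit (exitSet a b) w.pos).toNNReal w) := if_pos hwD
      rw [hval]
      set ρ := (hit (exitSet a b) w.pos).toNNReal
      have hpos : w.pos ρ = -a := hwD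
      by_cases hf : hit (upSet (a + b)) (shift ρ w).pos = ∞
      · have hf' : hit (upSet b) w.pos = ∞ := by rw [hadd, hf, add_top]
        rw [Set.indicator_of_notMem fun h => h.1 hf, Set.indicator_of_notMem fun h => h.1.1 hf',
          mul_zero]
      · have hf' : hit (upSet b) w.pos ≠ ∞ := by
          rw [hadd]
          exact ENNReal.add_ne_top.2 ⟨ENNReal.coe_ne_top, hf⟩
        have hadd' : (hit (upSet b) w.pos).toNNReal =
            ρ + (hit (upSet (a + b)) (shift ρ w).pos).toNNReal := by
          rw [hadd, ENNReal.toNNReal_add ENNReal.coe_ne_top hf, ENNReal.toNNReal_coe]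
        have hiff : shift ρ w ∈ hitSet (upSet (a + b)) j ↔
            w ∈ hitSet (upSet b) j ∩ {w | exitPos a b w = -a} := by
          refine ⟨fun h => ⟨⟨hf', ?_⟩, hwD⟩, fun h => ⟨hf, ?_⟩⟩
          · rw [hadd', ← st_shift]
            exact h.2
          · rw [st_shift, ← hadd']
            exact h.1.2
        by_cases hj : shift ρ w ∈ hitSet (upSet (a + b)) j
        · rw [Set.indicator_of_mem hj, Set.indicator_of_mem (hiff.1 hj), upWeight, upWeight,
            pos_shift, hpos, hadd', ← mul_assoc, ← Real.exp_add, NNReal.coe_add]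
          ring_nf
        · rw [Set.indicator_of_notMem hj, Set.indicator_of_notMem (mt hiff.2 hj), mul_zero]
    · rw [Set.indicator_of_notMem fun h => hwD h.2]
      exact if_neg hwD
  have hGi : IntegrableOn (fun w => G (((hit (exitSet a b) w.pos).toNNReal,
      w.pos (hit (exitSet a b) w.pos).toNNReal), shift (hit (exitSet a b) w.pos).toNNReal w))
      (hitSet (exitSet a b) k) (μ i) := by
    refine IntegrableOn.congr_fun ?_ (fun w hw => (hGw w hw).symm) hk
    exact (((integrableOn_upWeight hμ hα hβ i j).mono_set
      Set.inter_subset_left).integrable_indicator (hup.inter hD)).integrableOn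
  have hsets : hitSet (exitSet a b) k ∩ {w | exitPos a b w = -a} = hitSet (lowSet a) k ∩
      {w | hit (lowSet a) w.pos ≤ hit (upSet b) w.pos} := hitSet_exitSet_inter_eq ha hab k
  rw [← hsets, Set.inter_left_comm, ← setIntegral_indicator (hup.inter hD),
    ← setIntegral_congr_fun hk hGw, hμ.setIntegral_hitSet hO i k hGm hGi]
  have hval : ∀ w : PathSpace d, ∫ w', G (((hit (exitSet a b) w.pos).toNNReal,
      w.pos (hit (exitSet a b) w.pos).toNNReal), w') ∂μ k = {w | exitPos a b w = -a}.indicator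
        (fun w => Real.exp (-β * exitTime a b w) * upTransform μ α β (a + b) k j) w := fun w => by
    by_cases hwD : exitPos a b w = -a
    · rw [Set.indicator_of_mem (show w ∈ {w | exitPos a b w = -a} from hwD)]
      simp only [upTransform, Matrix.of_apply]
      rw [← integral_indicator hup', ← integral_const_mul]
      exact integral_congr_ae (.of_forall fun w' => if_pos hwD)
    · rw [Set.indicator_of_notMem (show w ∉ {w | exitPos a b w = -a} from hwD)]
      exact (integral_congr_ae (.of_forall fun w' => if_neg hwD)).trans
        (integral_zero _ _)
  simp_rw [hval]
  rw [setIntegral_indicator hD, integral_mul_const, hsets]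
  congr 1
  refine setIntegral_congr_fun ((hsets ▸ hk.inter hD)) fun w hw => ?_
  rw [exitTime, exitSet, hit_union, min_eq_left hw.2, lowWeight]

/-- The transform at the exit from `[-a, b]` in terms of one-sided passages. -/
theorem exitTransform_eq (hμ : IsMAP μ) (hα : 0 ≤ α) (hβ : 0 ≤ β) (ha : 0 ≤ a) (hab : 0 < a + b) :
    exitTransform μ α β a b = Real.exp (α * a) • lowTransform μ β a b +
      Real.exp (-α * b) • upTransform μ α β b -
        Real.exp (-α * b) • (lowTransform μ β a b * upTransform μ α β (a + b)) := by
  have := hμ.prob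
  ext i j
  have hO := isOpen_exitSet a b
  have hD : MeasurableSet {w : PathSpace d | exitPos a b w = -a} :=
    measurable_exitPos (measurableSet_singleton (-a))
  have hL : MeasurableSet {w : PathSpace d | hit (lowSet a) w.pos ≤ hit (upSet b) w.pos} :=
    measurableSet_le (measurable_hit_pos (isOpen_lowSet a)) (measurable_hit_pos (isOpen_upSet b))
  have hlow : ∀ k, MeasurableSet (hitSet (d := d) (lowSet a) k) :=
    measurableSet_hitSet (isOpen_lowSet a)
  have hup := measurableSet_hitSet (d := d) (isOpen_upSet b) j
  have hi : IntegrableOn (exitWeight α β a b) (hitSet (exitSet a b) j) (μ i) :=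
    integrableOn_univ.1 (integrable_restrict_hitSet hμ i j measurable_exitWeight .univ
      fun w _ hw => by
        rw [abs_of_nonneg (exitWeight_nonneg w)]
        exact exitWeight_le hα hβ ha hw)
  have hui := integrableOn_upWeight (u := b) hμ hα hβ i j
  have h1 : ∫ w in hitSet (exitSet a b) j ∩ {w | exitPos a b w = -a}, exitWeight α β a b w ∂μ i =
      Real.exp (α * a) * lowTransform μ β a b i j := by
    rw [show hitSet (exitSet a b) j ∩ {w | exitPos a b w = -a} = _ from
      hitSet_exitSet_inter_eq ha hab j]
    simp only [lowTransform, Matrix.of_apply]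
    rw [← integral_const_mul]
    refine setIntegral_congr_fun ((hlow j).inter hL) fun w hw => ?_
    rw [exitWeight, exitPos_eq_of_le ha hw.1.1 hw.2, exitTime, exitSet, hit_union,
      min_eq_left hw.2, lowWeight, mul_comm]
    ring_nf
  -- On an upward exit the exit level is `b` plus the overshoot, which accounts for the factor
  -- `exp(-α b)`.
  have h2 : ∫ w in hitSet (exitSet a b) j \ {w | exitPos a b w = -a}, exitWeight α β a b w ∂μ i =
      Real.exp (-α * b) * ∫ w in hitSet (upSet b) j \
        {w | hit (lowSet a) w.pos ≤ hit (upSet b) w.pos}, upWeight α β b w ∂μ i := by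
    rw [show hitSet (exitSet a b) j \ {w | exitPos a b w = -a} = _ from
      hitSet_exitSet_diff_eq ha hab j, ← integral_const_mul]
    refine setIntegral_congr_fun (hup.diff hL) fun w hw => ?_
    rw [exitWeight, exitPos, exitTime, exitSet, hit_union,
      min_eq_right (le_of_not_ge hw.2), upWeight, mul_left_comm, ← Real.exp_add, ← Real.exp_add,
      ← Real.exp_add]
    ring_nf
  -- A path that passes below before a finite passage above has a finite downward passage time,
  -- hence some state `k` at that time.
  have h3 : hitSet (upSet b) j ∩ {w : PathSpace d | hit (lowSet a) w.pos ≤ hit (upSet b) w.pos} =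
      ⋃ k, hitSet (upSet b) j ∩ (hitSet (lowSet a) k ∩
        {w | hit (lowSet a) w.pos ≤ hit (upSet b) w.pos}) := by
    ext w
    simp only [Set.mem_iUnion]
    exact ⟨fun h => ⟨_, h.1, ⟨ne_top_of_le_ne_top h.1.1 h.2, rfl⟩, h.2⟩,
      fun ⟨k, h⟩ => ⟨h.1, h.2.2⟩⟩
  have h4 : ∫ w in hitSet (upSet b) j ∩ {w | hit (lowSet a) w.pos ≤ hit (upSet b) w.pos},
      upWeight α β b w ∂μ i = (lowTransform μ β a b * upTransform μ α β (a + b)) i j := by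
    rw [h3, integral_iUnion_fintype (fun k => hup.inter ((hlow k).inter hL)) _
      fun k => hui.mono_set Set.inter_subset_left, Matrix.mul_apply]
    · exact Finset.sum_congr rfl fun k _ => integral_upWeight_after_low hμ hα hβ ha hab i k j
    · exact fun k l hkl => Set.disjoint_left.2 fun w h1 h2 => hkl (h1.2.1.2.symm.trans h2.2.1.2)
  have h5 := integral_inter_add_sdiff hL hui
  rw [h4] at h5
  have h6 : exitTransform μ α β a b i j = _ := (integral_inter_add_sdiff hD hi).symm
  rw [h1, h2, eq_sub_of_add_eq' h5] at h6
  rw [h6]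
  simp only [Matrix.sub_apply, Matrix.add_apply, Matrix.smul_apply, smul_eq_mul, upTransform,
    Matrix.of_apply]
  ring

end Exit

/-! ### The exponential killing time. -/

open PathSpace

section Exponential

variable {β : ℝ}

lemma toReal_exponentialPDF_smul_eq (hβ : 0 < β) (g : ℝ → ℝ) :
    (fun s => (exponentialPDF β s).toReal • g s) =
      (Set.Ici 0).indicator fun s => β * (Real.exp (-β * s) * g s) := by
  ext s
  by_cases hs : 0 ≤ s
  · rw [Set.indicator_of_mem (Set.mem_Ici.2 hs), exponentialPDF_of_nonneg hs,
      ENNReal.toReal_ofReal (by positivity), smul_eq_mul, neg_mul, mul_assoc]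
  · rw [Set.indicator_of_notMem (mt Set.mem_Ici.1 hs), exponentialPDF_of_neg (not_le.1 hs),
      ENNReal.toReal_zero, zero_smul]

lemma measurable_exponentialPDF : Measurable (exponentialPDF β) :=
  (measurable_exponentialPDFReal β).ennreal_ofReal

lemma integral_expMeasure (hβ : 0 < β) (g : ℝ → ℝ) :
    ∫ s, g s ∂expMeasure β = β * ∫ s in Set.Ioi 0, Real.exp (-β * s) * g s := by
  have h := integral_withDensity_eq_integral_toReal_smul (μ := volume)
    (measurable_exponentialPDF (β := β)) (.of_forall fun s => ENNReal.ofReal_lt_top) g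
  rw [toReal_exponentialPDF_smul_eq hβ, integral_indicator measurableSet_Ici,
    integral_Ici_eq_integral_Ioi, integral_const_mul] at h
  exact h

lemma integrableOn_of_integrable_expMeasure (hβ : 0 < β) {g : ℝ → ℝ}
    (hg : Integrable g (expMeasure β)) :
    IntegrableOn (fun s => Real.exp (-β * s) * g s) (Set.Ioi 0) := by
  have h := (integrable_withDensity_iff_integrable_smul' (μ := volume)
    (measurable_exponentialPDF (β := β)) (.of_forall fun s => ENNReal.ofReal_lt_top)).1 hg
  rw [toReal_exponentialPDF_smul_eq hβ, integrable_indicator_iff measurableSet_Ici] at h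
  refine ((h.mono_set Set.Ioi_subset_Ici_self).const_mul β⁻¹).congr (.of_forall fun s => ?_)
  exact inv_mul_cancel_left₀ hβ.ne' _

/-- The distribution function gives the open half-line; the law has a density, so the endpoint
carries no mass. -/
lemma expMeasure_real_Ici (hβ : 0 < β) {r : ℝ} (hr : 0 ≤ r) :
    (expMeasure β).real (Set.Ici r) = Real.exp (-β * r) := by
  have := isProbabilityMeasure_expMeasure hβ
  have h1 : Set.Ioi r =ᵐ[expMeasure β] Set.Ici r :=
    (withDensity_absolutelyContinuous _ _).ae_eq Ioi_ae_eq_Ici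
  have h2 := cdf_expMeasure_eq hβ r
  rw [if_pos hr, cdf_eq_real] at h2
  rw [← measureReal_congr h1, ← Set.compl_Iic, probReal_compl_eq_one_sub measurableSet_Iic, h2]
  ring_nf

end Exponential

namespace Model

variable {Ω : Type*} [MeasurableSpace Ω] {P : Measure Ω} {d : ℕ} (M : Model P d)

/-- The law of the path of the process started in state `i`. -/
def law (i : Fin d) : Measure (PathSpace d) := P.map (M.path i)

lemma hasLaplaceSemigroup [IsProbabilityMeasure P] {α : ℝ} (hα : 0 ≤ α) :
    HasLaplaceSemigroup M.law α (M.F α) where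
  integrable i t := (integrable_map_measure
    (Real.measurable_exp.comp ((measurable_pos t).const_mul _)).aestronglyMeasurable
    (M.measurable_path i).aemeasurable).2 (M.integrable_exp_neg_Y hα t i)
  integral i j t := by
    have hs : MeasurableSet {w : PathSpace d | w.st t = j} :=
      measurable_st t (measurableSet_singleton j)
    have hm : Measurable fun w : PathSpace d => Real.exp (-α * w.pos t) :=
      Real.measurable_exp.comp ((measurable_pos t).const_mul _)
    rw [← M.integral_exp_neg_Y hα t i j, law, setIntegral_map hs hm.aestronglyMeasurable
      (M.measurable_path i).aemeasurable, ← integral_indicator (M.measurable_path i hs)]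
    refine integral_congr_ae (.of_forall fun ω => ?_)
    beta_reduce
    by_cases h : M.J i t ω = j
    · rw [if_pos h, mul_one]
      exact Set.indicator_of_mem (show ω ∈ M.path i ⁻¹' {w : PathSpace d | w.st t = j} from h) _
    · rw [if_neg h, mul_zero]
      exact Set.indicator_of_notMem (show ω ∉ M.path i ⁻¹' {w : PathSpace d | w.st t = j} from h) _

variable {M} {β : ℝ} {T : Ω → ℝ≥0}

namespace IsKillingTime

lemma map_prodMk [IsProbabilityMeasure P] (hT : M.IsKillingTime β T) (i : Fin d) :
    P.map (fun ω => (T ω, M.path i ω)) = (P.map T).prod (M.law i) := by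
  refine (indepFun_iff_map_prod_eq_prod_map_map hT.measurable.aemeasurable
    (M.measurable_path i).aemeasurable).1 ?_
  exact indep_of_indep_of_le_right (hT.indep i) (M.measurable_path_sigmaAlg i).comap_le

lemma map_coe (hT : M.IsKillingTime β T) : (P.map T).map ((↑) : ℝ≥0 → ℝ) = expMeasure β := by
  rw [Measure.map_map measurable_coe_nnreal_real hT.measurable]
  exact hT.law

lemma map_eq (hT : M.IsKillingTime β T) : P.map T = (expMeasure β).map Real.toNNReal := by
  rw [← hT.map_coe, Measure.map_map measurable_real_toNNReal measurable_coe_nnreal_real]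
  have : Real.toNNReal ∘ ((↑) : ℝ≥0 → ℝ) = id := funext fun _ => Real.toNNReal_coe
  rw [this, Measure.map_id]

lemma real_le (hT : M.IsKillingTime β T) (hβ : 0 < β) {h : ℝ≥0∞} (hh : h ≠ ∞) :
    (P.map T).real {t : ℝ≥0 | h ≤ t} = Real.exp (-β * (h.toNNReal : ℝ)) := by
  rw [← expMeasure_real_Ici hβ (NNReal.coe_nonneg _), ← hT.map_coe,
    map_measureReal_apply measurable_coe_nnreal_real measurableSet_Ici]
  congr 1
  ext t
  rw [Set.mem_ofPred_eq, ← ENNReal.coe_toNNReal hh, ENNReal.coe_le_coe]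
  simp

lemma isProbabilityMeasure_map [IsProbabilityMeasure P] (hT : M.IsKillingTime β T) :
    IsProbabilityMeasure (P.map T) :=
  Measure.isProbabilityMeasure_map hT.measurable.aemeasurable

/-- A functional of the path on the event that the killing time exceeds a random time of the
path. -/
lemma setIntegral_le [IsProbabilityMeasure P] (hT : M.IsKillingTime β T) (hβ : 0 < β) (i : Fin d)
    {S : Set (PathSpace d)} (hS : MeasurableSet S) {h : PathSpace d → ℝ≥0∞} (hh : Measurable h)
    (hSh : ∀ w ∈ S, h w ≠ ∞) {g : PathSpace d → ℝ} (hg : Measurable g)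
    (hgi : IntegrableOn g S (M.law i)) :
    ∫ ω in {ω | M.path i ω ∈ S ∧ h (M.path i ω) ≤ T ω}, g (M.path i ω) ∂P =
      ∫ w in S, Real.exp (-β * ((h w).toNNReal : ℝ)) * g w ∂M.law i := by
  have := hT.isProbabilityMeasure_map
  have : IsProbabilityMeasure (M.law i) :=
    Measure.isProbabilityMeasure_map (M.measurable_path i).aemeasurable
  set A : Set (ℝ≥0 × PathSpace d) := {p | p.2 ∈ S ∧ h p.2 ≤ p.1} with hA
  have hAm : MeasurableSet A := (measurable_snd hS).inter
    (measurableSet_le (hh.comp measurable_snd) (measurable_coe_nnreal_ennreal.comp measurable_fst))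
  have hpm : Measurable fun ω => (T ω, M.path i ω) := hT.measurable.prodMk (M.measurable_path i)
  have h1 := setIntegral_map (μ := P) (f := fun p : ℝ≥0 × PathSpace d => g p.2) hAm
    (hg.comp measurable_snd).aestronglyMeasurable hpm.aemeasurable
  rw [hT.map_prodMk i] at h1
  refine h1.symm.trans ?_
  have hint : Integrable (A.indicator fun p : ℝ≥0 × PathSpace d => g p.2)
      ((P.map T).prod (M.law i)) := by
    refine ((hgi.integrable_indicator hS).comp_snd (P.map T)).mono
      ((hg.comp measurable_snd).indicator hAm).aestronglyMeasurable (.of_forall fun p => ?_)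
    by_cases hp : p ∈ A
    · rw [Set.indicator_of_mem hp, Set.indicator_of_mem hp.1]
    · rw [Set.indicator_of_notMem hp, norm_zero]
      exact norm_nonneg _
  -- For a fixed path, integrate over the killing time first: the probability that it is at least `h
  -- w` is the discount factor.
  rw [← integral_indicator hAm, integral_prod_symm _ hint, ← integral_indicator hS]
  refine integral_congr_ae (.of_forall fun w => ?_)
  beta_reduce
  by_cases hw : w ∈ S
  · have hm : MeasurableSet {t : ℝ≥0 | h w ≤ t} := measurable_coe_nnreal_ennreal measurableSet_Ici
    rw [Set.indicator_of_mem hw, ← hT.real_le hβ (hSh w hw), ← smul_eq_mul, ← setIntegral_const,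
      ← integral_indicator hm]
    refine integral_congr_ae (.of_forall fun t => ?_)
    by_cases ht : h w ≤ t
    · rw [Set.indicator_of_mem (show t ∈ {t : ℝ≥0 | h w ≤ t} from ht)]
      exact Set.indicator_of_mem (show (t, w) ∈ A from ⟨hw, ht⟩) _
    · rw [Set.indicator_of_notMem (show t ∉ {t : ℝ≥0 | h w ≤ t} from ht)]
      exact Set.indicator_of_notMem (fun h => ht h.2) _
  · rw [Set.indicator_of_notMem hw]
    refine (integral_congr_ae (.of_forall fun t => ?_)).trans (integral_zero _ _)
    exact Set.indicator_of_notMem (fun h => hw h.1) _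

/-- The expectation of a functional of the path and the killing time. -/
lemma integral_comp [IsProbabilityMeasure P] (hT : M.IsKillingTime β T) (hβ : 0 < β) (i : Fin d)
    {f : ℝ≥0 × PathSpace d → ℝ} (hf : Measurable f)
    (hfi : Integrable (fun ω => f (T ω, M.path i ω)) P) :
    IntegrableOn (fun s : ℝ => Real.exp (-β * s) * ∫ w, f (s.toNNReal, w) ∂M.law i) (Set.Ioi 0) ∧
    ∫ ω, f (T ω, M.path i ω) ∂P =
      β * ∫ s in Set.Ioi (0 : ℝ), Real.exp (-β * s) * ∫ w, f (s.toNNReal, w) ∂M.law i := by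
  have := hT.isProbabilityMeasure_map
  have : IsProbabilityMeasure (M.law i) :=
    Measure.isProbabilityMeasure_map (M.measurable_path i).aemeasurable
  have hpm : Measurable fun ω => (T ω, M.path i ω) := hT.measurable.prodMk (M.measurable_path i)
  have hint := (integrable_map_measure hf.aestronglyMeasurable hpm.aemeasurable).2 hfi
  have hm := hf.stronglyMeasurable.integral_prod_right' (ν := M.law i)
  rw [hT.map_prodMk i] at hint
  constructor
  · have h1 := hint.integral_prod_left
    rw [hT.map_eq] at h1
    exact integrableOn_of_integrable_expMeasure hβ ((integrable_map_measure
      hm.aestronglyMeasurable measurable_real_toNNReal.aemeasurable).1 h1)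
  · rw [← integral_map hpm.aemeasurable hf.aestronglyMeasurable, hT.map_prodMk i,
      integral_prod _ hint, hT.map_eq, integral_map measurable_real_toNNReal.aemeasurable
      hm.aestronglyMeasurable, integral_expMeasure hβ]

end IsKillingTime

end Model

/-! ### Identification of the matrices and conclusion. -/

open PathSpace

namespace Model

variable {Ω : Type*} [MeasurableSpace Ω] {P : Measure Ω} [IsProbabilityMeasure P] {d : ℕ}
  {M : Model P d} {α β : ℝ} {T : Ω → ℝ≥0}

/-- Survival up to the passage time has conditional probability `e^{-βσ}` given the path. As the
killing time is finite, the event forces the passage time to be finite. -/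
lemma deltaMinus_eq (hT : M.IsKillingTime β T) (hβ : 0 < β) (a b : ℝ) :
    M.deltaMinus T a b = lowTransform M.law β a b := by
  have : ∀ i, IsProbabilityMeasure (M.law i) := M.isMAP.prob
  ext i j
  have hL : MeasurableSet {w : PathSpace d | hit (lowSet a) w.pos ≤ hit (upSet b) w.pos} :=
    measurableSet_le (measurable_hit_pos (isOpen_lowSet a)) (measurable_hit_pos (isOpen_upSet b))
  have h := hT.setIntegral_le hβ i ((measurableSet_hitSet (isOpen_lowSet a) j).inter hL)
    (measurable_hit_pos (isOpen_lowSet a)) (fun w hw => hw.1.1) (g := fun _ => 1) measurable_const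
    (integrable_const _)
  rw [setIntegral_const, smul_eq_mul, mul_one] at h
  simp only [mul_one] at h
  refine Eq.trans ?_ h
  simp only [deltaMinus, Matrix.of_apply]
  congr 1
  ext ω
  refine ⟨fun h => ?_, fun h => ⟨le_min h.1.2 h.2, h.1.1.2⟩⟩
  exact ⟨⟨⟨ne_top_of_le_ne_top ENNReal.coe_ne_top (h.1.trans (min_le_right _ _)), h.2⟩,
    h.1.trans (min_le_left _ _)⟩, h.1.trans (min_le_right _ _)⟩

lemma eta_eq (hT : M.IsKillingTime β T) (hα : 0 ≤ α) (hβ : 0 < β) (u : ℝ) :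
    M.eta T u α = upTransform M.law α β u := by
  have : ∀ i, IsProbabilityMeasure (M.law i) := M.isMAP.prob
  ext i j
  have hm : Measurable fun w : PathSpace d =>
      Real.exp (-α * (w.pos (hit (upSet u) w.pos).toNNReal - u)) :=
    Real.measurable_exp.comp (((measurable_pos_comp
      (measurable_hit_pos (isOpen_upSet u)).ennreal_toNNReal measurable_id).sub_const _).const_mul _)
  have hS := measurableSet_hitSet (d := d) (isOpen_upSet u) j
  have h := hT.setIntegral_le hβ i hS (measurable_hit_pos (isOpen_upSet u)) (fun w hw => hw.1) hm <|
    by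
      refine Integrable.of_bound hm.aestronglyMeasurable 1 ?_
      filter_upwards [ae_restrict_mem hS] with w hw
      rw [Real.norm_of_nonneg (Real.exp_pos _).le, Real.exp_le_one_iff]
      nlinarith [le_pos_hit_upSet hw.1]
  refine Eq.trans ?_ h
  simp only [eta, Matrix.of_apply]
  congr 2
  ext ω
  exact ⟨fun h => ⟨⟨ne_top_of_le_ne_top ENNReal.coe_ne_top h.1, h.2⟩, h.1⟩,
    fun h => ⟨h.2, h.1.2⟩⟩

/-- The killing time has density `βe^{-βs}`, and up to the exit the integrand is at most `e^{αx}`,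
so integrability needs no assumption on `Y` at the killing time. -/
lemma deltaStar_eq (hT : M.IsKillingTime β T) (hα : 0 ≤ α) (hβ : 0 < β) (K : ℝ) {x : ℝ}
    (hx : 0 ≤ x) : M.deltaStar T K α x =
      Real.exp (-α * x) • (β • killedResolvent M.law α β x (K - x)) := by
  have : ∀ i, IsProbabilityMeasure (M.law i) := M.isMAP.prob
  ext i j
  have hf := measurable_ite_le_hit α x (K - x) j
  have hpm : Measurable fun ω => (T ω, M.path i ω) := hT.measurable.prodMk (M.measurable_path i)
  have hset : {ω | (T ω : ℝ≥0∞) ≤ min (M.sigma i x ω) (M.tau i (K - x) ω) ∧ M.J i (T ω) ω = j} =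
      {ω | (T ω : ℝ≥0∞) ≤ hit (exitSet x (K - x)) (M.path i ω).pos ∧ (M.path i ω).st (T ω) = j} := by
    simp only [exitSet, hit_union]
    rfl
  have hSm : MeasurableSet {ω | (T ω : ℝ≥0∞) ≤ hit (exitSet x (K - x)) (M.path i ω).pos ∧
      (M.path i ω).st (T ω) = j} :=
    (measurableSet_le (measurable_coe_nnreal_ennreal.comp hT.measurable)
      ((measurable_hit_pos (isOpen_exitSet x (K - x))).comp (M.measurable_path i))).inter
      (measurable_st_comp hT.measurable (M.measurable_path i) (measurableSet_singleton j))
  have h := (hT.integral_comp hβ i hf <| by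
    refine Integrable.of_bound (hf.comp hpm).aestronglyMeasurable (Real.exp (α * x))
      (.of_forall fun ω => ?_)
    split_ifs with h
    · rw [Real.norm_of_nonneg (Real.exp_pos _).le, Real.exp_le_exp]
      have h1 := h.1
      rw [exitSet, hit_union] at h1
      nlinarith [neg_le_pos_of_le_hit hx (h1.trans (min_le_left _ _))]
    · rw [norm_zero]
      exact (Real.exp_pos _).le).2
  simp only [deltaStar, killedResolvent, Matrix.of_apply, Matrix.smul_apply, smul_eq_mul]
  simp_rw [← killed_eq_integral] at h
  rw [hset, ← h, ← integral_indicator hSm]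
  congr 1
  simp only [Set.indicator_apply, Set.mem_ofPred_eq, pos_path]

/-- The resolvent of the matrix semigroup generated by `F(α)`. -/
lemma phi_eq (hT : M.IsKillingTime β T) (hα : 0 ≤ α) (hβ : 0 < β)
    (hi : ∀ i, Integrable (fun ω => Real.exp (-α * M.Y i (T ω) ω)) P) (i j : Fin d) :
    IntegrableOn (fun s : ℝ => Real.exp (-β * s) * expEntry (M.F α) s i j) (Set.Ioi 0) ∧
    M.Phi T α i j = β * ∫ s in Set.Ioi (0 : ℝ), Real.exp (-β * s) * expEntry (M.F α) s i j := by
  have hf : Measurable fun p : ℝ≥0 × PathSpace d =>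
      if p.2.st p.1 = j then Real.exp (-α * p.2.pos p.1) else 0 :=
    Measurable.ite (measurable_st_uncurry (measurableSet_singleton j))
      (Real.measurable_exp.comp (measurable_pos_uncurry.const_mul _)) measurable_const
  have hSm : MeasurableSet {ω | M.J i (T ω) ω = j} :=
    measurable_st_comp hT.measurable (M.measurable_path i) (measurableSet_singleton j)
  have hite : (fun ω => if (M.path i ω).st (T ω) = j then
      Real.exp (-α * (M.path i ω).pos (T ω)) else 0) =
      {ω | M.J i (T ω) ω = j}.indicator fun ω => Real.exp (-α * M.Y i (T ω) ω) := by
    ext ω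
    simp only [Set.indicator_apply, Set.mem_ofPred_eq, pos_path, st_path]
    congr
  have h := hT.integral_comp hβ i hf (by
    rw [hite]
    exact (hi i).indicator hSm)
  have hE : Set.EqOn (fun s : ℝ => Real.exp (-β * s) * ∫ w, (if w.st s.toNNReal = j then
      Real.exp (-α * w.pos s.toNNReal) else 0) ∂M.law i)
      (fun s => Real.exp (-β * s) * expEntry (M.F α) s i j) (Set.Ioi 0) := by
    intro s hs
    have h1 := (M.hasLaplaceSemigroup hα).integral i j s.toNNReal
    have hm : MeasurableSet {w : PathSpace d | w.st s.toNNReal = j} :=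
      measurable_st _ (measurableSet_singleton j)
    rw [Real.coe_toNNReal s (le_of_lt hs), ← integral_indicator hm] at h1
    beta_reduce
    rw [expEntry, ← h1]
    simp only [Set.indicator_apply, Set.mem_ofPred_eq]
  refine ⟨h.1.congr_fun hE measurableSet_Ioi, ?_⟩
  have h2 := h.2
  beta_reduce at h2
  rw [setIntegral_congr_fun measurableSet_Ioi hE, hite, integral_indicator hSm] at h2
  exact h2

/-- Integrability at the killing time makes `e^{-βs} exp(sF)` and its derivative integrable on `(0,
∞)`, so the function vanishes at infinity. The integral of the derivative is then minus the
identity. -/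
lemma phi_mul (hT : M.IsKillingTime β T) (hα : 0 ≤ α) (hβ : 0 < β)
    (hi : ∀ i, Integrable (fun ω => Real.exp (-α * M.Y i (T ω) ω)) P) :
    M.Phi T α * (β • (1 : Matrix (Fin d) (Fin d) ℝ) - M.F α) = β • 1 := by
  have hphi := phi_eq hT hα hβ hi
  ext i l
  have hd : ∀ s : ℝ, discounted (M.F α) β s i l = ∑ j, Real.exp (-β * s) *
      expEntry (M.F α) s i j * (β • (1 : Matrix (Fin d) (Fin d) ℝ) - M.F α) j l := fun s => by
    simp only [discounted, Finset.mul_sum, mul_assoc]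
  have hint : IntegrableOn (fun s => discounted (M.F α) β s i l) (Set.Ioi 0) := by
    simp_rw [hd]
    exact integrable_finsetSum _ fun j _ => (hphi i j).1.mul_const _
  have hder := fun s => hasDerivAt_discounted (M.F α) β s i l
  have h0 := tendsto_zero_of_hasDerivAt_of_integrableOn_Ioi (a := 0) (fun s _ => hder s) hint.neg
    (hphi i l).1
  have h1 := integral_Ioi_of_hasDerivAt_of_tendsto' (a := 0) (fun s _ => hder s) hint.neg h0
  rw [integral_neg, mul_zero, Real.exp_zero, one_mul, expEntry_zero, zero_sub, neg_inj] at h1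
  simp_rw [hd] at h1
  rw [integral_finsetSum _ fun j _ => (hphi i j).1.mul_const _] at h1
  rw [Matrix.mul_apply, Matrix.smul_apply, ← h1, smul_eq_mul, Finset.mul_sum]
  refine Finset.sum_congr rfl fun j _ => ?_
  rw [(hphi i j).2, integral_mul_const, mul_assoc]

/-- The resolvent equation with `a = x` and `b = K - x`, solved by inverting `βI - F`. Positivity of
`a + b = K` separates the two boundaries, also when `x` is an endpoint. -/
theorem deltaStar_eq_mul_inv (hT : M.IsKillingTime β T) (hα : 0 ≤ α) (hβ : 0 < β) {K x : ℝ}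
    (hK : 0 < K) (hx : 0 ≤ x) (hdet : IsUnit (β • (1 : Matrix (Fin d) (Fin d) ℝ) - M.F α).det) :
    M.deltaStar T K α x =
      Real.exp (-α * x) •
        ((1 - Real.exp (α * x) • M.deltaMinus T x (K - x)
            - Real.exp (-α * (K - x)) • M.eta T (K - x) α
            + Real.exp (-α * (K - x)) • (M.deltaMinus T x (K - x) * M.eta T K α)) *
          (β • (β • (1 : Matrix (Fin d) (Fin d) ℝ) - M.F α)⁻¹)) := by
  have h1 := killedResolvent_mul (μ := M.law) (b := K - x) M.isMAP (M.hasLaplaceSemigroup hα) hα hβ hx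
  have hab : x + (K - x) = K := add_sub_cancel x K
  rw [exitTransform_eq (μ := M.law) M.isMAP hα hβ.le hx (hab.symm ▸ hK), hab] at h1
  have h2 : killedResolvent M.law α β x (K - x) = _ :=
    (Matrix.mul_nonsing_inv_cancel_right _ _ hdet).symm
  rw [h1] at h2
  rw [deltaStar_eq hT hα hβ K hx, h2, deltaMinus_eq hT hβ, eta_eq hT hα hβ, eta_eq hT hα hβ,
    Matrix.mul_smul]
  congr 3
  abel

end Model

end MAPQueue

end

theorem mainTheorem4 {Ω : Type*} [MeasurableSpace Ω] (P : Measure Ω) [IsProbabilityMeasure P]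
    {d : ℕ} (M : MAPQueue.Model P d) (K : ℝ) (hK : 0 < K) (α β : ℝ) (hα : 0 ≤ α) (hβ : 0 < β)
    (T : Ω → ℝ≥0) (hT : M.IsKillingTime β T) (x : ℝ) (hx : x ∈ Set.Icc 0 K) :
    (IsUnit (β • (1 : Matrix (Fin d) (Fin d) ℝ) - M.F α).det →
      M.deltaStar T K α x =
        Real.exp (-α * x) •
          ((1 - Real.exp (α * x) • M.deltaMinus T x (K - x)
              - Real.exp (-α * (K - x)) • M.eta T (K - x) α
              + Real.exp (-α * (K - x)) • (M.deltaMinus T x (K - x) * M.eta T K α)) *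
            (β • (β • (1 : Matrix (Fin d) (Fin d) ℝ) - M.F α)⁻¹))) ∧
    ((∀ i, Integrable (fun ω => Real.exp (-α * M.Y i (T ω) ω)) P) →
      IsUnit (β • (1 : Matrix (Fin d) (Fin d) ℝ) - M.F α).det ∧
      M.Phi T α = β • (β • (1 : Matrix (Fin d) (Fin d) ℝ) - M.F α)⁻¹ ∧
      M.deltaStar T K α x =
        Real.exp (-α * x) •
          ((1 - Real.exp (α * x) • M.deltaMinus T x (K - x)
              - Real.exp (-α * (K - x)) • M.eta T (K - x) α
              + Real.exp (-α * (K - x)) • (M.deltaMinus T x (K - x) * M.eta T K α)) *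
            M.Phi T α)) := by
  refine ⟨fun h => MAPQueue.Model.deltaStar_eq_mul_inv hT hα hβ hK hx.1 h, fun hi => ?_⟩
  have h1 := MAPQueue.Model.phi_mul hT hα hβ hi
  have h2 : (β⁻¹ • M.Phi T α) * (β • (1 : Matrix (Fin d) (Fin d) ℝ) - M.F α) = 1 := by
    rw [Matrix.smul_mul, h1, inv_smul_smul₀ hβ.ne']
  -- For square matrices a one-sided inverse suffices, so invertibility is a consequence here and
  -- not an assumption.
  have hdet := Matrix.isUnit_det_of_left_inverse h2
  have hphi : M.Phi T α = β • (β • (1 : Matrix (Fin d) (Fin d) ℝ) - M.F α)⁻¹ := by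
    rw [Matrix.inv_eq_left_inv h2, smul_inv_smul₀ hβ.ne']
  refine ⟨hdet, hphi, ?_⟩
  rw [hphi]
  exact MAPQueue.Model.deltaStar_eq_mul_inv hT hα hβ hK hx.1 hdet
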